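/- Conventions. A $d$-dimensional register of $N$ qubits is a set of $N$ qubits located at the points of a finite set $\Lambda\subset\mathbb Z^d$, $|\Lambda|=N$; two sites are neighbours if their $\ell^1$-distance is $1$. Fix a locality $m\ge 2$. A layer partitions the sites into connected groups of at most $m$ sites, and every group undergoes a unitary gate (possibly the identity) or, if it is a single site, possibly a RESET $\rho\mapsto \mathrm{Tr}(\rho)\,|0\rangle\langle 0|$; the layer is unitary if it contains no RESET. A noisy circuit of depth $D$ with single-qubit noise channel $\mathcal N$ consists of $D$ layers, each followed by $\mathcal N$ on every qubit (idle ones included). For a single-qubit channel $\mathcal N$ the strength is $\kappa=\|\mathcal N-\mathcal I\|_\diamond$; $\mathcal N$ is contracting with constant $\Delta>0$ if $\|\mathcal N(\rho-\sigma)\|_1\le(1-\Delta\kappa)\|\rho-\sigma\|_1$ for all states $\rho,\sigma$; the purity of a fixed point $\sigma^*$ is $\eta=\sqrt{2\,\mathrm{Tr}[(\sigma^*)^2]-1}$. Noisy unitary circuits of depth $D$ on $\Lambda$ with noise $\mathcal N$ simulate a circuit on $\Lambda'$ with noise $\mathcal N'$ if there are injective placements of its input and output qubits at sites of $\Lambda$,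 and a finite probability distribution (independent of the input state) over unitary circuits of depth $D$ on $\Lambda$, such that for every input state, placed at the input sites with all other qubits in $|0\rangle$, the reduced state at the output sites, averaged over the random choice of the circuit, equals the output of the simulated noisy circuit. Statement. Let $d\ge1$, $m\ge 2$, $\delta>0$, $\Delta>0$, $c>0$ and $\mu=\frac{\log 3}{\log(3/2)}+\delta$. There are constants $C>0$ and $q\in\mathbb N$, depending only on $d,m,\delta,\Delta,c$, such that the following holds. Let $\mathcal N$ be a single-qubit channel of strength $\kappa>0$ that is contracting with constant $\Delta$ and has a fixed point of purity $\eta>0$, and let $\kappa\le c\,\eta^{\mu/d}$. Put $x=\kappa\eta^{-\mu/d}$. Then there is a single-qubit channel $\mathcal N'$ with $$\|\mathcal N'-\mathcal I\|_\diamond\le C\,x^{d/(\mu+d)}\,(1+|\log x|)^q ,$$ such that for every finite $\Lambda'\subset\mathbb Z^d$ with $N'=|\Lambda'|$ there is a finite $\Lambda\subset\mathbb Z^d$ with $N=|\Lambda|$, $$N\le C\,(\kappa\eta)^{-\mu d/(\mu+d)}\,(1+|\log x|)^q\,N',$$ and for every $D'\in\mathbb N$ there is $D\in\mathbb N$ with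 $$D\le C\,(\kappa\eta)^{-\mu/(\mu+d)}\,D',$$ such that every depth-$D'$ circuit of unitary gates and RESETs on $\Lambda'$ with noise $\mathcal N'$ is simulated by noisy unitary circuits of depth $D$ on $\Lambda$ with noise $\mathcal N$. -/

import Mathlib

noncomputable section

open scoped ComplexOrder

namespace NoisyCircuit

/-! ### Single-qubit channels -/

/-- Linear maps on the `2 × 2` complex matrices (single-qubit superoperators). -/
abbrev QubitMap : Type := Matrix (Fin 2) (Fin 2) ℂ →ₗ[ℂ] Matrix (Fin 2) (Fin 2) ℂ

/-- The trace norm `‖M‖₁ = Tr √(Mᴴ M)`, i.e. the sum of the singular values of `M`. -/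
def traceNorm {n : Type*} [Fintype n] [DecidableEq n] (M : Matrix n n ℂ) : ℝ :=
  ∑ i, Real.sqrt ((Matrix.isHermitian_conjTranspose_mul_self M).eigenvalues i)

/-- Density matrices: positive semidefinite of trace one. -/
def IsDensity {n : Type*} [Fintype n] (ρ : Matrix n n ℂ) : Prop :=
  ρ.PosSemidef ∧ ρ.trace = 1

/-- Completely positive trace-preserving maps of one qubit, in Kraus form. -/
def IsChannel (Φ : QubitMap) : Prop :=
  ∃ (r : ℕ) (K : Fin r → Matrix (Fin 2) (Fin 2) ℂ),
    (∑ i, (K i).conjTranspose * K i = 1) ∧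
      ∀ ρ : Matrix (Fin 2) (Fin 2) ℂ, Φ ρ = ∑ i, K i * ρ * (K i).conjTranspose

/-- The map `Φ ⊗ id`, where the second factor is a reference qubit. -/
def withReference (Φ : QubitMap) (X : Matrix (Fin 2 × Fin 2) (Fin 2 × Fin 2) ℂ) :
    Matrix (Fin 2 × Fin 2) (Fin 2 × Fin 2) ℂ :=
  Matrix.of fun a b => Φ (Matrix.of fun i j => X (i, a.2) (j, b.2)) a.1 b.1

/-- The diamond norm `‖Φ‖_⋄ = sup {‖(Φ ⊗ id) X‖₁ : ‖X‖₁ ≤ 1}`, where the reference system has the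
dimension of the input of `Φ`. -/
def diamondNorm (Φ : QubitMap) : ℝ :=
  sSup {r : ℝ | ∃ X : Matrix (Fin 2 × Fin 2) (Fin 2 × Fin 2) ℂ,
    traceNorm X ≤ 1 ∧ r = traceNorm (withReference Φ X)}

/-- The strength `‖𝒩 - id‖_⋄` of a noise channel. -/
def strength (N : QubitMap) : ℝ := diamondNorm (N - LinearMap.id)

/-- The noise channel contracts the trace distance of states at a rate of at least `Δ` times its
strength. -/
def IsContracting (Δ : ℝ) (N : QubitMap) : Prop :=
  ∀ ρ σ : Matrix (Fin 2) (Fin 2) ℂ, IsDensity ρ → IsDensity σ →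
    traceNorm (N (ρ - σ)) ≤ (1 - Δ * strength N) * traceNorm (ρ - σ)

/-- The purity parameter `√(2 Tr σ² - 1)` of a single-qubit state. -/
def purity (σ : Matrix (Fin 2) (Fin 2) ℂ) : ℝ :=
  Real.sqrt (2 * ((σ * σ).trace).re - 1)

/-! ### Many-qubit operators -/

/-- Operators on the qubits located at the sites `V`, in the computational basis `V → {0, 1}`. -/
abbrev Operator (V : Type*) : Type _ := Matrix (V → Fin 2) (V → Fin 2) ℂ

/-- The operation carried out on a group `S` of sites: a unitary gate or a RESET. -/
inductive LocalOp (S : Type*) [Fintype S] [DecidableEq S] where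
  | gate (U : Matrix.unitaryGroup (S → Fin 2) ℂ) : LocalOp S
  | reset : LocalOp S

/-- A gate maps `ρ` to `U ρ Uᴴ`; a RESET maps `ρ` to `Tr(ρ) |0⟩⟨0|`. -/
def LocalOp.apply {S : Type*} [Fintype S] [DecidableEq S] :
    LocalOp S → Operator S → Operator S
  | .gate U, ρ => (U : Operator S) * ρ * (U : Operator S).conjTranspose
  | .reset, ρ => ρ.trace • Matrix.single 0 0 1

/-- One layer of a circuit whose sites are the vertices of `G`: the sites are partitioned into
connected groups of at most `m` sites; every group undergoes one operation (idling is the identity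
gate on a single site), and RESETs act on single sites. -/
structure Layer {V : Type*} [Fintype V] [DecidableEq V] (G : SimpleGraph V) (m : ℕ) where
  parts : Finpartition (Finset.univ : Finset V)
  card_le : ∀ P ∈ parts.parts, P.card ≤ m
  connected : ∀ P ∈ parts.parts, (G.induce (P : Set V)).Connected
  op : (P : Finset V) → LocalOp P
  reset_single : ∀ P ∈ parts.parts, op P = LocalOp.reset → P.card = 1

section

variable {V : Type*} [Fintype V] [DecidableEq V] {G : SimpleGraph V} {m : ℕ}

/-- The tensor product, over the groups of the layer, of the operations on the groups. It is
determined by linearity from `|y⟩⟨y'| ↦ ⨂_P op_P(|y_P⟩⟨y'_P|)`. -/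
def Layer.apply (L : Layer G m) (ρ : Operator V) : Operator V :=
  Matrix.of fun x x' => ∑ y, ∑ y',
    (∏ P ∈ L.parts.parts,
      (L.op P).apply (Matrix.single (P.restrict y) (P.restrict y') 1)
        (P.restrict x) (P.restrict x')) * ρ y y'

/-- The layer contains no RESET. -/
def Layer.IsUnitary (L : Layer G m) : Prop :=
  ∀ P ∈ L.parts.parts, L.op P ≠ LocalOp.reset

/-- The tensor power `𝒩^{⊗ V}`: the single-qubit noise `𝒩` acts on every qubit. -/
def noiseLayer (N : QubitMap) (ρ : Operator V) : Operator V :=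
  Matrix.of fun x x' => ∑ y, ∑ y',
    (∏ v, N (Matrix.single (y v) (y' v) 1) (x v) (x' v)) * ρ y y'

/-- Run the layers of a circuit one after the other, each followed by the noise `𝒩` on every
qubit, idle ones included. The depth of the circuit is the length of the list. -/
def runNoisy (N : QubitMap) : List (Layer G m) → Operator V → Operator V
  | [], ρ => ρ
  | L :: Ls, ρ => runNoisy N Ls (noiseLayer N (L.apply ρ))

end

/-- Place the qubits `W` at the sites `e(W)`, with all the other qubits of `V` in the state `|0⟩`. -/
def embedState {W V : Type*} [Fintype V] (e : W ↪ V) (ρ : Operator W) : Operator V :=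
  open Classical in
  Matrix.of fun x x' =>
    if (∀ v, v ∉ Set.range e → x v = 0 ∧ x' v = 0) then ρ (x ∘ e) (x' ∘ e) else 0

/-- The reduced operator of the qubits at the sites `e(W)`: trace out all the other qubits. -/
def reduceState {W V : Type*} [Fintype V] (e : W ↪ V) (σ : Operator V) : Operator W :=
  open Classical in
  Matrix.of fun x x' => ∑ z : V → Fin 2, ∑ z' : V → Fin 2,
    if (z ∘ e = x ∧ z' ∘ e = x' ∧ ∀ v, v ∉ Set.range e → z v = z' v) then σ z z' else 0

/-- The circuit `target` on the qubits `W`, which may contain RESETs and runs under the noise `N'`,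
is simulated at depth `D` by noisy unitary circuits under the noise `N` on the qubits `V`: for some
placements of the input and of the output qubits and some random choice among finitely many
circuits of depth `D` without RESET (the choice does not depend on the input state), the output,
averaged over the choice, equals that of the target circuit for every input. -/
def Simulates {V W : Type*} [Fintype V] [DecidableEq V] [Fintype W] [DecidableEq W] {m : ℕ}
    (G : SimpleGraph V) {H : SimpleGraph W} (N : QubitMap) (D : ℕ)
    (N' : QubitMap) (target : List (Layer H m)) : Prop :=
  ∃ (input output : W ↪ V) (K : ℕ) (p : Fin K → ℝ) (c : Fin K → List (Layer G m)),
    (∀ k, 0 ≤ p k) ∧ (∑ k, p k = 1) ∧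
    (∀ k, (c k).length = D ∧ ∀ L ∈ c k, L.IsUnitary) ∧
    ∀ ρ : Operator W,
      reduceState output (∑ k, (p k : ℂ) • runNoisy N (c k) (embedState input ρ)) =
        runNoisy N' target ρ

/-! ### The lattice -/

/-- The nearest-neighbour graph on a finite set of sites of `ℤ^d`. -/
def latticeGraph {d : ℕ} (Λ : Finset (Fin d → ℤ)) : SimpleGraph Λ where
  Adj x y := ∑ i, |x.1 i - y.1 i| = 1
  symm := ⟨fun x y h => by
    simpa only [abs_sub_comm] using h⟩
  loopless := ⟨fun x h => by simp at h⟩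

end NoisyCircuit

end

/-!
The noise itself is the only source of cold qubits. A qubit that idles under contracting noise
approaches the fixed point of the noise and so acquires a polarization proportional to `η` (the
polarization `b` of a diagonal state is the difference of its eigenvalues). Majority votes increase
polarizations, which produces almost pure qubits; exchanged with the qubits of the simulated
circuit, these implement the RESETs.

*The gadget.* Four two-qubit gates put the majority of three qubits of polarization `b` into one of
them, which then has the polarization `(3 * b - b ^ 3) / 2` (`red1_majority`). Gates leave the
completely mixed state invariant and the noise moves it by `O(κ η)` per step. So during `t` noisy
steps a gadget whose qubits are at the distance `O(b)` from this state loses only `O(κ t (b + η))`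
of polarization (`exists_gadget`), and it works for arbitrarily small `b`.

*Recursive cooling.* A box of side length `s = 3 ^ l` in `ℤ ^ d` is composed of three boxes, each of
these of three smaller ones, and so on over `d * l` levels, with the directions of the subdivisions
in turn. A gadget acts on the corners of the three boxes of each level (`exists_cooling`). Qubits
are moved along paths by exchanges; the noise is the same at all sites and so commutes with them,
hence motion costs nothing but time (`reach_pairs`). The time is dominated by the last levels and is
`O(s)`. While the polarization is small, it grows by almost `3 / 2` in each level. Since the
exponent `μ` exceeds `log 3 / log (3 / 2)`, boxes with `s ^ d ≥ β ^ (-μ)` sites suffice to start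
from a polarization `β` and to end with a defect `O(κ s)` (`exists_polarizations`).

*The simulation.* The qubits of the register are spread out, and each one has a box next to its
home. In one round the qubits of each group of a layer gather, the gates are applied, the qubits to be
reset are exchanged for the cooled ones, all other sites are depolarized, the qubits return, and
boxes are cooled again (`exists_arrangement`, `exists_simulation`). The noise of the simulated
circuit is that of the `T = O(s)` steps of one round, together with random bit flips that are added
to all qubits so that reset qubits and the others have exactly the same noise. Its strength is
`O(κ s)`.

*Parameters.* Let `τ = (κ η) ^ (-μ / (μ + d))`. Then `κ τ = x ^ (d / (μ + d))`, and the polarization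
`β = κ τ η`, which waiting for a time of order `τ` provides, satisfies `τ ^ d = β ^ (-μ)`. So side
lengths of order `τ` are both sufficient for the cooling and of the claimed size
(`exists_hasSimulation_of_ge`). If `κ τ` is bounded below, the claimed bound on the strength is a
constant, and completely depolarized qubits may replace the cold ones
(`exists_hasSimulation_of_le`). Logarithmic factors do not occur.

Superoperators are represented as matrices on tensors with one label `(i, j)` per site, such that
tensor products, partial traces and permutations of sites become manipulations of finite products.
-/

noncomputable section

open scoped ComplexOrder Matrix

set_option linter.unusedSectionVars false

namespace NoisyCircuit

/-! ### Tensors and kernels -/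

/-- Labels `(i, j)` of the matrix units `|i⟩⟨j|` of one qubit. -/
abbrev Lab : Type := Fin 2 × Fin 2

/-- Operators on the qubits `S`, as tensors with one label per site. -/
abbrev Ten (S : Type*) : Type _ := (S → Lab) → ℂ

/-- Superoperators on the qubits `S`, as matrices acting on tensors. -/
abbrev Ker (S : Type*) : Type _ := Matrix (S → Lab) (S → Lab) ℂ

/-- The trace functional of one qubit. -/
def trw (b : Lab) : ℂ := if b.1 = b.2 then 1 else 0

/-- The tensor of an operator. -/
def vec {S : Type*} (ρ : Operator S) : Ten S := fun z => ρ (fun v => (z v).1) (fun v => (z v).2)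

/-- The operator of a tensor. -/
def unvec {S : Type*} (t : Ten S) : Operator S := Matrix.of fun x x' => t fun v => (x v, x' v)

@[simp] lemma unvec_vec {S : Type*} (ρ : Operator S) : unvec (vec ρ) = ρ := rfl

lemma vec_injective {S : Type*} : Function.Injective (vec (S := S)) :=
  fun a b h => by rw [← unvec_vec a, h, unvec_vec]

/-- Pairs of configurations are configurations of labels. -/
def pairEquiv (S : Type*) : (S → Lab) ≃ (S → Fin 2) × (S → Fin 2) :=
  Equiv.arrowProdEquivProdArrow S (fun _ => Fin 2) (fun _ => Fin 2)

lemma sum_pair {S : Type*} [Fintype S] [DecidableEq S] (F : (S → Fin 2) → (S → Fin 2) → ℂ) :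
    ∑ y, ∑ y', F y y' = ∑ z : S → Lab, F (fun v => (z v).1) (fun v => (z v).2) := by
  rw [← Fintype.sum_prod_type', ← (pairEquiv S).sum_comp]
  rfl

section site

variable {S : Type*} [Fintype S] [DecidableEq S]

/-- The tensor product of single-site kernels. -/
def siteKer (k : S → Matrix Lab Lab ℂ) : Ker S := Matrix.of fun x y => ∏ v, k v (x v) (y v)

lemma siteKer_apply (k : S → Matrix Lab Lab ℂ) (x y) : siteKer k x y = ∏ v, k v (x v) (y v) := rfl

lemma siteKer_mul (k k' : S → Matrix Lab Lab ℂ) :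
    siteKer k * siteKer k' = siteKer fun v => k v * k' v := by
  ext x y
  simp only [Matrix.mul_apply, siteKer_apply, ← Finset.prod_mul_distrib]
  rw [Finset.prod_univ_sum, Fintype.piFinset_univ]

lemma siteKer_one : siteKer (fun _ : S => (1 : Matrix Lab Lab ℂ)) = 1 := by
  ext x y
  simp only [siteKer_apply, Matrix.one_apply, Finset.prod_ite_zero, Finset.prod_const_one,
    funext_iff, Finset.mem_univ, true_implies]

lemma siteKer_pow (k : Matrix Lab Lab ℂ) (t : ℕ) :
    siteKer (fun _ : S => k) ^ t = siteKer fun _ : S => k ^ t := by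
  induction t with
  | zero => simp [siteKer_one]
  | succ t ih => rw [pow_succ, ih, siteKer_mul]; simp [pow_succ]

/-- The product tensor. -/
def prodTen (a : S → Lab → ℂ) : Ten S := fun x => ∏ v, a v (x v)

lemma siteKer_mulVec_prodTen (k : S → Matrix Lab Lab ℂ) (a : S → Lab → ℂ) :
    siteKer k *ᵥ prodTen a = prodTen fun v => k v *ᵥ a v := by
  ext x
  simp only [Matrix.mulVec, dotProduct, siteKer_apply, prodTen, ← Finset.prod_mul_distrib]
  rw [Finset.prod_univ_sum, Fintype.piFinset_univ]

/-- Tensor products of trace-preserving kernels preserve the trace. -/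
lemma sum_prod_trw_mul (k : S → Matrix Lab Lab ℂ) (hk : ∀ v y, ∑ x, trw x * k v x y = trw y)
    (y : S → Lab) : ∑ x : S → Lab, (∏ v, trw (x v)) * siteKer k x y = ∏ v, trw (y v) := by
  have h := Finset.prod_univ_sum (fun _ : S => Finset.univ)
    (fun v (b : Lab) => trw b * k v b (y v))
  simp only [hk, Fintype.piFinset_univ] at h
  simp only [h, siteKer_apply, ← Finset.prod_mul_distrib]

end site

/-- The kernel of a single-qubit superoperator. -/
def qker (Φ : QubitMap) : Matrix Lab Lab ℂ :=
  Matrix.of fun x y => Φ (Matrix.single y.1 y.2 1) x.1 x.2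

lemma vec_noiseLayer {V : Type*} [Fintype V] [DecidableEq V] (N : QubitMap) (ρ : Operator V) :
    vec (noiseLayer N ρ) = siteKer (fun _ => qker N) *ᵥ vec ρ := by
  ext x
  simp only [vec, noiseLayer, Matrix.of_apply, Matrix.mulVec, dotProduct, siteKer_apply, qker]
  rw [sum_pair (fun y y' => (∏ v, N (Matrix.single (y v) (y' v) 1) (x v).1 (x v).2) * ρ y y')]

/-- The kernel of the conjugation by a matrix. -/
def conjKer {S : Type*} (U : Matrix (S → Fin 2) (S → Fin 2) ℂ) : Ker S :=
  Matrix.of fun x y => U (fun v => (x v).1) (fun v => (y v).1) *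
    star (U (fun v => (x v).2) (fun v => (y v).2))

/-- The kernel of an operation on a group of sites. -/
def opKer {S : Type*} [Fintype S] [DecidableEq S] : LocalOp S → Ker S
  | .gate U => conjKer (U : Operator S)
  | .reset => Matrix.of fun x y => (if x = 0 then 1 else 0) * ∏ v, trw (y v)

lemma trace_single_eq {S : Type*} [Fintype S] [DecidableEq S] (y y' : S → Fin 2) :
    (Matrix.single y y' (1 : ℂ)).trace = ∏ v, trw (y v, y' v) := by
  simp only [trw, Finset.prod_ite_zero, Finset.prod_const_one]
  by_cases h : y = y'
  · subst h; simp
  · rw [Matrix.trace_single_eq_of_ne _ _ _ h, if_neg]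
    simpa [funext_iff] using h

lemma opKer_apply {S : Type*} [Fintype S] [DecidableEq S] (o : LocalOp S) (x y : S → Lab) :
    opKer o x y = o.apply (Matrix.single (fun v => (y v).1) (fun v => (y v).2) 1)
      (fun v => (x v).1) (fun v => (x v).2) := by
  cases o with
  | gate U =>
    simp only [opKer, conjKer, LocalOp.apply, Matrix.of_apply]
    simp [Matrix.mul_apply, Matrix.single_apply, Finset.sum_ite_eq, Matrix.conjTranspose_apply,
      ite_and]
  | reset =>
    simp only [opKer, LocalOp.apply, Matrix.of_apply, Matrix.smul_apply, trace_single_eq,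
      smul_eq_mul, Prod.mk.eta, mul_comm (∏ v, trw (y v))]
    congr 1
    rw [Matrix.single_apply]
    refine if_congr ?_ rfl rfl
    simp only [funext_iff, Pi.zero_apply, Prod.ext_iff]
    constructor
    · intro h; exact ⟨fun v => (h v).1.symm, fun v => (h v).2.symm⟩
    · intro h v; exact ⟨(h.1 v).symm, (h.2 v).symm⟩

section layer

variable {V : Type*} [Fintype V] [DecidableEq V] {G : SimpleGraph V} {m : ℕ}

/-- The kernel of a layer. -/
def layerKer (L : Layer G m) : Ker V :=
  Matrix.of fun x y => ∏ P ∈ L.parts.parts, opKer (L.op P) (P.restrict x) (P.restrict y)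

lemma vec_layer (L : Layer G m) (ρ : Operator V) : vec (L.apply ρ) = layerKer L *ᵥ vec ρ := by
  ext x
  simp only [vec, Layer.apply, Matrix.of_apply, Matrix.mulVec, dotProduct, layerKer, opKer_apply]
  rw [sum_pair (fun y y' => (∏ P ∈ L.parts.parts, (L.op P).apply
    (Matrix.single (P.restrict y) (P.restrict y') 1) (P.restrict fun v => (x v).1)
      (P.restrict fun v => (x v).2)) * ρ y y')]
  rfl

/-- The kernel of a noisy circuit. -/
def runKer (N : QubitMap) : List (Layer G m) → Ker V
  | [] => 1
  | L :: Ls => runKer N Ls * (siteKer (fun _ => qker N) * layerKer L)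

lemma vec_runNoisy (N : QubitMap) (Ls : List (Layer G m)) (ρ : Operator V) :
    vec (runNoisy N Ls ρ) = runKer N Ls *ᵥ vec ρ := by
  induction Ls generalizing ρ with
  | nil => simp [runNoisy, runKer]
  | cons L Ls ih =>
    simp only [runNoisy, runKer, ih, vec_noiseLayer, vec_layer, Matrix.mulVec_mulVec]

lemma runKer_append (N : QubitMap) (Ls Ls' : List (Layer G m)) :
    runKer N (Ls ++ Ls') = runKer N Ls' * runKer N Ls := by
  induction Ls with
  | nil => simp [runKer]
  | cons L Ls ih => simp only [List.cons_append, runKer, ih, Matrix.mul_assoc]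

/-- The superoperator `Φ` is a convex combination of noisy unitary circuits of depth `t`: the random
choice among the circuits does not depend on the state. -/
def Reach (G : SimpleGraph V) (m : ℕ) (N : QubitMap) (t : ℕ) (Φ : Ker V) : Prop :=
  ∃ (ι : Type) (_ : Fintype ι) (p : ι → ℝ) (c : ι → List (Layer G m)),
    (∀ k, 0 ≤ p k) ∧ ∑ k, p k = 1 ∧ (∀ k, (c k).length = t ∧ ∀ L ∈ c k, L.IsUnitary) ∧
      Φ = ∑ k, (p k : ℂ) • runKer N (c k)

lemma Reach.zero (N : QubitMap) : Reach G m N 0 1 :=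
  ⟨Unit, inferInstance, fun _ => 1, fun _ => [], by simp, by simp, by simp, by simp [runKer]⟩

lemma Reach.comp {N : QubitMap} {t t' : ℕ} {Φ Ψ : Ker V} (hΨ : Reach G m N t' Ψ)
    (hΦ : Reach G m N t Φ) : Reach G m N (t + t') (Ψ * Φ) := by
  obtain ⟨ι, _, p, c, hp, hs, hc, rfl⟩ := hΦ
  obtain ⟨κ, _, p', c', hp', hs', hc', rfl⟩ := hΨ
  refine ⟨ι × κ, inferInstance, fun k => p k.1 * p' k.2, fun k => c k.1 ++ c' k.2,
    fun k => mul_nonneg (hp _) (hp' _), ?_, fun k => ⟨?_, ?_⟩, ?_⟩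
  · rw [Fintype.sum_prod_type]; simp [← Finset.mul_sum, hs', hs]
  · rw [List.length_append, (hc _).1, (hc' _).1]
  · intro L hL
    rcases List.mem_append.1 hL with h | h
    exacts [(hc _).2 L h, (hc' _).2 L h]
  · rw [Fintype.sum_prod_type, Finset.sum_comm, Finset.sum_mul]
    refine Finset.sum_congr rfl fun i _ => ?_
    rw [Finset.mul_sum]
    refine Finset.sum_congr rfl fun j _ => ?_
    rw [runKer_append, Matrix.smul_mul, Matrix.mul_smul, smul_smul, Complex.ofReal_mul, mul_comm]

end layer

/-! ### Mixtures of unitaries -/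

/-- The kernel is a convex combination of unitary conjugations: a random choice of a gate realizes
it. -/
def MixU {S : Type*} [Fintype S] [DecidableEq S] (K : Ker S) : Prop :=
  ∃ (ι : Type) (_ : Fintype ι) (p : ι → ℝ) (U : ι → Matrix.unitaryGroup (S → Fin 2) ℂ),
    (∀ k, 0 ≤ p k) ∧ ∑ k, p k = 1 ∧ K = ∑ k, (p k : ℂ) • conjKer (U k : Operator S)

section mix

variable {S : Type*} [Fintype S] [DecidableEq S]

lemma conjKer_mul (U U' : Operator S) : conjKer (U * U') = conjKer U * conjKer U' := by
  ext x z
  simp only [conjKer, Matrix.of_apply, Matrix.mul_apply, star_sum, star_mul']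
  rw [Finset.sum_mul_sum, sum_pair (fun y y' => U (fun v => (x v).1) y * U' y (fun v => (z v).1) *
    (star (U (fun v => (x v).2) y') * star (U' y' (fun v => (z v).2))))]
  exact Finset.sum_congr rfl fun y _ => by ring

lemma MixU.conj (U : Matrix.unitaryGroup (S → Fin 2) ℂ) : MixU (conjKer (U : Operator S)) :=
  ⟨Unit, inferInstance, fun _ => 1, fun _ => U, by simp, by simp, by simp⟩

lemma conjKer_one : conjKer (1 : Operator S) = 1 := by
  ext x y
  simp only [conjKer, Matrix.of_apply, Matrix.one_apply, funext_iff, Prod.ext_iff, forall_and]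
  split_ifs <;> simp_all

lemma MixU.one : MixU (1 : Ker S) := by
  have := MixU.conj (1 : Matrix.unitaryGroup (S → Fin 2) ℂ)
  rwa [Matrix.UnitaryGroup.one_val, conjKer_one] at this

lemma MixU.mul {K K' : Ker S} (h : MixU K) (h' : MixU K') : MixU (K * K') := by
  obtain ⟨ι, _, p, U, hp, hs, rfl⟩ := h
  obtain ⟨κ, _, p', U', hp', hs', rfl⟩ := h'
  refine ⟨ι × κ, inferInstance, fun k => p k.1 * p' k.2, fun k => U k.1 * U' k.2,
    fun k => mul_nonneg (hp _) (hp' _), ?_, ?_⟩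
  · rw [Fintype.sum_prod_type]; simp [← Finset.mul_sum, hs', hs]
  · rw [Fintype.sum_prod_type, Finset.sum_mul]
    refine Finset.sum_congr rfl fun i _ => ?_
    rw [Finset.mul_sum]
    refine Finset.sum_congr rfl fun j _ => ?_
    rw [Matrix.smul_mul, Matrix.mul_smul, smul_smul, Complex.ofReal_mul, Submonoid.coe_mul,
      conjKer_mul]

/-- Convex combinations of mixtures are mixtures. -/
lemma MixU.convex {K K' : Ker S} (h : MixU K) (h' : MixU K') {r : ℝ} (h0 : 0 ≤ r) (h1 : r ≤ 1) :
    MixU ((1 - r : ℂ) • K + (r : ℂ) • K') := by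
  obtain ⟨ι, _, p, U, hp, hs, rfl⟩ := h
  obtain ⟨κ, _, p', U', hp', hs', rfl⟩ := h'
  refine ⟨ι ⊕ κ, inferInstance, Sum.elim (fun i => (1 - r) * p i) (fun i => r * p' i),
    Sum.elim U U', ?_, ?_, ?_⟩
  · rintro (i | i)
    exacts [mul_nonneg (by linarith) (hp _), mul_nonneg h0 (hp' _)]
  · simp [← Finset.mul_sum, hs, hs']
  · simp only [Finset.smul_sum, smul_smul, Fintype.sum_sum_type, Sum.elim_inl, Sum.elim_inr]
    push_cast
    rfl

end mix

/-! ### Subsystems: partial traces, product extensions, permutations -/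

/-- The sites outside the range of a placement. -/
def Off {S V : Type*} (f : S ↪ V) : Type _ := {v : V // v ∉ Set.range f}

namespace Off

variable {S V : Type*} (f : S ↪ V)

instance [Finite V] : Finite (Off f) := inferInstanceAs (Finite {v : V // v ∉ Set.range f})

instance [Finite V] : Fintype (Off f) := Fintype.ofFinite _

instance : DecidableEq (Off f) := Classical.decEq _

end Off

section split

variable {S V : Type*} [Fintype S] [Fintype V] [DecidableEq S] [DecidableEq V]

open Classical in
/-- The sites are those in the range of a placement and the others. -/
def splitEquiv (f : S ↪ V) : S ⊕ Off f ≃ V :=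
  (Equiv.sumCongr (Equiv.ofInjective f f.injective) (Equiv.refl _)).trans
    (Equiv.sumCompl fun v => v ∈ Set.range f)

lemma splitEquiv_inl (f : S ↪ V) (s : S) : splitEquiv f (Sum.inl s) = f s := rfl

lemma splitEquiv_inr (f : S ↪ V) (o : Off f) : splitEquiv f (Sum.inr o) = o.1 := rfl

/-- Combine a configuration on the range of `f` with one on the other sites. -/
def glue (f : S ↪ V) (z : S → Lab) (o : Off f → Lab) : V → Lab :=
  fun v => Sum.elim z o ((splitEquiv f).symm v)

@[simp] lemma glue_apply (f : S ↪ V) (z : S → Lab) (o : Off f → Lab) (s : S) :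
    glue f z o (f s) = z s := by
  rw [glue, ← splitEquiv_inl, Equiv.symm_apply_apply, Sum.elim_inl]

@[simp] lemma glue_off (f : S ↪ V) (z : S → Lab) (o : Off f → Lab) (u : Off f) :
    glue f z o u.1 = o u := by
  rw [glue, ← splitEquiv_inr, Equiv.symm_apply_apply, Sum.elim_inr]

lemma eq_glue (f : S ↪ V) (z : S → Lab) (o : Off f → Lab) (x : V → Lab)
    (h : ∀ s, x (f s) = z s) (h' : ∀ u : Off f, x u.1 = o u) : x = glue f z o := by
  funext v
  obtain ⟨w, rfl⟩ := (splitEquiv f).surjective v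
  rcases w with s | u
  · rw [splitEquiv_inl, glue_apply, h]
  · rw [splitEquiv_inr, glue_off, h']

lemma sum_glue (f : S ↪ V) (F : (V → Lab) → ℂ) :
    ∑ x, F x = ∑ z, ∑ o, F (glue f z o) := by
  rw [← Fintype.sum_prod_type']
  refine (Equiv.sum_comp ((Equiv.sumArrowEquivProdArrow S (Off f) Lab).symm.trans
    ((splitEquiv f).arrowCongr (Equiv.refl Lab))) F).symm.trans ?_
  rfl

lemma prod_split (f : S ↪ V) (F : V → ℂ) : ∏ v, F v = (∏ s, F (f s)) * ∏ o : Off f, F o.1 := by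
  rw [← (splitEquiv f).prod_comp, Fintype.prod_sum_type]
  rfl

lemma forall_split (f : S ↪ V) (p : V → Prop) :
    (∀ v, p v) ↔ (∀ s, p (f s)) ∧ ∀ o : Off f, p o.1 := by
  constructor
  · exact fun h => ⟨fun s => h _, fun o => h _⟩
  · rintro ⟨h, h'⟩ v
    obtain ⟨w, rfl⟩ := (splitEquiv f).surjective v
    rcases w with s | u
    exacts [h s, h' u]

/-- The partial trace over the sites outside the range of `f`. -/
def red (f : S ↪ V) (ψ : Ten V) : Ten S :=
  fun z => ∑ o : Off f → Lab, (∏ u, trw (o u)) * ψ (glue f z o)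

/-- The operator `ρ` on the range of `f`, tensored with `ω` at each of the other sites. -/
def place (f : S ↪ V) (ρ : Ten S) (ω : Lab → ℂ) : Ten V :=
  fun x => ρ (fun s => x (f s)) * ∏ o : Off f, ω (x o.1)

/-- A kernel that factorizes with a trace-preserving factor outside of a subsystem acts on the
partial trace through the other factor. -/
lemma red_mulVec (f : S ↪ V) (L : Ker V) (A : Ker S) (Q : Ker (Off f)) (ψ : Ten V)
    (hL : ∀ z o w u, L (glue f z o) (glue f w u) = A z w * Q o u)
    (hQ : ∀ u : Off f → Lab, ∑ o : Off f → Lab, (∏ v, trw (o v)) * Q o u = ∏ v, trw (u v)) :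
    red f (L *ᵥ ψ) = A *ᵥ red f ψ := by
  ext z
  simp only [red, Matrix.mulVec, dotProduct, sum_glue f (fun x => L _ x * ψ x), hL]
  calc _ = ∑ w, ∑ u, (∑ o : Off f → Lab, (∏ v, trw (o v)) * Q o u) *
        (A z w * ψ (glue f w u)) := by
        simp only [Finset.mul_sum, Finset.sum_mul]
        rw [Finset.sum_comm]
        refine Finset.sum_congr rfl fun w _ => ?_
        rw [Finset.sum_comm]
        exact Finset.sum_congr rfl fun u _ => Finset.sum_congr rfl fun o _ => by ring
    _ = _ := by
        simp only [hQ, Finset.mul_sum]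
        exact Finset.sum_congr rfl fun w _ => Finset.sum_congr rfl fun u _ => by ring

/-- Trace preservation of a single-site kernel. -/
def TP (k : Matrix Lab Lab ℂ) : Prop := ∀ y, ∑ x, trw x * k x y = trw y

lemma siteKer_glue (f : S ↪ V) (k : V → Matrix Lab Lab ℂ) (z o w u) :
    siteKer k (glue f z o) (glue f w u) =
      siteKer (fun s => k (f s)) z w * siteKer (fun v : Off f => k v.1) o u := by
  simp only [siteKer_apply, prod_split f, glue_apply, glue_off]

lemma red_siteKer (f : S ↪ V) (k : V → Matrix Lab Lab ℂ) (hk : ∀ v, TP (k v)) (ψ : Ten V) :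
    red f (siteKer k *ᵥ ψ) = siteKer (fun s => k (f s)) *ᵥ red f ψ :=
  red_mulVec f _ _ _ ψ (siteKer_glue f k) (sum_prod_trw_mul _ fun v => hk v.1)

/-- A kernel that factorizes along a subsystem acts on product extensions factorwise. -/
lemma mulVec_place (f : S ↪ V) (A : Ker S) (k : Matrix Lab Lab ℂ) (L : Ker V) (ρ : Ten S)
    (ω : Lab → ℂ)
    (hL : ∀ z o w u, L (glue f z o) (glue f w u) = A z w * siteKer (fun _ : Off f => k) o u) :
    L *ᵥ place f ρ ω = place f (A *ᵥ ρ) (k *ᵥ ω) := by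
  have key : ∀ z o, (L *ᵥ place f ρ ω) (glue f z o) = place f (A *ᵥ ρ) (k *ᵥ ω) (glue f z o) := by
    intro z o
    have h2 := congrFun (siteKer_mulVec_prodTen (fun _ : Off f => k) (fun _ => ω)) o
    simp only [Matrix.mulVec, dotProduct, prodTen] at h2
    simp only [Matrix.mulVec, dotProduct, place, sum_glue f (fun x => L _ x * _), hL, glue_apply,
      glue_off, ← h2]
    rw [Finset.sum_mul_sum]
    exact Finset.sum_congr rfl fun w _ => Finset.sum_congr rfl fun u _ => by ring
  ext x
  rw [eq_glue f (fun s => x (f s)) (fun u => x u.1) x (fun _ => rfl) (fun _ => rfl), key]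

lemma siteKer_place (f : S ↪ V) (k : Matrix Lab Lab ℂ) (ρ : Ten S) (ω : Lab → ℂ) :
    siteKer (fun _ => k) *ᵥ place f ρ ω = place f (siteKer (fun _ => k) *ᵥ ρ) (k *ᵥ ω) :=
  mulVec_place f _ _ _ _ _ (siteKer_glue f _)

end split

section perm

variable {V : Type*} [Fintype V] [DecidableEq V]

/-- The permutation `π` of the qubits: the qubit at `v` goes to `π v`. -/
def permKer (π : Equiv.Perm V) : Ker V := Matrix.of fun x y => if y = x ∘ π then 1 else 0

lemma permKer_mulVec (π : Equiv.Perm V) (ψ : Ten V) (x) : (permKer π *ᵥ ψ) x = ψ (x ∘ π) := by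
  simp [permKer, Matrix.mulVec, dotProduct]

lemma permKer_mul (π : Equiv.Perm V) (A : Ker V) (x y) : (permKer π * A) x y = A (x ∘ π) y := by
  simp [permKer, Matrix.mul_apply]

lemma mul_permKer (π : Equiv.Perm V) (A : Ker V) (x y) :
    (A * permKer π) x y = A x (y ∘ π.symm) := by
  rw [Matrix.mul_apply, Finset.sum_eq_single (y ∘ π.symm)]
  · simp [permKer, Function.comp_assoc]
  · intro z _ hz
    simp only [permKer, Matrix.of_apply]
    rw [if_neg, mul_zero]
    rintro rfl
    exact hz (by simp [Function.comp_assoc])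
  · simp

lemma siteKer_permKer (π : Equiv.Perm V) (k : Matrix Lab Lab ℂ) :
    siteKer (fun _ => k) * permKer π = permKer π * siteKer (fun _ => k) := by
  ext x y
  rw [permKer_mul, mul_permKer, siteKer_apply, siteKer_apply,
    ← Equiv.prod_comp π fun v => k (x v) ((y ∘ π.symm) v)]
  simp

variable {S : Type*} [Fintype S] [DecidableEq S]

/-- The sites outside of a placement, after a permutation. -/
def offEquiv (f g : S ↪ V) (π : Equiv.Perm V) (h : ∀ s, g s = π (f s)) : Off f ≃ Off g :=
  π.subtypeEquiv fun v => by
    rw [not_iff_not]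
    constructor
    · rintro ⟨s, rfl⟩; exact ⟨s, h s⟩
    · rintro ⟨s, hs⟩; exact ⟨s, π.injective (by rw [← h, hs])⟩

lemma offEquiv_val (f g : S ↪ V) (π : Equiv.Perm V) (h : ∀ s, g s = π (f s)) (o : Off f) :
    (offEquiv f g π h o).1 = π o.1 := rfl

lemma permKer_place (f g : S ↪ V) (π : Equiv.Perm V) (h : ∀ s, g s = π (f s)) (ρ : Ten S)
    (ω : Lab → ℂ) : permKer π *ᵥ place f ρ ω = place g ρ ω := by
  ext x
  rw [permKer_mulVec]
  simp only [place, Function.comp, h]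
  congr 1
  rw [← (offEquiv f g π h).prod_comp]
  rfl

lemma red_permKer (f g : S ↪ V) (π : Equiv.Perm V) (h : ∀ s, g s = π (f s)) (ψ : Ten V) :
    red g (permKer π *ᵥ ψ) = red f ψ := by
  ext z
  simp only [red, permKer_mulVec]
  rw [← ((offEquiv f g π h).arrowCongr (Equiv.refl Lab)).sum_comp]
  refine Finset.sum_congr rfl fun o _ => ?_
  congr 1
  · rw [← (offEquiv f g π h).prod_comp]; simp
  · congr 1
    apply eq_glue
    · intro s; simp [← h]
    · intro u
      simp only [Function.comp, ← offEquiv_val f g π h, glue_off, Equiv.arrowCongr_apply]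
      simp

end perm

section interface

variable {W V : Type*} [Fintype V] [Fintype W] [iV : DecidableEq V] [DecidableEq W]

/-- The operator `|0⟩⟨0|`. -/
def zeroState : Lab → ℂ := fun b => if b = 0 then 1 else 0

lemma vec_embedState (e : W ↪ V) (ρ : Operator W) :
    vec (embedState e ρ) = place e (vec ρ) zeroState := by
  ext x
  simp only [vec, embedState, Matrix.of_apply, place, zeroState, Finset.prod_ite_zero,
    Finset.prod_const_one, Finset.mem_univ, true_implies, mul_ite, mul_one, mul_zero]
  have hiff : (∀ v, v ∉ Set.range e → (x v).1 = 0 ∧ (x v).2 = 0) ↔ ∀ o : Off e, x o.1 = 0 := by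
    constructor
    · intro h o; exact Prod.ext (h _ o.2).1 (h _ o.2).2
    · intro h v hv
      have := h ⟨v, hv⟩
      exact ⟨congrArg Prod.fst this, congrArg Prod.snd this⟩
  by_cases h : ∀ o : Off e, x o.1 = 0
  · rw [if_pos h, if_pos (hiff.2 h)]; rfl
  · rw [if_neg h, if_neg fun h' => h (hiff.1 h')]

lemma vec_reduceState (e : W ↪ V) (σ : Operator V) :
    vec (reduceState e σ) = red e (vec σ) := by
  classical
  obtain rfl : iV = fun a b => Classical.propDecidable (a = b) := Subsingleton.elim _ _
  ext x
  simp only [vec, reduceState, Matrix.of_apply]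
  refine (sum_pair _).trans ((sum_glue e _).trans ?_)
  refine (Finset.sum_eq_single x ?_ ?_).trans ?_
  · intro z _ hz
    refine Finset.sum_eq_zero fun o _ => if_neg ?_
    rintro ⟨h, h', -⟩
    refine hz (funext fun w => Prod.ext ?_ ?_)
    · simpa using congrFun h w
    · simpa using congrFun h' w
  · simp
  · refine Finset.sum_congr rfl fun o _ => ?_
    have hiff : ((fun v => (glue e x o v).1) ∘ e = (fun v => (x v).1) ∧
        (fun v => (glue e x o v).2) ∘ e = (fun v => (x v).2) ∧
        ∀ v, v ∉ Set.range e → (glue e x o v).1 = (glue e x o v).2) ↔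
          ∀ u, (o u).1 = (o u).2 := by
      constructor
      · rintro ⟨-, -, h⟩ u
        simpa using h u.1 u.2
      · intro h
        refine ⟨by ext v; simp, by ext v; simp, fun v hv => ?_⟩
        have h2 := glue_off e x o ⟨v, hv⟩
        exact (congrArg Prod.fst h2).trans ((h ⟨v, hv⟩).trans (congrArg Prod.snd h2).symm)
    simp only [trw, Finset.prod_ite_zero, Finset.prod_const_one, ite_mul, one_mul, zero_mul,
      Finset.mem_univ, true_implies]
    by_cases h : ∀ u, (o u).1 = (o u).2
    · rw [if_pos h]
      exact if_pos (hiff.2 h)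
    · rw [if_neg h]
      exact if_neg fun h' => h (hiff.1 h')

end interface

/-! ### Realizing product kernels by random layers -/

section unitary

variable {S T : Type*} [Fintype S] [DecidableEq S] [Fintype T] [DecidableEq T]

/-- A unitary gate, transported along a bijection of the sites. -/
def reindexU (ε : S ≃ T) (U : Matrix.unitaryGroup (S → Fin 2) ℂ) :
    Matrix.unitaryGroup (T → Fin 2) ℂ :=
  ⟨(U : Operator S).submatrix (ε.arrowCongr (Equiv.refl (Fin 2))).symm
    (ε.arrowCongr (Equiv.refl (Fin 2))).symm, by
    rw [Matrix.mem_unitaryGroup_iff, Matrix.star_eq_conjTranspose, Matrix.conjTranspose_submatrix,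
      Matrix.submatrix_mul_equiv, ← Matrix.star_eq_conjTranspose,
      Matrix.mem_unitaryGroup_iff.1 U.2, Matrix.submatrix_one_equiv]⟩

/-- The tensor product of single-qubit unitary matrices. -/
def tensorU (U : S → Matrix.unitaryGroup (Unit → Fin 2) ℂ) : Matrix.unitaryGroup (S → Fin 2) ℂ :=
  ⟨Matrix.of fun x y => ∏ s, (U s : Operator Unit) (fun _ => x s) (fun _ => y s), by
    rw [Matrix.mem_unitaryGroup_iff]
    ext x z
    have h : ∀ s, ∑ b : Fin 2, (U s : Operator Unit) (fun _ => x s) (fun _ => b) *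
        star ((U s : Operator Unit) (fun _ => z s) (fun _ => b)) = if x s = z s then 1 else 0 := by
      intro s
      have h1 := congrFun (congrFun (Matrix.mem_unitaryGroup_iff.1 (U s).2) (fun _ => x s))
        (fun _ => z s)
      rw [Matrix.mul_apply, Matrix.one_apply] at h1
      rw [← (Equiv.funUnique Unit (Fin 2)).sum_comp]
      refine Eq.trans ?_ (h1.trans ?_)
      · rfl
      · refine if_congr ?_ rfl rfl
        simp [funext_iff]
    have h2 := Finset.prod_univ_sum (fun _ : S => Finset.univ) (fun s (b : Fin 2) =>
      (U s : Operator Unit) (fun _ => x s) (fun _ => b) *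
        star ((U s : Operator Unit) (fun _ => z s) (fun _ => b)))
    simp only [h, Fintype.piFinset_univ, Finset.prod_ite_zero, Finset.prod_const_one] at h2
    simp only [Matrix.mul_apply, Matrix.of_apply, Matrix.star_apply, star_prod,
      ← Finset.prod_mul_distrib, Matrix.one_apply, funext_iff]
    simpa using h2.symm⟩

lemma conjKer_tensorU (U : S → Matrix.unitaryGroup (Unit → Fin 2) ℂ) (x y : S → Lab) :
    conjKer (tensorU U : Operator S) x y =
      ∏ s, conjKer (U s : Operator Unit) (fun _ => x s) (fun _ => y s) := by
  simp [conjKer, tensorU, Finset.prod_mul_distrib]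

/-- A single-site kernel, on a register of one qubit. -/
def oneKer (k : Matrix Lab Lab ℂ) : Ker Unit := siteKer fun _ => k

lemma oneKer_apply (k : Matrix Lab Lab ℂ) (x y) : oneKer k x y = k (x ()) (y ()) := by
  simp [oneKer, siteKer_apply]

lemma oneKer_mul (k k' : Matrix Lab Lab ℂ) : oneKer (k * k') = oneKer k * oneKer k' := by
  rw [oneKer, oneKer, oneKer, siteKer_mul]

lemma oneKer_one : oneKer 1 = 1 := siteKer_one

/-- The expansion of a product of finite sums, in the form used for independent random choices. -/
lemma prod_sum_choice {I : Type*} [Fintype I] [DecidableEq I] {ι : I → Type*}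
    [∀ i, Fintype (ι i)] {R : Type*} [CommSemiring R] (F : ∀ i, ι i → R) :
    ∏ i, ∑ k, F i k = ∑ c : ∀ i, ι i, ∏ i, F i (c i) := by
  rw [Finset.prod_univ_sum, Fintype.piFinset_univ]

/-- Independent mixtures on the sites form a mixture. -/
lemma MixU.site {S : Type} [Fintype S] [DecidableEq S] {k : S → Matrix Lab Lab ℂ}
    (hk : ∀ s, MixU (oneKer (k s))) : MixU (siteKer k) := by
  choose ι hι p U hp hs hK using hk
  refine ⟨∀ s, ι s, inferInstance, fun c => ∏ s, p s (c s), fun c => tensorU fun s => U s (c s),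
    fun c => Finset.prod_nonneg fun s _ => hp _ _, ?_, ?_⟩
  · rw [← prod_sum_choice]
    exact Finset.prod_eq_one fun s _ => hs s
  · ext x y
    have h : ∀ s, k s (x s) (y s) = ∑ c, (p s c : ℂ) *
        conjKer (U s c : Operator Unit) (fun _ => x s) (fun _ => y s) := by
      intro s
      have := congrFun (congrFun (hK s) (fun _ => x s)) (fun _ => y s)
      rw [oneKer_apply] at this
      rw [this]
      simp [Matrix.sum_apply]
    simp only [siteKer_apply, h, prod_sum_choice, Matrix.sum_apply, Matrix.smul_apply,
      conjKer_tensorU, Finset.prod_mul_distrib, smul_eq_mul]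
    push_cast
    rfl

end unitary

section block

variable {V : Type} [Fintype V] [DecidableEq V] {G : SimpleGraph V} {m : ℕ}
variable {I : Type} [Fintype I] [DecidableEq I] {A : I → Type} [∀ i, Fintype (A i)]
  [∀ i, DecidableEq (A i)]

/-- The sites covered by one member of a family that covers all sites. -/
def famPart (e : (Σ i, A i) ≃ V) (i : I) : Finset V := Finset.univ.filter fun v => (e.symm v).1 = i

lemma mem_famPart (e : (Σ i, A i) ≃ V) (i : I) (v : V) : v ∈ famPart e i ↔ (e.symm v).1 = i := by
  simp [famPart]

lemma apply_mem_famPart (e : (Σ i, A i) ≃ V) (i : I) (s : A i) : e ⟨i, s⟩ ∈ famPart e i := by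
  simp [famPart]

lemma coe_famPart (e : (Σ i, A i) ≃ V) (i : I) :
    (famPart e i : Set V) = Set.range fun s => e ⟨i, s⟩ := by
  ext v
  simp only [Finset.mem_coe, mem_famPart, Set.mem_range]
  constructor
  · rintro rfl
    exact ⟨(e.symm v).2, by simp⟩
  · rintro ⟨s, rfl⟩; simp

/-- The members of a family parametrize the sites they cover. -/
def famEquiv (e : (Σ i, A i) ≃ V) (i : I) (Q : Finset V) (h : famPart e i = Q) : A i ≃ Q :=
  Equiv.ofBijective (fun s => ⟨e ⟨i, s⟩, h ▸ apply_mem_famPart e i s⟩) (by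
    subst h
    constructor
    · intro s t hst
      have := e.injective (congrArg Subtype.val hst)
      simpa using this
    · rintro ⟨v, hv⟩
      rw [mem_famPart] at hv
      subst hv
      exact ⟨(e.symm v).2, Subtype.ext (by simp)⟩)

/-- A family of unitary gates on connected groups is a layer. -/
lemma exists_layer_of_family (e : (Σ i, A i) ≃ V)
    (hG : ∀ i, (G.induce (Set.range fun s => e ⟨i, s⟩)).Connected)
    (hc : ∀ i, Fintype.card (A i) ≤ m) (U : ∀ i, Matrix.unitaryGroup (A i → Fin 2) ℂ) :
    ∃ L : Layer G m, L.IsUnitary ∧ ∀ x y, layerKer L x y =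
      ∏ i, conjKer (U i : Operator (A i)) (fun s => x (e ⟨i, s⟩)) (fun s => y (e ⟨i, s⟩)) := by
  classical
  have hne : ∀ i, (famPart e i).Nonempty := by
    intro i
    obtain ⟨⟨v, s, rfl⟩⟩ := (hG i).nonempty
    exact ⟨_, apply_mem_famPart e i s⟩
  have hinj : Function.Injective (famPart e) := by
    intro i j hij
    obtain ⟨v, hv⟩ := hne i
    have hv' := hv
    rw [hij] at hv'
    rw [← (mem_famPart e i v).1 hv, (mem_famPart e j v).1 hv']
  -- The value at sets that are no members of the family is irrelevant.
  let op : (Q : Finset V) → LocalOp Q := fun Q =>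
    if h : ∃ i, famPart e i = Q then .gate (reindexU (famEquiv e h.choose Q h.choose_spec)
      (U h.choose)) else .gate 1
  let L : Layer G m :=
    { parts := Finpartition.ofExistsUnique (Finset.univ.image (famPart e))
        (fun _ _ => Finset.subset_univ _)
        (fun v _ => ⟨famPart e (e.symm v).1, ⟨by simp, by simp [mem_famPart]⟩, by
          rintro Q ⟨hQ, hv⟩
          obtain ⟨i, -, rfl⟩ := Finset.mem_image.1 hQ
          rw [(mem_famPart e i v).1 hv]⟩)
        (fun h => by
          obtain ⟨i, -, hi⟩ := Finset.mem_image.1 h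
          exact (hne i).ne_empty hi)
      card_le := by
        intro Q hQ
        obtain ⟨i, -, rfl⟩ := Finset.mem_image.1 hQ
        refine le_trans (le_of_eq ?_) (hc i)
        rw [← Fintype.card_coe]
        exact (Fintype.card_congr (famEquiv e i _ rfl)).symm
      connected := by
        intro Q hQ
        obtain ⟨i, -, rfl⟩ := Finset.mem_image.1 hQ
        rw [coe_famPart]
        exact hG i
      op := op
      reset_single := by
        intro Q hQ h
        simp only [op] at h
        split_ifs at h }
  refine ⟨L, ?_, fun x y => ?_⟩
  · intro Q hQ h
    change op Q = _ at h
    simp only [op] at h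
    split_ifs at h
  · change ∏ Q ∈ Finset.univ.image (famPart e), opKer (op Q) (Q.restrict x) (Q.restrict y) = _
    rw [Finset.prod_image fun i _ j _ h => hinj h]
    refine Finset.prod_congr rfl fun i _ => ?_
    have h : ∃ j, famPart e j = famPart e i := ⟨i, rfl⟩
    have hi : h.choose = i := hinj h.choose_spec
    have hop : op (famPart e i) = .gate (reindexU (famEquiv e h.choose _ h.choose_spec)
      (U h.choose)) := dif_pos h
    rw [hop]
    change conjKer (U h.choose : Operator (A h.choose)) (fun s => x (e ⟨h.choose, s⟩))
      (fun s => y (e ⟨h.choose, s⟩)) = _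
    exact congrArg (fun i => conjKer (U i : Operator (A i)) (fun s => x (e ⟨i, s⟩))
      (fun s => y (e ⟨i, s⟩))) hi

/-- A family of independent mixtures of gates on connected groups, followed by the noise, is
realized by a random layer. -/
lemma reach_of_family (N : QubitMap) (e : (Σ i, A i) ≃ V)
    (hG : ∀ i, (G.induce (Set.range fun s => e ⟨i, s⟩)).Connected)
    (hc : ∀ i, Fintype.card (A i) ≤ m) (K : ∀ i, Ker (A i)) (hK : ∀ i, MixU (K i)) (Φ : Ker V)
    (hΦ : ∀ x y, Φ x y = ∏ i, K i (fun s => x (e ⟨i, s⟩)) (fun s => y (e ⟨i, s⟩))) :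
    Reach G m N 1 (siteKer (fun _ => qker N) * Φ) := by
  choose ι hι p U hp hs hK using hK
  choose L hL hL' using fun c : ∀ i, ι i => exists_layer_of_family (m := m) e hG hc
    (fun i => U i (c i))
  -- The choices for the members of the family are independent.
  refine ⟨∀ i, ι i, inferInstance, fun c => ∏ i, p i (c i), fun c => [L c],
    fun c => Finset.prod_nonneg fun i _ => hp _ _, ?_, fun c => ⟨rfl, ?_⟩, ?_⟩
  · rw [← prod_sum_choice]
    exact Finset.prod_eq_one fun i _ => hs i
  · simpa using hL c
  · have : Φ = ∑ c, ((∏ i, p i (c i) : ℝ) : ℂ) • layerKer (L c) := by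
      ext x y
      simp only [hΦ, hK, Matrix.sum_apply, Matrix.smul_apply, hL', smul_eq_mul, prod_sum_choice,
        Finset.prod_mul_distrib]
      push_cast
      rfl
    rw [this, Finset.mul_sum]
    simp [runKer]

/-- The product of kernels on disjoint groups of sites and of a single-site kernel on each of the
remaining sites. -/
def blockKer (a : (Σ i, A i) ↪ V) (K : ∀ i, Ker (A i)) (k : Matrix Lab Lab ℂ) : Ker V :=
  Matrix.of fun x y => (∏ i, K i (fun s => x (a ⟨i, s⟩)) (fun s => y (a ⟨i, s⟩))) *
    ∏ v : Off a, k (x v.1) (y v.1)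

lemma induce_singleton_connected (G : SimpleGraph V) (v : V) (s : Set V) (h : s = {v}) :
    (G.induce s).Connected := by
  subst h
  have : Nonempty ({v} : Set V) := ⟨⟨v, rfl⟩⟩
  exact ⟨fun a b => by rw [Subsingleton.elim a b]⟩

/-- The domains of the members of a family completed by single sites. -/
abbrev SumFam (A : I → Type) (J : Type) : I ⊕ J → Type := Sum.elim A fun _ => Unit

instance (J : Type) : ∀ i, Fintype (SumFam A J i)
  | .inl i => inferInstanceAs (Fintype (A i))
  | .inr _ => inferInstanceAs (Fintype Unit)

instance (J : Type) : ∀ i, DecidableEq (SumFam A J i)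
  | .inl i => inferInstanceAs (DecidableEq (A i))
  | .inr _ => inferInstanceAs (DecidableEq Unit)

/-- The completion by single sites of a family covers all sites. -/
def completeEquiv (a : (Σ i, A i) ↪ V) : (Σ i, SumFam A (Off a) i) ≃ V :=
  (Equiv.ofBijective (fun i : Σ i, SumFam A (Off a) i => match i with
    | ⟨.inl i, s⟩ => (Sum.inl ⟨i, s⟩ : (Σ i, A i) ⊕ Off a)
    | ⟨.inr o, _⟩ => Sum.inr o) (by
      constructor
      · rintro ⟨i | o, s⟩ ⟨j | o', t⟩ h
        · obtain ⟨rfl, h⟩ := Sigma.mk.inj_iff.1 (Sum.inl.inj h)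
          rw [eq_of_heq h]
        · exact absurd h (by simp)
        · exact absurd h (by simp)
        · have := Sum.inr.inj h
          subst this
          rfl
      · rintro (⟨i, s⟩ | o)
        exacts [⟨⟨.inl i, s⟩, rfl⟩, ⟨⟨.inr o, ()⟩, rfl⟩])).trans (splitEquiv a)

lemma reach_blockKer (N : QubitMap) (hm : 1 ≤ m) (a : (Σ i, A i) ↪ V)
    (hG : ∀ i, (G.induce (Set.range fun s => a ⟨i, s⟩)).Connected)
    (hc : ∀ i, Fintype.card (A i) ≤ m) (K : ∀ i, Ker (A i)) (hK : ∀ i, MixU (K i))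
    (k : Matrix Lab Lab ℂ) (hk : MixU (oneKer k)) :
    Reach G m N 1 (siteKer (fun _ => qker N) * blockKer a K k) := by
  refine reach_of_family N (completeEquiv a) ?_ ?_ (fun i => match i with
    | .inl i => K i
    | .inr _ => oneKer k) ?_ _ ?_
  · rintro (i | o)
    · exact hG i
    · refine induce_singleton_connected G o.1 _ ?_
      ext v
      constructor
      · rintro ⟨s, rfl⟩; rfl
      · rintro rfl; exact ⟨(), rfl⟩
  · rintro (i | o)
    exacts [hc i, hm]
  · rintro (i | o)
    exacts [hK i, hk]
  · intro x y
    rw [Fintype.prod_sum_type, blockKer, Matrix.of_apply]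
    congr 1
    refine Finset.prod_congr rfl fun o _ => ?_
    exact (oneKer_apply k (fun _ => x o.1) (fun _ => y o.1)).symm

end block

/-! ### Gates at a distance -/

lemma MixU.perm {S : Type*} [Fintype S] [DecidableEq S] (π : Equiv.Perm S) : MixU (permKer π) := by
  let U : Operator S := Matrix.of fun x y => if y = x ∘ π then 1 else 0
  have hU : U ∈ Matrix.unitaryGroup (S → Fin 2) ℂ := by
    rw [Matrix.mem_unitaryGroup_iff]
    ext x z
    have : (x ∘ π = z ∘ π) ↔ x = z := π.surjective.injective_comp_right.eq_iff
    simp [U, Matrix.mul_apply, Matrix.one_apply, Matrix.star_apply, ← this, eq_comm]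
  have h : permKer π = conjKer U := by
    ext x y
    simp only [permKer, conjKer, U, Matrix.of_apply, funext_iff, Prod.ext_iff, forall_and,
      Function.comp]
    split_ifs <;> simp_all
  rw [h]
  exact MixU.conj ⟨U, hU⟩

section block

variable {V : Type} [Fintype V] [DecidableEq V] {G : SimpleGraph V} {m : ℕ}
variable {I : Type} [Fintype I] [DecidableEq I] {A : I → Type} [∀ i, Fintype (A i)]
  [∀ i, DecidableEq (A i)]

lemma permKer_blockKer (a b : (Σ i, A i) ↪ V) (π : Equiv.Perm V) (h : ∀ s, b s = π (a s))
    (K : ∀ i, Ker (A i)) (k : Matrix Lab Lab ℂ) :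
    permKer π * blockKer a K k * permKer π.symm = blockKer b K k := by
  ext x y
  rw [mul_permKer, permKer_mul]
  simp only [blockKer, Matrix.of_apply, h, Function.comp, Equiv.symm_symm]
  congr 1
  rw [← (offEquiv a b π h).prod_comp]
  rfl

/-- The simultaneous exchange of disjoint pairs of sites. -/
def pairPerm (a : (Σ _ : I, Fin 2) ↪ V) : Equiv.Perm V :=
  (splitEquiv a).permCongr
    (Equiv.sumCongr (Equiv.sigmaCongrRight fun _ => Equiv.swap 0 1) (Equiv.refl _))

lemma pairPerm_apply (a : (Σ _ : I, Fin 2) ↪ V) (i : I) (s : Fin 2) :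
    pairPerm a (a ⟨i, s⟩) = a ⟨i, Equiv.swap 0 1 s⟩ := by
  rw [pairPerm, Equiv.permCongr_apply, ← splitEquiv_inl, Equiv.symm_apply_apply]
  rfl

lemma pairPerm_of_notMem (a : (Σ _ : I, Fin 2) ↪ V) (v : V) (hv : v ∉ Set.range a) :
    pairPerm a v = v := by
  have h := splitEquiv_inr a ⟨v, hv⟩
  change _ = v at h
  rw [pairPerm, Equiv.permCongr_apply]
  nth_rewrite 1 [← h]
  rw [Equiv.symm_apply_apply]
  exact h

lemma pairPerm_symm (a : (Σ _ : I, Fin 2) ↪ V) : (pairPerm a).symm = pairPerm a := by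
  ext v
  rw [Equiv.symm_apply_eq]
  by_cases hv : v ∈ Set.range a
  · obtain ⟨⟨i, s⟩, rfl⟩ := hv
    rw [pairPerm_apply, pairPerm_apply, Equiv.swap_apply_self] 
  · rw [pairPerm_of_notMem a v hv, pairPerm_of_notMem a v hv]

lemma blockKer_swap (a : (Σ _ : I, Fin 2) ↪ V) :
    blockKer a (fun _ => permKer (Equiv.swap 0 1)) 1 = permKer (pairPerm a) := by
  ext x y
  have h : (y = x ∘ pairPerm a) ↔ (∀ i, (fun s => y (a ⟨i, s⟩)) =
      (fun s => x (a ⟨i, s⟩)) ∘ (Equiv.swap (0 : Fin 2) 1)) ∧ ∀ o : Off a, x o.1 = y o.1 := by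
    rw [funext_iff, forall_split a]
    simp only [funext_iff, Sigma.forall, Function.comp, pairPerm_apply]
    refine and_congr Iff.rfl (forall_congr' fun o => ?_)
    rw [pairPerm_of_notMem a o.1 o.2, eq_comm]
  simp only [blockKer, permKer, Matrix.of_apply, Matrix.one_apply, Finset.prod_ite_zero,
    Finset.prod_const_one, Finset.mem_univ, true_implies, h, ite_and]
  split_ifs <;> simp

/-- The noise on all sites. -/
def noiseKer (V : Type*) [Fintype V] [DecidableEq V] (N : QubitMap) : Ker V :=
  siteKer fun _ => qker N

lemma noiseKer_pow_permKer (N : QubitMap) (π : Equiv.Perm V) (t : ℕ) :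
    noiseKer V N ^ t * permKer π = permKer π * noiseKer V N ^ t := by
  rw [noiseKer, siteKer_pow, siteKer_permKer]

/-- Moving one qubit of each pair along a path, carrying out the gates between neighbours, and
moving back implements gates at a distance. As the noise commutes with permutations of the sites,
the motion contributes only noise before and after the gates. -/
lemma reach_pairs (N : QubitMap) (hm : 2 ≤ m) (R : I → Set V)
    (hR : ∀ i j, i ≠ j → Disjoint (R i) (R j)) (K : ∀ _ : I, Ker (Fin 2)) (hK : ∀ i, MixU (K i))
    (n : ℕ) (a : (Σ _ : I, Fin 2) ↪ V)
    (hw : ∀ i, ∃ w : G.Walk (a ⟨i, 0⟩) (a ⟨i, 1⟩), w.length ≤ n + 1 ∧ ∀ v ∈ w.support, v ∈ R i) :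
    Reach G m N (2 * n + 1) (noiseKer V N ^ (n + 1) * blockKer a K 1 * noiseKer V N ^ n) := by
  induction n generalizing a with
  | zero =>
    rw [zero_add, pow_one, pow_zero, mul_one]
    refine reach_blockKer N (by omega) a (fun i => ?_) (fun i => by simpa using hm) K hK 1
      (by rw [oneKer_one]; exact MixU.one)
    obtain ⟨w, hw, -⟩ := hw i
    have hadj : G.Adj (a ⟨i, 0⟩) (a ⟨i, 1⟩) := by
      refine SimpleGraph.Walk.adj_of_length_eq_one (p := w) (le_antisymm hw ?_)
      by_contra h0
      have := SimpleGraph.Walk.eq_of_length_eq_zero (p := w) (by omega)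
      simpa using a.injective this
    have : (Set.range fun s : Fin 2 => a ⟨i, s⟩) = {a ⟨i, 0⟩, a ⟨i, 1⟩} := by
      ext v
      simp [Fin.exists_fin_two, eq_comm]
    rw [this]
    exact SimpleGraph.induce_pair_connected_of_adj hadj
  | succ n ih =>
    -- The qubit at `a ⟨i, 0⟩` moves to the next site `c i` of its path, unless this is its partner's
    -- site; in that case it waits.
    have hc : ∀ i, ∃ c, c ∈ R i ∧ c ≠ a ⟨i, 1⟩ ∧ (c = a ⟨i, 0⟩ ∨ G.Adj (a ⟨i, 0⟩) c) ∧
        ∃ w : G.Walk c (a ⟨i, 1⟩), w.length ≤ n + 1 ∧ ∀ v ∈ w.support, v ∈ R i := by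
      intro i
      obtain ⟨w, hl, hs⟩ := hw i
      have h01 : a ⟨i, 0⟩ ≠ a ⟨i, 1⟩ := fun h => by simpa using a.injective h
      generalize a ⟨i, 0⟩ = u, a ⟨i, 1⟩ = v at *
      cases w with
      | nil => exact absurd rfl h01
      | @cons _ c _ h p =>
        by_cases hcv : c = v
        · subst hcv
          exact ⟨u, hs _ (by simp), h01, Or.inl rfl, h.toWalk, by simp, fun x hx => hs x (by
            simp only [SimpleGraph.Walk.support_cons, SimpleGraph.Walk.support_nil,
              List.mem_cons, List.not_mem_nil, or_false] at hx ⊢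
            rcases hx with rfl | rfl <;> simp)⟩
        · refine ⟨c, hs _ (by simp), hcv, Or.inr h, p, ?_, fun x hx => hs x (by simp [hx])⟩
          simpa using hl
    have haR : ∀ i s, a ⟨i, s⟩ ∈ R i := by
      intro i s
      obtain ⟨w, -, hs⟩ := hw i
      fin_cases s
      exacts [hs _ (by simp), hs _ (by simp)]
    choose c hcR hc1 hc0 hcw using hc
    have hdisj : ∀ {i j v}, v ∈ R i → v ∈ R j → i = j := fun {i j v} h h' => by
      by_contra hij
      exact Set.disjoint_left.1 (hR i j hij) h h'
    let J := {i // c i ≠ a ⟨i, 0⟩}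
    -- `b` lists the exchanges of this step, and `a'` the pairs after it.
    obtain ⟨b, hb0, hb1⟩ : ∃ b : (Σ _ : J, Fin 2) ↪ V, (∀ i : J, b ⟨i, 0⟩ = a ⟨i.1, 0⟩) ∧
        ∀ i : J, b ⟨i, 1⟩ = c i.1 := by
      refine ⟨⟨fun p => if p.2 = 0 then a ⟨p.1.1, 0⟩ else c p.1.1, by
        rintro ⟨⟨i, hi⟩, s⟩ ⟨⟨j, hj⟩, t⟩ h
        have hij : i = j := by
          refine hdisj (v := if s = 0 then a ⟨i, 0⟩ else c i) ?_ ?_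
          · split_ifs
            exacts [haR _ _, hcR _]
          · dsimp only at h
            rw [h]
            split_ifs
            exacts [haR _ _, hcR _]
        subst hij
        have : s = t := by
          dsimp only at h
          fin_cases s <;> fin_cases t <;> simp at h ⊢
          · exact hi h.symm
          · exact hi h
        rw [this]⟩, fun _ => rfl, fun _ => rfl⟩
    obtain ⟨a', ha0, ha1⟩ : ∃ a' : (Σ _ : I, Fin 2) ↪ V, (∀ i, a' ⟨i, 0⟩ = c i) ∧
        ∀ i, a' ⟨i, 1⟩ = a ⟨i, 1⟩ := by
      refine ⟨⟨fun p => if p.2 = 0 then c p.1 else a ⟨p.1, 1⟩, by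
        rintro ⟨i, s⟩ ⟨j, t⟩ h
        have hij : i = j := by
          refine hdisj (v := if s = 0 then c i else a ⟨i, 1⟩) ?_ ?_
          · split_ifs
            exacts [hcR _, haR _ _]
          · dsimp only at h
            rw [h]
            split_ifs
            exacts [hcR _, haR _ _]
        subst hij
        have : s = t := by
          dsimp only at h
          fin_cases s <;> fin_cases t <;> simp at h ⊢
          · exact hc1 _ h
          · exact hc1 _ h.symm
        rw [this]⟩, fun _ => rfl, fun _ => rfl⟩
    have hbR : ∀ i t, b ⟨i, t⟩ ∈ R i.1 := by
      intro i t
      fin_cases t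
      · exact (hb0 i).symm ▸ haR _ _
      · exact (hb1 i).symm ▸ hcR _
    have hstep : Reach G m N 1 (noiseKer V N * permKer (pairPerm b)) := by
      rw [← blockKer_swap]
      refine reach_blockKer N (by omega) b (fun i => ?_) (fun i => by simpa using hm) _
        (fun _ => MixU.perm _) 1 (by rw [oneKer_one]; exact MixU.one)
      have : (Set.range fun s : Fin 2 => b ⟨i, s⟩) = {a ⟨i.1, 0⟩, c i.1} := by
        ext v
        simp [Fin.exists_fin_two, eq_comm, hb0, hb1]
      rw [this]
      exact SimpleGraph.induce_pair_connected_of_adj ((hc0 i.1).resolve_left i.2)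
    have hperm : ∀ p, a p = pairPerm b (a' p) := by
      rintro ⟨i, s⟩
      fin_cases s
      · change a ⟨i, 0⟩ = pairPerm b (a' ⟨i, 0⟩)
        by_cases hi : c i = a ⟨i, 0⟩
        · rw [pairPerm_of_notMem, ha0, hi]
          rintro ⟨⟨⟨j, hj⟩, t⟩, h⟩
          have : i = j := hdisj (v := c i) (hcR i) (by rw [← ha0, ← h]; exact hbR ⟨j, hj⟩ t)
          subst this
          exact hj hi
        · rw [ha0, ← hb1 ⟨i, hi⟩, pairPerm_apply, Equiv.swap_apply_right, hb0]
      · change a ⟨i, 1⟩ = pairPerm b (a' ⟨i, 1⟩)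
        rw [pairPerm_of_notMem, ha1]
        rintro ⟨⟨⟨j, hj⟩, t⟩, h⟩
        rw [ha1] at h
        have : i = j := hdisj (haR i 1) (by rw [← h]; exact hbR ⟨j, hj⟩ t)
        subst this
        fin_cases t
        · change b ⟨⟨i, hj⟩, 0⟩ = _ at h
          rw [hb0] at h
          simpa using a.injective h
        · change b ⟨⟨i, hj⟩, 1⟩ = _ at h
          rw [hb1] at h
          exact hc1 _ h
    have key := ((hstep.comp (ih a' (fun i => by rw [ha0, ha1]; exact hcw i))).comp hstep)
    have e1 := permKer_blockKer a' a (pairPerm b) hperm K 1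
    rw [pairPerm_symm] at e1
    -- The exchanges before and after the shorter motion cancel up to the noise, with which they
    -- commute.
    have e2 : noiseKer V N ^ (n + 1 + 1) * blockKer a K 1 * noiseKer V N ^ (n + 1) =
        noiseKer V N * permKer (pairPerm b) *
          (noiseKer V N ^ (n + 1) * blockKer a' K 1 * noiseKer V N ^ n *
            (noiseKer V N * permKer (pairPerm b))) := by
      have c1 := noiseKer_pow_permKer N (pairPerm b) (n + 1)
      rw [← e1, pow_succ' _ (n + 1)]
      calc _ = noiseKer V N * (noiseKer V N ^ (n + 1) * permKer (pairPerm b)) * blockKer a' K 1 *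
            (permKer (pairPerm b) * noiseKer V N ^ (n + 1)) := by simp only [mul_assoc]
        _ = noiseKer V N * (permKer (pairPerm b) * noiseKer V N ^ (n + 1)) * blockKer a' K 1 *
            (noiseKer V N ^ (n + 1) * permKer (pairPerm b)) := by rw [c1]
        _ = _ := by rw [pow_succ (noiseKer V N) n]; simp only [mul_assoc]
    rw [e2]
    convert key using 1
    · omega
    · simp only [mul_assoc]

end block

/-! ### Product states -/

section trans

variable {A S V : Type*} [Fintype A] [Fintype S] [Fintype V] [DecidableEq A] [DecidableEq S]
  [DecidableEq V]

/-- The sites outside of a composite placement. -/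
def offTrans (a : A ↪ S) (f : S ↪ V) : Off a ⊕ Off f ≃ Off (a.trans f) :=
  Equiv.ofBijective (Sum.elim
    (fun s => ⟨f s.1, by rintro ⟨i, hi⟩; exact s.2 ⟨i, f.injective hi⟩⟩)
    (fun o => ⟨o.1, by rintro ⟨i, hi⟩; exact o.2 ⟨a i, hi⟩⟩)) (by
    constructor
    · rintro (s | o) (s' | o') h
      · exact congrArg _ (Subtype.ext (f.injective (congrArg Subtype.val h)))
      · exact absurd ⟨s.1, congrArg Subtype.val h⟩ o'.2
      · exact absurd ⟨s'.1, (congrArg Subtype.val h).symm⟩ o.2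
      · exact congrArg _ (Subtype.ext (congrArg Subtype.val h :))
    · rintro ⟨v, hv⟩
      by_cases h : v ∈ Set.range f
      · obtain ⟨s, rfl⟩ := h
        exact ⟨.inl ⟨s, fun ⟨i, hi⟩ => hv ⟨i, congrArg f hi⟩⟩, rfl⟩
      · exact ⟨.inr ⟨v, h⟩, rfl⟩)

lemma prod_offTrans (a : A ↪ S) (f : S ↪ V) (F : V → ℂ) :
    ∏ v : Off (a.trans f), F v.1 = (∏ s : Off a, F (f s.1)) * ∏ o : Off f, F o.1 := by
  rw [← (offTrans a f).prod_comp, Fintype.prod_sum_type]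
  rfl

lemma red_red (a : A ↪ S) (f : S ↪ V) (ψ : Ten V) :
    red a (red f ψ) = red (a.trans f) ψ := by
  ext z
  simp only [red, Finset.mul_sum]
  rw [← Fintype.sum_prod_type']
  let ε : (Off a → Lab) × (Off f → Lab) ≃ (Off (a.trans f) → Lab) :=
    (Equiv.sumArrowEquivProdArrow (Off a) (Off f) Lab).symm.trans
      ((offTrans a f).arrowCongr (Equiv.refl Lab))
  rw [← ε.sum_comp]
  refine Finset.sum_congr rfl fun p _ => ?_
  have h1 : ∀ s : Off a, ε p (offTrans a f (.inl s)) = p.1 s := fun s => by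
    simp [ε, Equiv.arrowCongr, Equiv.sumArrowEquivProdArrow]
  have h2 : ∀ o : Off f, ε p (offTrans a f (.inr o)) = p.2 o := fun s => by
    simp [ε, Equiv.arrowCongr, Equiv.sumArrowEquivProdArrow]
  rw [← mul_assoc]
  congr 1
  · rw [← (offTrans a f).prod_comp, Fintype.prod_sum_type]
    simp only [h1, h2]
  · congr 1
    refine eq_glue _ _ _ _ (fun s => by simp) fun u => ?_
    obtain ⟨w, rfl⟩ := (offTrans a f).surjective u
    rcases w with s | o
    · rw [h1]
      change glue f _ _ (f s.1) = _
      simp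
    · rw [h2]
      change glue f _ _ o.1 = _
      simp

end trans

section block

variable {S V : Type} [Fintype S] [Fintype V] [DecidableEq S] [DecidableEq V]
variable {I : Type} [Fintype I] [DecidableEq I] {A : I → Type} [∀ i, Fintype (A i)]
  [∀ i, DecidableEq (A i)]

/-- Blocks inside of a subsystem act on its reduced state. -/
lemma red_blockKer (a : (Σ i, A i) ↪ S) (f : S ↪ V) (K : ∀ i, Ker (A i))
    (k : Matrix Lab Lab ℂ) (hk : TP k) (ψ : Ten V) :
    red f (blockKer (a.trans f) K k *ᵥ ψ) = blockKer a K k *ᵥ red f ψ := by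
  refine red_mulVec f _ _ (siteKer fun _ => k) ψ (fun z o w u => ?_)
    (sum_prod_trw_mul _ fun _ => hk)
  have h := prod_offTrans a f fun v => k (glue f z o v) (glue f w u v)
  simp only [glue_apply, glue_off] at h
  simp only [blockKer, Matrix.of_apply, h, siteKer_apply, Function.Embedding.trans_apply,
    glue_apply, mul_assoc]

lemma TP_one : TP 1 := by
  intro y
  simp [Matrix.one_apply]

end block

section prod

variable {W : Type} [Fintype W] [DecidableEq W] {I : Type} [Fintype I] [DecidableEq I]
variable {T : Type} [Fintype T] [DecidableEq T]

/-- The tensor product of `ρ` with a copy of `α` at each site of `I`. -/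
def tens (ρ : Ten W) (α : Lab → ℂ) : Ten (W ⊕ I) :=
  fun x => ρ (fun w => x (.inl w)) * ∏ i, α (x (.inr i))

/-- The tensor product of `ρ` with a copy of the tensor `β` on each of the groups of sites. -/
def prodSt (ρ : Ten W) (β : Ten T) : Ten (W ⊕ (Σ _ : I, T)) :=
  fun x => ρ (fun w => x (.inl w)) * ∏ i, β (fun t => x (.inr ⟨i, t⟩))

lemma tens_eq_prodSt (ρ : Ten W) (α : Lab → ℂ) :
    tens (I := Σ _ : I, T) ρ α = prodSt ρ (prodTen fun _ => α) := by
  ext x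
  simp [tens, prodSt, prodTen, Fintype.prod_sigma]

/-- Configurations of a register and of a family of groups of sites. -/
def confEquiv (W I T : Type) : (W → Lab) × (I → T → Lab) ≃ (W ⊕ (Σ _ : I, T) → Lab) :=
  ((Equiv.refl _).prodCongr (Equiv.piCurry fun _ _ => Lab).symm).trans
    (Equiv.sumArrowEquivProdArrow W (Σ _ : I, T) Lab).symm

lemma confEquiv_inl (p : (W → Lab) × (I → T → Lab)) (w : W) :
    confEquiv W I T p (.inl w) = p.1 w := rfl

lemma confEquiv_inr (p : (W → Lab) × (I → T → Lab)) (i : I) (t : T) :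
    confEquiv W I T p (.inr ⟨i, t⟩) = p.2 i t := rfl

lemma mulVec_prodSt (L : Ker (W ⊕ (Σ _ : I, T))) (A : Ker W) (Q : Ker T)
    (hL : ∀ x y, L x y = A (fun w => x (.inl w)) (fun w => y (.inl w)) *
      ∏ i, Q (fun t => x (.inr ⟨i, t⟩)) (fun t => y (.inr ⟨i, t⟩))) (ρ : Ten W) (β : Ten T) :
    L *ᵥ prodSt ρ β = prodSt (A *ᵥ ρ) (Q *ᵥ β) := by
  ext x
  have h := prod_sum_choice fun (i : I) (y : T → Lab) => Q (fun t => x (.inr ⟨i, t⟩)) y * β y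
  simp only [Matrix.mulVec, dotProduct, prodSt, hL, h]
  rw [Finset.sum_mul_sum, ← Fintype.sum_prod_type', ← (confEquiv W I T).sum_comp]
  refine Finset.sum_congr rfl fun p _ => ?_
  simp only [confEquiv_inl, confEquiv_inr, Finset.prod_mul_distrib]
  ring

lemma siteKer_prodSt (k : Matrix Lab Lab ℂ) (ρ : Ten W) (β : Ten T) :
    siteKer (fun _ => k) *ᵥ prodSt (I := I) ρ β =
      prodSt (siteKer (fun _ => k) *ᵥ ρ) (siteKer (fun _ => k) *ᵥ β) := by
  refine mulVec_prodSt _ _ _ (fun x y => ?_) ρ β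
  simp [siteKer_apply, Fintype.prod_sum_type, Fintype.prod_sigma]

/-- A two-qubit kernel, acting on two of the qubits `T`. -/
def liftKer (τ : Fin 2 ↪ T) (K : Ker (Fin 2)) : Ker T :=
  Matrix.of fun x y => K (fun s => x (τ s)) (fun s => y (τ s)) *
    ∏ v : Off τ, if x v.1 = y v.1 then 1 else 0

/-- The copies of a pair of sites in a family of groups. -/
def famPair (W I : Type) (τ : Fin 2 ↪ T) : (Σ _ : I, Fin 2) ↪ W ⊕ (Σ _ : I, T) :=
  ⟨fun p => .inr ⟨p.1, τ p.2⟩, by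
    rintro ⟨i, s⟩ ⟨j, t⟩ h
    obtain ⟨h1, h2⟩ := Sigma.mk.inj_iff.1 (Sum.inr.inj h)
    dsimp only at h1 h2
    subst h1
    rw [τ.injective (eq_of_heq h2)]⟩

lemma famPair_prodSt (τ : Fin 2 ↪ T) (K : Ker (Fin 2)) (ρ : Ten W) (β : Ten T) :
    blockKer (famPair W I τ) (fun _ => K) 1 *ᵥ prodSt (I := I) ρ β =
      prodSt ρ (liftKer τ K *ᵥ β) := by
  have := mulVec_prodSt (blockKer (famPair W I τ) (fun _ => K) 1) 1 (liftKer τ K)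
    (fun x y => ?_) ρ β
  · rwa [Matrix.one_mulVec] at this
  · simp only [blockKer, liftKer, Matrix.of_apply, Matrix.one_apply, Finset.prod_mul_distrib,
      Finset.prod_ite_zero, Finset.prod_const_one, Finset.mem_univ, true_implies, funext_iff]
    rw [mul_left_comm]
    congr 1
    have : (∀ v : Off (famPair W I τ), x v.1 = y v.1) ↔
        (∀ w, x (.inl w) = y (.inl w)) ∧ ∀ i, ∀ v : Off τ, x (.inr ⟨i, v.1⟩) = y (.inr ⟨i, v.1⟩) := by
      constructor
      · refine fun h => ⟨fun w => h ⟨.inl w, ?_⟩, fun i v => h ⟨.inr ⟨i, v.1⟩, ?_⟩⟩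
        · rintro ⟨p, hp⟩
          exact absurd hp (by simp [famPair])
        · rintro ⟨⟨j, s⟩, hp⟩
          obtain ⟨rfl, h⟩ := Sigma.mk.inj_iff.1 (Sum.inr.inj hp)
          exact v.2 ⟨s, eq_of_heq h⟩
      · rintro ⟨h, h'⟩ ⟨w | ⟨i, t⟩, hv⟩
        · exact h w
        · exact h' i ⟨t, fun ⟨s, hs⟩ => hv ⟨⟨i, s⟩, by rw [← hs]; rfl⟩⟩
    simp only [this, ite_and]
    split_ifs <;> simp

/-- The placement of a qubit among the qubits `T`. -/
def oneEmb (t : T) : Unit ↪ T := ⟨fun _ => t, fun _ _ _ => rfl⟩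

/-- The reduced state of the qubit `t`. -/
def red1 (t : T) (β : Ten T) : Lab → ℂ := fun b => red (oneEmb t) β fun _ => b

/-- The placement of one member of each group of a family. -/
def famOne (W I : Type) (t : T) : W ⊕ I ↪ W ⊕ (Σ _ : I, T) :=
  ⟨Sum.map id fun i => ⟨i, t⟩, Function.Injective.sumMap Function.injective_id
    fun _ _ h => (Sigma.mk.inj_iff.1 h).1⟩

/-- The sites outside of the placement of one member of each group. -/
def offFamOne (W I : Type) (t : T) : (Σ _ : I, Off (oneEmb t)) ≃ Off (famOne W I t) :=
  Equiv.ofBijective (fun p => ⟨.inr ⟨p.1, p.2.1⟩, by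
      rintro ⟨w | i, h⟩
      · exact absurd h (by simp [famOne])
      · obtain ⟨-, h2⟩ := Sigma.mk.inj_iff.1 (Sum.inr.inj h)
        exact p.2.2 ⟨(), eq_of_heq h2⟩⟩) (by
    constructor
    · rintro ⟨i, o⟩ ⟨j, o'⟩ h
      obtain ⟨rfl, h⟩ := Sigma.mk.inj_iff.1 (Sum.inr.inj (congrArg Subtype.val h))
      rw [Subtype.ext (eq_of_heq h) (a1 := o) (a2 := o')]
    · rintro ⟨w | ⟨i, t'⟩, hv⟩
      · exact absurd ⟨.inl w, rfl⟩ hv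
      · refine ⟨⟨i, t', ?_⟩, rfl⟩
        rintro ⟨u, hu⟩
        exact hv ⟨.inr i, by rw [← hu]; rfl⟩)

lemma red_prodSt (t : T) (ρ : Ten W) (β : Ten T) :
    red (famOne W I t) (prodSt ρ β) = tens ρ (red1 t β) := by
  ext z
  have h := prod_sum_choice fun (i : I) (o : Off (oneEmb t) → Lab) =>
    (∏ u, trw (o u)) * β (glue (oneEmb t) (fun _ => z (.inr i)) o)
  simp only [tens, red1, red, h]
  let ε : (I → Off (oneEmb t) → Lab) ≃ (Off (famOne W I t) → Lab) :=
    (Equiv.piCurry fun _ _ => Lab).symm.trans ((offFamOne W I t).arrowCongr (Equiv.refl Lab))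
  rw [← ε.sum_comp, Finset.mul_sum]
  refine Finset.sum_congr rfl fun o _ => ?_
  have hε : ∀ i u, ε o (offFamOne W I t ⟨i, u⟩) = o i u := fun i u => by
    simp [ε, Equiv.arrowCongr, Sigma.uncurry]
  rw [← (offFamOne W I t).prod_comp, Fintype.prod_sigma, Finset.prod_mul_distrib]
  simp only [hε, prodSt]
  rw [mul_left_comm]
  congr 2
  · funext w
    exact glue_apply (famOne W I t) z _ (.inl w)
  · refine Finset.prod_congr rfl fun i _ => ?_
    congr 1
    refine eq_glue _ _ _ _ (fun _ => ?_) fun u => ?_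
    · exact glue_apply (famOne W I t) z _ (.inr i)
    · rw [← hε]
      exact glue_off (famOne W I t) z _ (offFamOne W I t ⟨i, u⟩)

variable {V : Type} [Fintype V] [DecidableEq V]

/-- The sites outside of the first summand. -/
def offInl (W I : Type) : I ≃ Off (Function.Embedding.inl : W ↪ W ⊕ I) :=
  Equiv.ofBijective (fun i => ⟨.inr i, by rintro ⟨w, h⟩; simp at h⟩) (by
    constructor
    · intro i j h
      exact Sum.inr.inj (congrArg Subtype.val h)
    · rintro ⟨w | i, h⟩
      exacts [absurd ⟨w, rfl⟩ h, ⟨i, rfl⟩])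

lemma red_place (F : W ⊕ I ↪ V) (ρ : Ten W) (ω : Lab → ℂ) (hω : ∑ b, trw b * ω b = 1) :
    red F (place (Function.Embedding.inl.trans F) ρ ω) = tens ρ ω := by
  ext z
  have h := prod_sum_choice fun (_ : Off F) (b : Lab) => trw b * ω b
  simp only [hω, Finset.prod_const_one] at h
  rw [← mul_one (tens ρ ω z), h, Finset.mul_sum]
  refine Finset.sum_congr rfl fun o _ => ?_
  have h1 := prod_offTrans Function.Embedding.inl F fun v => ω (glue F z o v)
  simp only [glue_apply, glue_off] at h1
  rw [← (offInl W I).prod_comp] at h1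
  rw [place, h1, Finset.prod_mul_distrib]
  simp only [Function.Embedding.trans_apply, glue_apply, tens]
  change _ * (_ * (_ * _)) = _ * _ * _
  simp only [Function.Embedding.inl_apply]
  rw [mul_left_comm, mul_assoc, mul_left_comm (∏ u, trw (o u))]
  rfl

end prod

/-! ### Single-qubit kernels -/

/-- The kernel of the conjugation by a `2 × 2` matrix. -/
def conj1 (U : Matrix (Fin 2) (Fin 2) ℂ) : Matrix Lab Lab ℂ :=
  Matrix.of fun x y => U x.1 y.1 * star (U x.2 y.2)

lemma mixU_conj1 (U : Matrix (Fin 2) (Fin 2) ℂ) (hU : U ∈ Matrix.unitaryGroup (Fin 2) ℂ) :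
    MixU (oneKer (conj1 U)) := by
  let ε : (Unit → Fin 2) ≃ Fin 2 := Equiv.funUnique Unit (Fin 2)
  have h : U.submatrix ε ε ∈ Matrix.unitaryGroup (Unit → Fin 2) ℂ := by
    rw [Matrix.mem_unitaryGroup_iff, Matrix.star_eq_conjTranspose, Matrix.conjTranspose_submatrix,
      Matrix.submatrix_mul_equiv, ← Matrix.star_eq_conjTranspose,
      Matrix.mem_unitaryGroup_iff.1 hU, Matrix.submatrix_one_equiv]
  have h2 : oneKer (conj1 U) = conjKer (U.submatrix ε ε) := by
    ext x y
    rw [oneKer_apply]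
    rfl
  rw [h2]
  exact MixU.conj ⟨_, h⟩

lemma oneKer_convex (k k' : Matrix Lab Lab ℂ) (a b : ℂ) :
    oneKer (a • k + b • k') = a • oneKer k + b • oneKer k' := by
  ext x y
  simp [oneKer_apply]

/-- The Pauli matrix `X`. -/
def pauliX : Matrix (Fin 2) (Fin 2) ℂ := !![0, 1; 1, 0]

/-- The Pauli matrix `Z`. -/
def pauliZ : Matrix (Fin 2) (Fin 2) ℂ := !![1, 0; 0, -1]

lemma pauliX_mem : pauliX ∈ Matrix.unitaryGroup (Fin 2) ℂ := by
  rw [Matrix.mem_unitaryGroup_iff]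
  ext i j
  fin_cases i <;> fin_cases j <;> simp [pauliX, Matrix.mul_apply, Matrix.star_apply]

lemma pauliZ_mem : pauliZ ∈ Matrix.unitaryGroup (Fin 2) ℂ := by
  rw [Matrix.mem_unitaryGroup_iff]
  ext i j
  fin_cases i <;> fin_cases j <;> simp [pauliZ, Matrix.mul_apply, Matrix.star_apply]

/-- The bit flip with probability `r`. -/
def flipKer (r : ℝ) : Matrix Lab Lab ℂ := (1 - r : ℂ) • 1 + (r : ℂ) • conj1 pauliX

/-- The complete dephasing. -/
def dephKer : Matrix Lab Lab ℂ :=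
  (1 - ((1 / 2 : ℝ) : ℂ)) • 1 + ((1 / 2 : ℝ) : ℂ) • conj1 pauliZ

lemma mixU_flipKer {r : ℝ} (h0 : 0 ≤ r) (h1 : r ≤ 1) : MixU (oneKer (flipKer r)) := by
  rw [flipKer, oneKer_convex, oneKer_one]
  exact MixU.one.convex (mixU_conj1 _ pauliX_mem) h0 h1

lemma mixU_dephKer : MixU (oneKer dephKer) := by
  rw [dephKer, oneKer_convex, oneKer_one]
  exact MixU.one.convex (mixU_conj1 _ pauliZ_mem) (by norm_num) (by norm_num)

lemma MixU.oneKer_mul {k k' : Matrix Lab Lab ℂ} (h : MixU (oneKer k)) (h' : MixU (oneKer k')) :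
    MixU (oneKer (k * k')) := by
  rw [NoisyCircuit.oneKer_mul]
  exact h.mul h'

/-- The diagonal state with eigenvalues `(1 + b) / 2` and `(1 - b) / 2`; `b` is its polarization. -/
def diagState (b : ℝ) : Lab → ℂ :=
  fun x => if x = 0 then (1 + b) / 2 else if x = 1 then (1 - b) / 2 else 0

lemma dephKer_mulVec (α : Lab → ℂ) (x : Lab) :
    (dephKer *ᵥ α) x = if x.1 = x.2 then α x else 0 := by
  obtain ⟨i, j⟩ := x
  fin_cases i <;> fin_cases j <;>
    norm_num [dephKer, Matrix.mulVec, dotProduct, Fintype.sum_prod_type, conj1, pauliZ,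
      Matrix.one_apply]

lemma flipKer_mulVec (r : ℝ) (α : Lab → ℂ) (x : Lab) :
    (flipKer r *ᵥ α) x = (1 - r) * α x + r * α (x.1 + 1, x.2 + 1) := by
  obtain ⟨i, j⟩ := x
  fin_cases i <;> fin_cases j <;>
    simp [flipKer, Matrix.mulVec, dotProduct, Fintype.sum_prod_type, conj1, pauliX,
      Matrix.one_apply] <;> ring

lemma TP_flipKer (r : ℝ) : TP (flipKer r) := by
  rintro ⟨i, j⟩
  fin_cases i <;> fin_cases j <;>
    simp [flipKer, Fintype.sum_prod_type, conj1, pauliX, Matrix.one_apply, trw]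

lemma TP_dephKer : TP dephKer := by
  rintro ⟨i, j⟩
  fin_cases i <;> fin_cases j <;>
    simp [dephKer, Fintype.sum_prod_type, conj1, pauliZ, Matrix.one_apply, trw]

lemma TP_iff (k : Matrix Lab Lab ℂ) : TP k ↔ trw ᵥ* k = trw := by
  rw [funext_iff]
  rfl

lemma TP.mul {k k' : Matrix Lab Lab ℂ} (h : TP k) (h' : TP k') : TP (k * k') := by
  rw [TP_iff] at *
  rw [← Matrix.vecMul_vecMul, h, h']

lemma TP.pow {k : Matrix Lab Lab ℂ} (h : TP k) (t : ℕ) : TP (k ^ t) := by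
  induction t with
  | zero => exact TP_one
  | succ t ih => rw [pow_succ]; exact ih.mul h

lemma TP.trace {k : Matrix Lab Lab ℂ} (h : TP k) (α : Lab → ℂ) :
    ∑ b, trw b * (k *ᵥ α) b = ∑ b, trw b * α b := by
  rw [TP_iff] at h
  change trw ⬝ᵥ (k *ᵥ α) = trw ⬝ᵥ α
  rw [Matrix.dotProduct_mulVec, h]

/-- The full depolarization. -/
def depKer : Matrix Lab Lab ℂ := dephKer * flipKer (1 / 2)

lemma mixU_depKer : MixU (oneKer depKer) :=
  mixU_dephKer.oneKer_mul (mixU_flipKer (by norm_num) (by norm_num))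

lemma depKer_apply (x y : Lab) : depKer x y = diagState 0 x * trw y := by
  have h := dephKer_mulVec (fun x => flipKer (1 / 2) x y) x
  rw [depKer, Matrix.mul_apply]
  refine Eq.trans h ?_
  obtain ⟨i, j⟩ := x
  obtain ⟨k, l⟩ := y
  fin_cases i <;> fin_cases j <;> fin_cases k <;> fin_cases l <;>
    simp [flipKer, conj1, pauliX, trw, diagState, Prod.ext_iff] <;> norm_num

lemma trace_diagState (b : ℝ) : ∑ x, trw x * diagState b x = 1 := by
  simp [Fintype.sum_prod_type, trw, diagState, Prod.ext_iff]
  ring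

lemma flipKer_zeroState (r : ℝ) : flipKer r *ᵥ zeroState = diagState (1 - 2 * r) := by
  ext x
  rw [flipKer_mulVec]
  obtain ⟨i, j⟩ := x
  fin_cases i <;> fin_cases j <;> simp [zeroState, diagState, Prod.ext_iff] <;> ring

lemma flipKer_diagState (r b : ℝ) : flipKer r *ᵥ diagState b = diagState ((1 - 2 * r) * b) := by
  ext x
  rw [flipKer_mulVec]
  obtain ⟨i, j⟩ := x
  fin_cases i <;> fin_cases j <;> simp [diagState, Prod.ext_iff] <;> ring

/-! ### Kernels of superoperators -/

lemma qker_mulVec (Φ : QubitMap) (ρ : Matrix (Fin 2) (Fin 2) ℂ) (x : Lab) :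
    (qker Φ *ᵥ fun b => ρ b.1 b.2) x = Φ ρ x.1 x.2 := by
  conv_rhs => rw [Matrix.matrix_eq_sum_single ρ]
  simp only [map_sum, Matrix.sum_apply, Matrix.mulVec, dotProduct, qker, Matrix.of_apply,
    Fintype.sum_prod_type]
  refine Finset.sum_congr rfl fun i _ => Finset.sum_congr rfl fun j _ => ?_
  have h : Matrix.single i j (ρ i j) = ρ i j • Matrix.single i j (1 : ℂ) := by
    simp [Matrix.smul_single]
  rw [h, map_smul, Matrix.smul_apply, smul_eq_mul, mul_comm]

lemma qker_mul (Φ Ψ : QubitMap) : qker (Φ * Ψ) = qker Φ * qker Ψ := by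
  ext x y
  exact (qker_mulVec Φ (Ψ (Matrix.single y.1 y.2 1)) x).symm

lemma qker_one : qker 1 = 1 := by
  ext x y
  simp only [qker, Matrix.of_apply, Module.End.one_apply, Matrix.single_apply, Matrix.one_apply,
    Prod.ext_iff]
  exact if_congr (by tauto) rfl rfl

lemma qker_pow (Φ : QubitMap) (t : ℕ) : qker (Φ ^ t) = qker Φ ^ t := by
  induction t with
  | zero => rw [pow_zero, pow_zero, qker_one]
  | succ t ih => rw [pow_succ, pow_succ, qker_mul, ih]

/-- The bit flip channel. -/
def flipMap (r : ℝ) : QubitMap :=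
  (1 - r : ℂ) • LinearMap.id +
    (r : ℂ) • ((LinearMap.mulLeft ℂ pauliX).comp (LinearMap.mulRight ℂ pauliX))

lemma pauliX_mul_mul_pauliX (M : Matrix (Fin 2) (Fin 2) ℂ) (i j : Fin 2) :
    (pauliX * (M * pauliX)) i j = M (i + 1) (j + 1) := by
  rw [← mul_assoc]
  fin_cases i <;> fin_cases j <;>
    simp [pauliX, Matrix.mul_apply, Fin.sum_univ_two, Matrix.vecMul, dotProduct]

lemma qker_flipMap (r : ℝ) : qker (flipMap r) = flipKer r := by
  ext ⟨i, j⟩ ⟨k, l⟩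
  simp only [qker, flipMap, Matrix.of_apply, LinearMap.add_apply, LinearMap.smul_apply,
    LinearMap.comp_apply, LinearMap.mulLeft_apply, LinearMap.mulRight_apply, Matrix.add_apply,
    Matrix.smul_apply, LinearMap.id_apply, pauliX_mul_mul_pauliX, flipKer]
  fin_cases i <;> fin_cases j <;> fin_cases k <;> fin_cases l <;>
    simp [conj1, pauliX]

lemma IsChannel.one : IsChannel 1 := ⟨1, fun _ => 1, by simp, by simp⟩

lemma IsChannel.mul {Φ Ψ : QubitMap} (hΦ : IsChannel Φ) (hΨ : IsChannel Ψ) :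
    IsChannel (Φ * Ψ) := by
  obtain ⟨r, K, hK, hΦ⟩ := hΦ
  obtain ⟨s, L, hL, hΨ⟩ := hΨ
  refine ⟨r * s, fun p => K (finProdFinEquiv.symm p).1 * L (finProdFinEquiv.symm p).2, ?_, ?_⟩
  · rw [finProdFinEquiv.symm.sum_comp fun p : Fin r × Fin s => (K p.1 * L p.2).conjTranspose *
      (K p.1 * L p.2), Fintype.sum_prod_type, Finset.sum_comm, ← hL]
    refine Finset.sum_congr rfl fun j _ => ?_
    calc _ = (L j).conjTranspose * (∑ i, (K i).conjTranspose * K i) * L j := by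
          simp only [Finset.mul_sum, Finset.sum_mul, Matrix.conjTranspose_mul, mul_assoc]
      _ = _ := by rw [hK, mul_one]
  · intro ρ
    rw [finProdFinEquiv.symm.sum_comp fun p : Fin r × Fin s => (K p.1 * L p.2) * ρ *
      (K p.1 * L p.2).conjTranspose, Fintype.sum_prod_type, Module.End.mul_apply, hΨ, hΦ]
    simp only [Finset.mul_sum, Finset.sum_mul, Matrix.conjTranspose_mul, mul_assoc]

lemma IsChannel.pow {Φ : QubitMap} (hΦ : IsChannel Φ) (t : ℕ) : IsChannel (Φ ^ t) := by
  induction t with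
  | zero => exact IsChannel.one
  | succ t ih => rw [pow_succ]; exact ih.mul hΦ

lemma isChannel_flipMap {r : ℝ} (h0 : 0 ≤ r) (h1 : r ≤ 1) : IsChannel (flipMap r) := by
  have hX : pauliX.conjTranspose = pauliX := by
    ext i j; fin_cases i <;> fin_cases j <;> simp [pauliX]
  have hXX : pauliX * pauliX = 1 := by
    ext i j; fin_cases i <;> fin_cases j <;> simp [pauliX]
  have hsq : ∀ x : ℝ, 0 ≤ x → ∃ a : ℂ, star a = a ∧ a * a = x := fun x hx =>
    ⟨(Real.sqrt x : ℝ), Complex.conj_ofReal _, by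
      rw [← Complex.ofReal_mul, Real.mul_self_sqrt hx]⟩
  obtain ⟨a, ha, ha'⟩ := hsq (1 - r) (by linarith)
  obtain ⟨b, hb, hb'⟩ := hsq r h0
  push_cast at ha'
  refine ⟨2, ![a • 1, b • pauliX], ?_, fun ρ => ?_⟩
  · simp [-Complex.coe_smul, -RCLike.star_def, Fin.sum_univ_two, hX, hXX, smul_smul, ha, hb, ha',
      hb', ← add_smul]
  · simp [-Complex.coe_smul, -RCLike.star_def, Fin.sum_univ_two, hX, smul_smul, ha, hb, ha', hb',
      flipMap, mul_assoc]

lemma IsChannel.TP {Φ : QubitMap} (h : IsChannel Φ) : TP (qker Φ) := by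
  obtain ⟨r, K, hK, hΦ⟩ := h
  intro y
  have h1 : ∀ M : Matrix (Fin 2) (Fin 2) ℂ, ∑ x : Lab, trw x * M x.1 x.2 = M.trace := by
    intro M
    simp [Fintype.sum_prod_type, trw, Matrix.trace, Fin.sum_univ_two]
  have h2 : ∀ M, (Φ M).trace = M.trace := by
    intro M
    rw [hΦ, Matrix.trace_sum]
    calc _ = ∑ i, ((K i).conjTranspose * K i * M).trace :=
          Finset.sum_congr rfl fun i _ => by
            rw [Matrix.trace_mul_comm, ← mul_assoc]
      _ = _ := by rw [← Matrix.trace_sum, ← Finset.sum_mul, hK, one_mul]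
  simp only [qker, Matrix.of_apply, h1, h2]
  obtain ⟨i, j⟩ := y
  by_cases hij : i = j
  · subst hij; simp [trw]
  · rw [Matrix.trace_single_eq_of_ne _ _ _ hij]; simp [trw, hij]

/-! ### The layers of the simulated circuit -/

section family

variable {W V : Type} [Fintype W] [DecidableEq W] [Fintype V] [DecidableEq V]
variable {I : Type} [Fintype I] [DecidableEq I] {A : I → Type} [∀ i, Fintype (A i)]
  [∀ i, DecidableEq (A i)]

/-- Sums over configurations factorize along a partition of the sites. -/
lemma sum_prod_family (e : (Σ i, A i) ≃ W) (F : ∀ i, (A i → Lab) → ℂ) :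
    ∑ o : W → Lab, ∏ i, F i (fun s => o (e ⟨i, s⟩)) = ∏ i, ∑ o, F i o := by
  rw [prod_sum_choice, ← ((Equiv.piCurry fun _ _ => Lab).symm.trans
    (e.arrowCongr (Equiv.refl Lab))).sum_comp]
  refine Finset.sum_congr rfl fun o _ => Finset.prod_congr rfl fun i _ => ?_
  congr 1
  funext s
  exact congrArg (fun p : Σ i, A i => o p.1 p.2) (e.symm_apply_apply ⟨i, s⟩)

lemma prod_family (e : (Σ i, A i) ≃ W) (F : W → ℂ) : ∏ w, F w = ∏ i, ∏ s, F (e ⟨i, s⟩) := by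
  rw [← e.prod_comp, Fintype.prod_sigma]

/-- A product of kernels over the members of a partition. -/
def famKer (e : (Σ i, A i) ≃ W) (K : ∀ i, Ker (A i)) : Ker W :=
  Matrix.of fun x y => ∏ i, K i (fun s => x (e ⟨i, s⟩)) (fun s => y (e ⟨i, s⟩))

lemma famKer_apply (e : (Σ i, A i) ≃ W) (K : ∀ i, Ker (A i)) (x y) :
    famKer e K x y = ∏ i, K i (fun s => x (e ⟨i, s⟩)) (fun s => y (e ⟨i, s⟩)) := rfl

lemma famKer_mul (e : (Σ i, A i) ≃ W) (K K' : ∀ i, Ker (A i)) :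
    famKer e K * famKer e K' = famKer e fun i => K i * K' i := by
  ext x y
  simp only [famKer, Matrix.mul_apply, Matrix.of_apply, ← Finset.prod_mul_distrib]
  exact sum_prod_family e fun i z => K i (fun s => x (e ⟨i, s⟩)) z * K' i z (fun s => y (e ⟨i, s⟩))

lemma siteKer_eq_famKer (e : (Σ i, A i) ≃ W) (k : Matrix Lab Lab ℂ) :
    siteKer (fun _ => k) = famKer e fun _ => siteKer fun _ => k := by
  ext x y
  simp only [siteKer_apply, famKer, Matrix.of_apply]
  exact prod_family e fun w => k (x w) (y w)

lemma blockKer_glue (e : (Σ i, A i) ≃ W) (f : W ↪ V) (K : ∀ i, Ker (A i))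
    (k : Matrix Lab Lab ℂ) (z o w u) :
    blockKer (e.toEmbedding.trans f) K k (glue f z o) (glue f w u) =
      famKer e K z w * siteKer (fun _ => k) o u := by
  have h := prod_offTrans e.toEmbedding f fun v => k (glue f z o v) (glue f w u v)
  have : IsEmpty (Off e.toEmbedding) := ⟨fun v => v.2 ⟨e.symm v.1, by simp⟩⟩
  simp only [glue_off, Finset.univ_eq_empty, Finset.prod_empty, one_mul] at h
  simp only [blockKer, Matrix.of_apply, h, siteKer_apply, famKer, Function.Embedding.trans_apply,
    Equiv.coe_toEmbedding, glue_apply]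

/-- The qubits after the resets: those in `r` are taken from the second, fresh copy of `W`. -/
def freshEmb (W : Type) (r : W → Prop) [DecidablePred r] : W ↪ W ⊕ W :=
  ⟨fun w => if r w then .inr w else .inl w, fun v w h => by
    dsimp only at h
    split_ifs at h
    exacts [Sum.inr.inj h, Sum.inl.inj h]⟩

/-- The qubits which are not used after the exchange. -/
def offFresh (W : Type) (r : W → Prop) [DecidablePred r] : W ≃ Off (freshEmb W r) :=
  Equiv.ofBijective (fun w => ⟨if r w then .inl w else .inr w, by
      rintro ⟨v, hv⟩
      change (if r v then Sum.inr v else Sum.inl v) = if r w then Sum.inl w else Sum.inr w at hv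
      by_cases h1 : r v <;> by_cases h2 : r w <;> simp [h1, h2] at hv
      all_goals
        subst hv
        contradiction⟩) (by
    constructor
    · intro v w h
      have h := congrArg Subtype.val h
      dsimp only at h
      split_ifs at h
      exacts [Sum.inl.inj h, Sum.inr.inj h]
    · rintro ⟨w | w, h⟩
      · refine ⟨w, Subtype.ext (if_pos ?_)⟩
        by_contra hw
        exact h ⟨w, if_neg hw⟩
      · refine ⟨w, Subtype.ext (if_neg ?_)⟩
        intro hw
        exact h ⟨w, if_pos hw⟩)

lemma red_freshEmb (r : W → Prop) [DecidablePred r] (τ : Ten W) (σ : Lab → ℂ) (z : W → Lab) :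
    red (freshEmb W r) (tens τ σ) z = ∑ o : W → Lab, (∏ w, trw (o w)) *
      (τ (fun w => if r w then o w else z w) * ∏ w, σ (if r w then z w else o w)) := by
  rw [red, ← ((offFresh W r).arrowCongr (Equiv.refl Lab)).sum_comp]
  refine Finset.sum_congr rfl fun o _ => ?_
  have ho : ∀ w, (offFresh W r).arrowCongr (Equiv.refl Lab) o (offFresh W r w) = o w := fun w => by
    simp [Equiv.arrowCongr]
  rw [← (offFresh W r).prod_comp]
  simp only [ho, tens]
  congr 2
  · congr 1
    funext w
    by_cases hw : r w
    · rw [if_pos hw, ← ho]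
      convert glue_off (freshEmb W r) z _ (offFresh W r w)
      exact (if_pos hw).symm
    · rw [if_neg hw]
      convert glue_apply (freshEmb W r) z _ w
      exact (if_neg hw).symm
  · refine Finset.prod_congr rfl fun w _ => congrArg σ ?_
    by_cases hw : r w
    · rw [if_pos hw]
      convert glue_apply (freshEmb W r) z _ w
      exact (if_pos hw).symm
    · rw [if_neg hw, ← ho]
      convert glue_off (freshEmb W r) z _ (offFresh W r w)
      exact (if_neg hw).symm

/-- If a product of kernels is applied to `ρ` and then the qubits of some of the groups are
exchanged for fresh ones, this amounts to replacing the kernels of these groups by the preparation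
of fresh qubits. -/
lemma red_freshEmb_famKer (e : (Σ i, A i) ≃ W) (r : W → Prop) [DecidablePred r] (b : I → Prop)
    (hb : ∀ i s, r (e ⟨i, s⟩) ↔ b i) (K K' : ∀ i, Ker (A i)) (σ : Lab → ℂ)
    (hσ : ∑ x, trw x * σ x = 1) (hK : ∀ i, ¬ b i → K' i = K i)
    (hK' : ∀ i, b i → ∀ x y, K' i x y = (∏ s, σ (x s)) * ∏ s, trw (y s))
    (hT : ∀ i, b i → ∀ y, ∑ x, (∏ s, trw (x s)) * K i x y = ∏ s, trw (y s)) (ρ : Ten W) :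
    red (freshEmb W r) (tens (famKer e K *ᵥ ρ) σ) = famKer e K' *ᵥ ρ := by
  classical
  ext z
  rw [red_freshEmb]
  simp only [Matrix.mulVec, dotProduct, Finset.sum_mul, Finset.mul_sum]
  rw [Finset.sum_comm]
  refine Finset.sum_congr rfl fun y _ => ?_
  have key := sum_prod_family e fun i (o : A i → Lab) => (∏ s, trw (o s)) *
    (K i (fun s => if b i then o s else z (e ⟨i, s⟩)) (fun s => y (e ⟨i, s⟩)) *
      ∏ s, σ (if b i then z (e ⟨i, s⟩) else o s))
  have h2 : ∀ i, ∑ o : A i → Lab, (∏ s, trw (o s)) *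
      (K i (fun s => if b i then o s else z (e ⟨i, s⟩)) (fun s => y (e ⟨i, s⟩)) *
        ∏ s, σ (if b i then z (e ⟨i, s⟩) else o s)) =
      K' i (fun s => z (e ⟨i, s⟩)) (fun s => y (e ⟨i, s⟩)) := by
    intro i
    by_cases hi : b i
    · simp only [if_pos hi]
      rw [hK' i hi, ← hT i hi, Finset.mul_sum]
      exact Finset.sum_congr rfl fun o _ => by ring
    · simp only [if_neg hi, hK i hi]
      have h3 := prod_sum_choice fun (_ : A i) x => trw x * σ x
      simp only [hσ, Finset.prod_const_one, Finset.prod_mul_distrib] at h3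
      calc _ = K i (fun s => z (e ⟨i, s⟩)) (fun s => y (e ⟨i, s⟩)) *
            ∑ o : A i → Lab, (∏ s, trw (o s)) * ∏ s, σ (o s) := by
            rw [Finset.mul_sum]
            exact Finset.sum_congr rfl fun o _ => by ring
        _ = _ := by rw [← h3, mul_one]
  simp only [h2] at key
  rw [famKer_apply e K', ← key, Finset.sum_mul]
  refine Finset.sum_congr rfl fun o _ => ?_
  rw [prod_family e fun w => trw (o w), prod_family e fun w => σ (if r w then z w else o w)]
  simp only [Finset.prod_mul_distrib, hb, famKer_apply]
  ring

end family

section stage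

variable {W V : Type} [Fintype W] [DecidableEq W] [Fintype V] [DecidableEq V]
  {G : SimpleGraph V} {H : SimpleGraph W} {m : ℕ}

lemma tens_eq_place {I : Type} [Fintype I] [DecidableEq I] (ρ : Ten W) (α : Lab → ℂ) :
    tens (I := I) ρ α = place Function.Embedding.inl ρ α := by
  ext x
  rw [place, ← (offInl W I).prod_comp]
  rfl

/-- The groups of a layer cover all sites. -/
def partsEquiv (L : Layer H m) : (Σ P : L.parts.parts, P.1) ≃ W :=
  Equiv.ofBijective (fun p => p.2.1) (by
    constructor
    · rintro ⟨⟨P, hP⟩, s, hs⟩ ⟨⟨Q, hQ⟩, t, ht⟩ h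
      dsimp only at h
      subst h
      obtain rfl : P = Q := L.parts.eq_of_mem_parts hP hQ hs ht
      rfl
    · intro w
      obtain ⟨P, hP, hw⟩ := L.parts.exists_mem (Finset.mem_univ w)
      exact ⟨⟨⟨P, hP⟩, w, hw⟩, rfl⟩)

lemma partsEquiv_apply (L : Layer H m) (P : L.parts.parts) (s : P.1) :
    partsEquiv L ⟨P, s⟩ = s.1 := rfl

lemma layerKer_eq_famKer (L : Layer H m) :
    layerKer L = famKer (partsEquiv L) fun P => opKer (L.op P.1) := by
  ext x y
  simp only [layerKer, famKer, Matrix.of_apply]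
  rw [← Finset.prod_coe_sort]
  rfl

/-- The kernel of a gate, and of idling for a RESET. -/
def gateKer {S : Type*} [Fintype S] [DecidableEq S] : LocalOp S → Ker S
  | .gate U => conjKer (U : Operator S)
  | .reset => 1

lemma mixU_gateKer {S : Type*} [Fintype S] [DecidableEq S] (o : LocalOp S) : MixU (gateKer o) := by
  cases o with
  | gate U => exact MixU.conj U
  | reset => exact MixU.one

/-- Full depolarization outside of a placement erases all correlations with the other sites. -/
lemma depolarize (f : W ↪ V) (ψ : Ten V) :
    blockKer ((Equiv.sigmaPUnit W).toEmbedding.trans f) (fun _ => 1) depKer *ᵥ ψ =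
      place f (red f ψ) (diagState 0) := by
  have key : ∀ z o, (blockKer ((Equiv.sigmaPUnit W).toEmbedding.trans f) (fun _ => 1) depKer *ᵥ ψ)
      (glue f z o) = place f (red f ψ) (diagState 0) (glue f z o) := by
    intro z o
    have h1 : famKer (Equiv.sigmaPUnit W) (fun _ => 1) = 1 := by
      ext x y
      simp [famKer, Matrix.one_apply, Finset.prod_ite_zero, funext_iff]
    simp only [Matrix.mulVec, dotProduct, sum_glue f (fun x => _ * ψ x), blockKer_glue, h1, place,
      glue_apply, glue_off, red, Matrix.one_apply, ite_mul, one_mul, zero_mul, siteKer_apply,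
      depKer_apply, Finset.prod_mul_distrib]
    rw [Finset.sum_eq_single z]
    · simp only [if_true, Finset.sum_mul]
      exact Finset.sum_congr rfl fun u _ => by ring
    · intro w _ hw
      simp [hw.symm]
    · simp
  ext x
  rw [eq_glue f (fun s => x (f s)) (fun u => x u.1) x (fun _ => rfl) (fun _ => rfl), key]

/-- A layer of the simulated circuit, in three layers: the gates followed by bit flips; the
exchange of the qubits to be reset for fresh ones; the depolarization of all other sites. -/
lemma reach_layer (N : QubitMap) (hN : TP (qker N)) (hm : 2 ≤ m) (L : Layer H m) (F : W ⊕ W ↪ V)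
    (g : W ↪ V) (hg : ∀ w, F (.inl w) = g w)
    (hP : ∀ P ∈ L.parts.parts, (G.induce (g '' P)).Connected)
    (hadj : ∀ w, {w} ∈ L.parts.parts → G.Adj (g w) (F (.inr w)))
    {r : ℝ} (h0 : 0 ≤ r) (h1 : r ≤ 1) (γ : Lab → ℂ)
    (hγ : ∃ k, MixU (oneKer k) ∧ TP k ∧ k *ᵥ γ = diagState (1 - 2 * r)) :
    ∃ Φ, Reach G m N 3 Φ ∧ ∀ (ψ : Ten V) (ρ : Operator W), red F ψ = tens (vec ρ) γ →
      Φ *ᵥ ψ = place g (noiseKer W N ^ 3 *ᵥ (siteKer (fun _ => flipKer r) *ᵥ vec (L.apply ρ)))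
        (qker N *ᵥ diagState 0) := by
  classical
  obtain ⟨k, hk, hkT, hkγ⟩ := hγ
  let e := partsEquiv L
  let rs : W → Prop := fun w => ∃ P ∈ L.parts.parts, w ∈ P ∧ L.op P = .reset
  let K : ∀ P : L.parts.parts, Ker P.1 := fun P => siteKer (fun _ => flipKer r) * gateKer (L.op P.1)
  have hgF : g = Function.Embedding.inl.trans F := by
    ext w; exact (hg w).symm
  -- The gates followed by bit flips. RESETs idle, and `k` acts on all the other sites, among them
  -- the fresh qubits.
  have R1 : Reach G m N 1 (noiseKer V N * blockKer (e.toEmbedding.trans g) K k) := by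
    refine reach_blockKer N (by omega) _ (fun P => ?_) (fun P => ?_) K (fun P => ?_) k hk
    · convert hP P.1 P.2 using 2
      all_goals
        ext v
        simp [e, partsEquiv_apply]
    · simpa using L.card_le P.1 P.2
    · exact (MixU.site fun _ => mixU_flipKer h0 h1).mul (mixU_gateKer _)
  -- The exchange of the qubits to be reset for fresh ones.
  let a : (Σ _ : {w // rs w}, Fin 2) ↪ V :=
    ⟨fun p => if p.2 = 0 then g p.1.1 else F (.inr p.1.1), by
      rintro ⟨⟨v, hv⟩, s⟩ ⟨⟨w, hw⟩, t⟩ h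
      simp only [← hg] at h
      fin_cases s <;> fin_cases t <;> simp at h ⊢ <;> exact h⟩
  have ha : ∀ w, a ⟨w, 0⟩ = g w.1 ∧ a ⟨w, 1⟩ = F (.inr w.1) := fun w => ⟨rfl, rfl⟩
  have hrs : ∀ w, rs w → {w} ∈ L.parts.parts := by
    rintro w ⟨P, hP, hw, h⟩
    obtain ⟨v, hv⟩ := Finset.card_eq_one.1 (L.reset_single P hP h)
    rw [hv, Finset.mem_singleton] at hw
    rwa [hw, ← hv]
  have R2 : Reach G m N 1 (noiseKer V N * permKer (pairPerm a)) := by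
    rw [← blockKer_swap]
    refine reach_blockKer N (by omega) a (fun i => ?_) (fun i => by simpa using hm) _
      (fun _ => MixU.perm _) 1 (by rw [oneKer_one]; exact MixU.one)
    have : (Set.range fun s : Fin 2 => a ⟨i, s⟩) = {g i.1, F (.inr i.1)} := by
      ext v
      simp [Fin.exists_fin_two, eq_comm, ha]
    rw [this]
    exact SimpleGraph.induce_pair_connected_of_adj (hadj _ (hrs _ i.2))
  -- The depolarization of all sites other than those of the register.
  have R3 : Reach G m N 1 (noiseKer V N *
      blockKer ((Equiv.sigmaPUnit W).toEmbedding.trans g) (fun _ => 1) depKer) := by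
    refine reach_blockKer N (by omega) _ (fun w => ?_) (fun P => by simp; omega) _
      (fun P => MixU.one) _ mixU_depKer
    refine induce_singleton_connected G (g w) _ ?_
    ext v
    simp
  refine ⟨_, R3.comp (R2.comp R1), fun ψ ρ hψ => ?_⟩
  simp only [← Matrix.mulVec_mulVec, depolarize, noiseKer, siteKer_place]
  congr 1
  rw [red_siteKer _ _ fun _ => hN]
  have hF : ∀ w, g w = pairPerm a (((freshEmb W rs).trans F) w) := by
    intro w
    by_cases hw : rs w
    · have : ((freshEmb W rs).trans F) w = a ⟨⟨w, hw⟩, 1⟩ := by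
        rw [(ha _).2]
        exact congrArg F (if_pos hw)
      rw [this, pairPerm_apply, Equiv.swap_apply_right, (ha _).1]
    · have : ((freshEmb W rs).trans F) w = g w := by
        rw [← hg]
        exact congrArg F (if_neg hw)
      rw [this, pairPerm_of_notMem]
      rintro ⟨⟨⟨v, hv⟩, s⟩, h⟩
      rw [← hg] at h
      fin_cases s
      · have := (ha ⟨v, hv⟩).1.symm.trans h
        rw [← hg] at this
        exact hw (Sum.inl.inj (F.injective this) ▸ hv)
      · exact absurd (F.injective ((ha ⟨v, hv⟩).2.symm.trans h)) (by simp)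
  rw [red_permKer _ _ _ hF, red_siteKer _ _ fun _ => hN]
  have hM : red F (blockKer (e.toEmbedding.trans g) K k *ᵥ ψ) =
      tens (famKer e K *ᵥ vec ρ) (diagState (1 - 2 * r)) := by
    rw [hgF, ← hkγ]
    change red F (blockKer ((e.toEmbedding.trans Function.Embedding.inl).trans F) K k *ᵥ ψ) = _
    rw [red_blockKer _ _ _ _ hkT, hψ, tens_eq_place, tens_eq_place,
      mulVec_place _ _ _ _ _ _ (blockKer_glue e _ K k)]
  rw [← red_red, hM]
  have hL : red (freshEmb W rs) (tens (famKer e K *ᵥ vec ρ) (diagState (1 - 2 * r))) =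
      siteKer (fun _ => flipKer r) *ᵥ vec (L.apply ρ) := by
    rw [vec_layer, Matrix.mulVec_mulVec, siteKer_eq_famKer e, layerKer_eq_famKer, famKer_mul]
    refine red_freshEmb_famKer e rs (fun P => L.op P.1 = .reset) (fun P s => ?_) _ _ _
      (trace_diagState _) (fun P hP => ?_) (fun P hP x y => ?_) (fun P hP y => ?_) _
    · constructor
      · rintro ⟨Q, hQ, hs, h⟩
        rwa [← L.parts.eq_of_mem_parts hQ P.2 hs s.2]
      · exact fun h => ⟨P.1, P.2, s.2, h⟩
    · simp only [K]
      congr 1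
      cases h : L.op P.1 with
      | gate U => rfl
      | reset => exact absurd h hP
    · rw [hP]
      simp only [opKer, Matrix.mul_apply, Matrix.of_apply, ite_mul, one_mul, zero_mul, mul_ite,
        mul_zero, Finset.sum_ite_eq', Finset.mem_univ, if_true]
      congr 1
      rw [siteKer_apply]
      refine Finset.prod_congr rfl fun s _ => ?_
      rw [← flipKer_zeroState]
      simp [Matrix.mulVec, dotProduct, zeroState]
    · simp only [K, hP, gateKer, mul_one]
      exact sum_prod_trw_mul _ (fun _ => TP_flipKer r) y
  rw [hL, pow_succ, pow_two]
  simp only [Matrix.mulVec_mulVec, mul_assoc]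

end stage

/-! ### Routing -/

section route

variable {V W : Type} [Fintype V] [DecidableEq V] [Fintype W] [DecidableEq W]
  {G : SimpleGraph V} {m : ℕ}

lemma siteKer_pow_place (N : QubitMap) (f : W ↪ V) (ρ : Ten W) (ω : Lab → ℂ) (t : ℕ) :
    noiseKer V N ^ t *ᵥ place f ρ ω = place f (noiseKer W N ^ t *ᵥ ρ) (qker N ^ t *ᵥ ω) := by
  rw [noiseKer, siteKer_pow, siteKer_place, noiseKer, siteKer_pow]

lemma red_noise_pow {S : Type} [Fintype S] [DecidableEq S] (N : QubitMap) (hN : TP (qker N))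
    (f : S ↪ V) (t : ℕ) (ψ : Ten V) :
    red f (noiseKer V N ^ t *ᵥ ψ) = noiseKer S N ^ t *ᵥ red f ψ := by
  rw [noiseKer, siteKer_pow, red_siteKer _ _ fun _ => hN.pow t, noiseKer, siteKer_pow]

/-- In `t` steps, the qubits at the sites `f` can be moved to the sites `f'`. The noise acts, and
the identical states of the qubits at the other sites remain in place. -/
def Route (G : SimpleGraph V) (m : ℕ) (N : QubitMap) (t : ℕ) (f f' : W ↪ V) : Prop :=
  ∃ Φ, Reach G m N t Φ ∧ ∀ ρ ω, Φ *ᵥ place f ρ ω =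
    place f' (noiseKer W N ^ t *ᵥ ρ) (qker N ^ t *ᵥ ω)

lemma Route.trans {N : QubitMap} {t t' : ℕ} {f f' f'' : W ↪ V} (h : Route G m N t f f')
    (h' : Route G m N t' f' f'') : Route G m N (t + t') f f'' := by
  obtain ⟨Φ, hΦ, h⟩ := h
  obtain ⟨Ψ, hΨ, h'⟩ := h'
  refine ⟨_, hΨ.comp hΦ, fun ρ ω => ?_⟩
  rw [← Matrix.mulVec_mulVec, h, h', Matrix.mulVec_mulVec, Matrix.mulVec_mulVec, ← pow_add,
    ← pow_add, add_comm]

lemma reach_idle (G : SimpleGraph V) (N : QubitMap) (hm : 1 ≤ m) (t : ℕ) :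
    Reach G m N t (noiseKer V N ^ t) := by
  induction t with
  | zero => exact Reach.zero N
  | succ t ih =>
    rw [pow_succ', add_comm]
    rw [add_comm]
    refine Reach.comp ?_ ih
    let a : (Σ _ : Fin 0, Unit) ↪ V := ⟨fun p => p.1.elim0, fun p => p.1.elim0⟩
    have := reach_blockKer (G := G) N hm a (fun i => i.elim0) (fun i => i.elim0) (fun _ => 1)
      (fun i => i.elim0) 1 (by rw [oneKer_one]; exact MixU.one)
    convert this using 1
    have h1 : blockKer a (fun _ => 1) 1 = 1 := by
      ext x y
      have h : (∀ v : Off a, x v.1 = y v.1) ↔ x = y := by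
        constructor
        · intro h
          funext v
          exact h ⟨v, fun ⟨p, _⟩ => p.1.elim0⟩
        · rintro rfl v; rfl
      simp only [blockKer, Matrix.of_apply, Matrix.one_apply, Finset.prod_ite_zero,
        Finset.prod_const_one, Finset.mem_univ, true_implies, h]
      simp
    rw [h1, mul_one]
    rfl

lemma Route.idle (N : QubitMap) (hm : 1 ≤ m) (t : ℕ) (f : W ↪ V) : Route G m N t f f :=
  ⟨_, reach_idle G N hm t, fun ρ ω => siteKer_pow_place N f ρ ω t⟩

/-- The exchange of all members of a family of pairs moves the qubits at the sites `f` to `f'`, if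
the other sites hold identical states. -/
lemma route_swap (N : QubitMap) (hm : 2 ≤ m) {J : Type} [Fintype J] [DecidableEq J]
    (R : J → Set V) (hR : ∀ i j, i ≠ j → Disjoint (R i) (R j)) (n : ℕ) (a : (Σ _ : J, Fin 2) ↪ V)
    (hw : ∀ i, ∃ w : G.Walk (a ⟨i, 0⟩) (a ⟨i, 1⟩), w.length ≤ n + 1 ∧ ∀ v ∈ w.support, v ∈ R i)
    (f f' : W ↪ V) (hf : ∀ w, f' w = pairPerm a (f w)) : Route G m N (2 * n + 1) f f' := by
  refine ⟨_, reach_pairs N hm R hR (fun _ => permKer (Equiv.swap 0 1)) (fun _ => MixU.perm _) n a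
    hw, fun ρ ω => ?_⟩
  rw [blockKer_swap, mul_assoc, ← noiseKer_pow_permKer, ← mul_assoc, ← pow_add,
    ← Matrix.mulVec_mulVec, permKer_place f f' _ hf, siteKer_pow_place]
  congr 3 <;> omega

/-- Qubits whose moves obstruct each other only if they belong to different classes can be moved
class by class. -/
lemma route_classes (N : QubitMap) (hm : 2 ≤ m) {Q : Type} [Fintype Q] [DecidableEq Q] (c : W → Q)
    (g h : W ↪ V) (hgh : ∀ v w, g w = h v → w = v) (R : W → Set V)
    (hR : ∀ v w, c v = c w → v ≠ w → Disjoint (R v) (R w)) (n : ℕ)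
    (hw : ∀ v, ∃ w : G.Walk (g v) (h v), w.length ≤ n + 1 ∧ ∀ u ∈ w.support, u ∈ R v) :
    Route G m N (Fintype.card Q * (2 * n + 1)) g h := by
  classical
  -- The qubits of the classes in `A` have been moved already.
  have key : ∀ A : Finset Q, ∃ f : W ↪ V, (∀ w, f w = if c w ∈ A then h w else g w) ∧
      Route G m N (A.card * (2 * n + 1)) g f := by
    intro A
    induction A using Finset.induction_on with
    | empty => exact ⟨g, by simp, by simpa using Route.idle N (by omega) 0 g⟩
    | insert q A hq ih =>
      obtain ⟨f, hf, hr⟩ := ih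
      let f' : W ↪ V := ⟨fun w => if c w ∈ insert q A then h w else g w, fun v w hvw => by
        dsimp only at hvw
        split_ifs at hvw
        · exact h.injective hvw
        · exact (hgh _ _ hvw.symm).symm
        · exact hgh _ _ hvw
        · exact g.injective hvw⟩
      have hgR : ∀ v, g v ∈ R v := fun v => by
        obtain ⟨w, -, hs⟩ := hw v
        exact hs _ (by simp)
      have hhR : ∀ v, h v ∈ R v := fun v => by
        obtain ⟨w, -, hs⟩ := hw v
        exact hs _ (by simp)
      let J := {v : W // c v = q ∧ g v ≠ h v}
      let a : (Σ _ : J, Fin 2) ↪ V := ⟨fun p => if p.2 = 0 then g p.1.1 else h p.1.1, by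
        rintro ⟨⟨v, hv, hv'⟩, s⟩ ⟨⟨w, hw, hw'⟩, t⟩ hvw
        fin_cases s <;> fin_cases t <;> simp at hvw ⊢
        · exact Subtype.ext hvw
        · exact absurd hvw (by rw [hgh _ _ hvw]; exact hw')
        · exact absurd hvw.symm (by rw [hgh _ _ hvw.symm]; exact hv')
        · exact Subtype.ext hvw⟩
      have ha0 : ∀ v, a ⟨v, 0⟩ = g v.1 := fun _ => rfl
      have ha1 : ∀ v, a ⟨v, 1⟩ = h v.1 := fun _ => rfl
      refine ⟨f', fun w => rfl, ?_⟩
      rw [Finset.card_insert_of_notMem hq, add_mul, one_mul]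
      refine hr.trans (route_swap N hm (fun v : J => R v.1)
        (fun i j hij => hR _ _ (i.2.1.trans j.2.1.symm) fun h => hij (Subtype.ext h)) n a
        (fun v => by rw [ha0, ha1]; exact hw v.1) f f' fun w => ?_)
      have hfw : f' w = if c w ∈ insert q A then h w else g w := rfl
      rw [hfw]
      by_cases hwJ : c w = q ∧ g w ≠ h w
      · rw [hf, if_pos (by simp [hwJ.1]), if_neg (by rw [hwJ.1]; exact hq), ← ha0 ⟨w, hwJ⟩,
          pairPerm_apply, Equiv.swap_apply_left, ha1]
      · have hne : ∀ x, (x = g w ∨ x = h w) → x ∉ Set.range a := by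
          rintro x hx ⟨⟨v, s⟩, rfl⟩
          have hvw : v.1 = w := by
            fin_cases s
            · rcases hx with hx | hx
              · exact g.injective hx
              · exact hgh _ _ hx
            · rcases hx with hx | hx
              · exact (hgh _ _ hx.symm).symm
              · exact h.injective hx
          exact hwJ (hvw ▸ v.2)
        have hfw' : f w = g w ∨ f w = h w := by
          rw [hf]
          split_ifs <;> simp
        rw [pairPerm_of_notMem a _ (hne _ hfw'), hf]
        by_cases hcq : c w = q
        · have : g w = h w := by
            by_contra hne
            exact hwJ ⟨hcq, hne⟩
          simp [this]
        · simp [hcq]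
  obtain ⟨f, hf, hr⟩ := key Finset.univ
  have : f = h := by ext w; simp [hf]
  rwa [this, Finset.card_univ] at hr

end route

/-! ### Lattice paths -/

section lattice

variable {d : ℕ} {Λ : Finset (Fin d → ℤ)}

lemma latticeGraph_adj_update (x y : Λ) (i : Fin d) (e : ℤ) (he : |e| = 1)
    (h : y.1 = Function.update x.1 i (x.1 i + e)) : (latticeGraph Λ).Adj x y := by
  change ∑ j, |x.1 j - y.1 j| = 1
  rw [Finset.sum_eq_single i]
  · rw [h]; simpa using he
  · intro j _ hj
    rw [h]; simp [hj]
  · simp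

/-- Two sites are joined by a monotone path. -/
lemma exists_walk (x y : Λ)
    (hΛ : ∀ p : Fin d → ℤ, (∀ i, min (x.1 i) (y.1 i) ≤ p i ∧ p i ≤ max (x.1 i) (y.1 i)) → p ∈ Λ) :
    ∃ w : (latticeGraph Λ).Walk x y, w.length ≤ ∑ i, (x.1 i - y.1 i).natAbs ∧
      ∀ v ∈ w.support, ∀ i, min (x.1 i) (y.1 i) ≤ v.1 i ∧ v.1 i ≤ max (x.1 i) (y.1 i) := by
  generalize hn : ∑ i, (x.1 i - y.1 i).natAbs = n
  induction n generalizing x with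
  | zero =>
    have : x = y := by
      ext i
      have := Finset.sum_eq_zero_iff.1 hn i (Finset.mem_univ i)
      omega
    subst this
    exact ⟨SimpleGraph.Walk.nil, by simp, by simp⟩
  | succ n ih =>
    obtain ⟨i, hi⟩ : ∃ i, x.1 i ≠ y.1 i := by
      by_contra h
      push Not at h
      simp [h] at hn
    -- One step towards `y`, in a direction in which the sites differ.
    obtain ⟨e, he, hlt, hmin, hmax⟩ : ∃ e : ℤ, |e| = 1 ∧
        (x.1 i + e - y.1 i).natAbs + 1 = (x.1 i - y.1 i).natAbs ∧
        min (x.1 i) (y.1 i) ≤ min (x.1 i + e) (y.1 i) ∧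
        max (x.1 i + e) (y.1 i) ≤ max (x.1 i) (y.1 i) := by
      rcases lt_or_gt_of_ne hi with h | h
      · exact ⟨1, by simp, by omega, by omega, by omega⟩
      · exact ⟨-1, by simp, by omega, by omega, by omega⟩
    have hx' : Function.update x.1 i (x.1 i + e) ∈ Λ := by
      refine hΛ _ fun j => ?_
      by_cases hj : j = i
      · subst hj
        rw [Function.update_self]
        omega
      · rw [Function.update_of_ne hj]
        omega
    let x' : Λ := ⟨_, hx'⟩
    have hle : ∀ j, min (x.1 j) (y.1 j) ≤ min (x'.1 j) (y.1 j) ∧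
        max (x'.1 j) (y.1 j) ≤ max (x.1 j) (y.1 j) := by
      intro j
      by_cases hj : j = i
      · subst hj
        simp only [x', Function.update_self]
        exact ⟨hmin, hmax⟩
      · simp only [x', Function.update_of_ne hj]
        exact ⟨le_rfl, le_rfl⟩
    obtain ⟨w, hl, hs⟩ := ih x' (fun p hp => hΛ p fun j =>
      ⟨(hle j).1.trans (hp j).1, (hp j).2.trans (hle j).2⟩) (by
        rw [← Finset.add_sum_erase _ _ (Finset.mem_univ i)] at hn ⊢
        have : ∑ j ∈ Finset.univ.erase i, (x'.1 j - y.1 j).natAbs =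
            ∑ j ∈ Finset.univ.erase i, (x.1 j - y.1 j).natAbs :=
          Finset.sum_congr rfl fun j hj => by
            simp only [x', Function.update_of_ne (Finset.ne_of_mem_erase hj)]
        rw [this]
        simp only [x', Function.update_self]
        omega)
    refine ⟨SimpleGraph.Walk.cons (latticeGraph_adj_update x x' i e he rfl) w, ?_, ?_⟩
    · rw [SimpleGraph.Walk.length_cons]
      omega
    · intro v hv j
      rw [SimpleGraph.Walk.support_cons, List.mem_cons] at hv
      rcases hv with rfl | hv
      · omega
      · exact ⟨(hle j).1.trans (hs v hv j).1, (hs v hv j).2.trans (hle j).2⟩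

end lattice

/-! ### Recursive cooling -/

/-- The pair formed by the qubit `0` and another one. -/
def zeroPair (j : Fin 3) (hj : 0 ≠ j) : Fin 2 ↪ Fin 3 :=
  ⟨fun s => if s = 0 then 0 else j, by
    intro s t h
    fin_cases s <;> fin_cases t <;> simp at h ⊢
    exacts [hj h, hj h.symm]⟩

/-- The noise acts `t` times, then a gate on the qubits `0` and `j`. -/
def gadgetStep (N : QubitMap) (t : ℕ) (j : Fin 3) (hj : 0 ≠ j) (K : Ker (Fin 2)) : Ker (Fin 3) :=
  liftKer (zeroPair j hj) K * noiseKer (Fin 3) N ^ t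

/-- Four noisy two-qubit gates turn three qubits in the state `α` into one in the state `α'`. A gate
at a distance of at most `n + 1` takes `n` noise steps before it and `n + 1` after it; the latter are
counted with the next gate. The qubits are in the state `α` `l` noise steps before the motion for
the first gate begins, and `α'` is the state right after the last gate. -/
def Gadget (N : QubitMap) (n l : ℕ) (α α' : Lab → ℂ) : Prop :=
  ∃ K₁ K₂ K₃ K₄ : Ker (Fin 2), MixU K₁ ∧ MixU K₂ ∧ MixU K₃ ∧ MixU K₄ ∧
    red1 0 ((gadgetStep N (2 * n + 1) 2 (by decide) K₄ *
      (gadgetStep N (2 * n + 1) 1 (by decide) K₃ *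
        (gadgetStep N (2 * n + 1) 2 (by decide) K₂ *
          gadgetStep N (n + l) 1 (by decide) K₁))) *ᵥ prodTen fun _ => α) = α'

section tree

variable {d : ℕ} (hd : 0 < d)

/-- The direction in which three boxes of level `j` form one of level `j + 1`. -/
def axis (j : ℕ) : Fin d := ⟨j % d, Nat.mod_lt j hd⟩

/-- The side lengths of the boxes of level `j`. -/
def side : ℕ → Fin d → ℕ
  | 0 => fun _ => 1
  | j + 1 => Function.update (side j) (axis hd j) (3 * side j (axis hd j))

/-- The gates on the corners of three boxes of level `j` act at a distance of at most `gap + 1`. -/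
def gap (j : ℕ) : ℕ := 2 * side hd j (axis hd j) - 1

/-- The number of noise steps after the last gate of level `j`, until the next level begins: the
qubit moves back. Level `0` is the preparation of the qubits. -/
def lag : ℕ → ℕ
  | 0 => 1
  | j + 1 => gap hd j + 1

/-- The time it takes to cool up to level `j`. -/
def coolTime : ℕ → ℕ
  | 0 => 1
  | j + 1 => coolTime j + 4 * (2 * gap hd j + 1)

/-- The box of level `j` with corner `p`. -/
def box (j : ℕ) (p : Fin d → ℤ) : Set (Fin d → ℤ) :=
  {x | ∀ c, p c ≤ x c ∧ x c < p c + side hd j c}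

/-- The corners of the three boxes of level `j` in a box of level `j + 1`. -/
def subcorner (j : ℕ) (p : Fin d → ℤ) (t : Fin 3) : Fin d → ℤ :=
  Function.update p (axis hd j) (p (axis hd j) + t.1 * side hd j (axis hd j))

lemma side_pos (j : ℕ) (c : Fin d) : 0 < side hd j c := by
  induction j with
  | zero => simp [side]
  | succ j ih =>
    simp only [side, Function.update_apply]
    split_ifs with h
    · subst h; omega
    · exact ih

lemma box_subcorner (j : ℕ) (p : Fin d → ℤ) (t : Fin 3) :
    box hd j (subcorner hd j p t) ⊆ box hd (j + 1) p := by
  intro x hx c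
  have h := hx c
  simp only [subcorner, side, Function.update_apply] at h ⊢
  have ht : (t.1 : ℤ) ≤ 2 := by have := t.2; omega
  split_ifs at h ⊢ with hc
  · subst hc
    have h1 := side_pos hd j (axis hd j)
    push_cast
    constructor
    · nlinarith [h.1]
    · nlinarith [h.2]
  · exact h

lemma disjoint_subcorner (j : ℕ) (p : Fin d → ℤ) (t t' : Fin 3) (ht : t ≠ t') :
    Disjoint (box hd j (subcorner hd j p t)) (box hd j (subcorner hd j p t')) := by
  rw [Set.disjoint_left]
  intro x hx hx'
  have h := hx (axis hd j)
  have h' := hx' (axis hd j)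
  simp only [subcorner, Function.update_self] at h h'
  have h1 := side_pos hd j (axis hd j)
  have h2 : (t.1 : ℤ) < t'.1 + 1 := by
    by_contra hlt
    nlinarith [h.1, h'.2]
  have h3 : (t'.1 : ℤ) < t.1 + 1 := by
    by_contra hlt
    nlinarith [h'.1, h.2]
  exact ht (Fin.ext (by omega))

lemma subcorner_zero (j : ℕ) (p : Fin d → ℤ) : subcorner hd j p 0 = p := by
  simp [subcorner]

variable {Λ : Finset (Fin d → ℤ)} {W : Type} [Fintype W] [DecidableEq W] {m : ℕ}

lemma gadgetStep_mul_pow (N : QubitMap) (n t : ℕ) (j : Fin 3) (hj : 0 ≠ j) (K : Ker (Fin 2)) :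
    gadgetStep N n j hj K * noiseKer (Fin 3) N ^ t = gadgetStep N (n + t) j hj K := by
  rw [gadgetStep, gadgetStep, pow_add, Matrix.mul_assoc]

/-- A gate at a distance, carried out in all groups of three qubits at the same time. -/
lemma red_gadgetStep {V : Type} [Fintype V] [DecidableEq V] {I : Type} [Fintype I]
    [DecidableEq I] (N : QubitMap) (hN : TP (qker N)) (F : W ⊕ (Σ _ : I, Fin 3) ↪ V) (n l t : ℕ)
    (j : Fin 3) (hj : 0 ≠ j) (K : Ker (Fin 2)) (ψ : Ten V) (ρ : Ten W) (β : Ten (Fin 3))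
    (hψ : red F ψ = prodSt (noiseKer W N ^ l *ᵥ ρ) (noiseKer (Fin 3) N ^ t *ᵥ β)) :
    red F ((noiseKer V N ^ (n + 1) * blockKer ((famPair W I (zeroPair j hj)).trans F)
      (fun _ => K) 1 * noiseKer V N ^ n) *ᵥ ψ) =
      prodSt (noiseKer W N ^ (l + (2 * n + 1)) *ᵥ ρ)
        (noiseKer (Fin 3) N ^ (n + 1) *ᵥ (gadgetStep N (n + t) j hj K *ᵥ β)) := by
  have hpow : ∀ (t : ℕ) (ρ : Ten W) (β : Ten (Fin 3)),
      noiseKer (W ⊕ (Σ _ : I, Fin 3)) N ^ t *ᵥ prodSt ρ β =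
        prodSt (noiseKer W N ^ t *ᵥ ρ) (noiseKer (Fin 3) N ^ t *ᵥ β) := by
    intro t ρ β
    simp only [noiseKer, siteKer_pow, siteKer_prodSt]
  rw [← Matrix.mulVec_mulVec, ← Matrix.mulVec_mulVec, red_noise_pow N hN,
    red_blockKer _ _ _ _ TP_one, red_noise_pow N hN, hψ, hpow, famPair_prodSt, hpow]
  congr 1
  · rw [Matrix.mulVec_mulVec, Matrix.mulVec_mulVec, ← pow_add, ← pow_add,
      show n + 1 + n + l = l + (2 * n + 1) by omega]
  · rw [← gadgetStep_mul_pow]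
    simp only [gadgetStep, Matrix.mulVec_mulVec, Matrix.mul_assoc]

lemma red1_noise_pow (N : QubitMap) (hN : TP (qker N)) (j : Fin 3) (t : ℕ) (β : Ten (Fin 3)) :
    red1 j (noiseKer (Fin 3) N ^ t *ᵥ β) = qker N ^ t *ᵥ red1 j β := by
  ext b
  simp only [red1]
  rw [red_noise_pow N hN, noiseKer, siteKer_pow]
  simp only [Matrix.mulVec, dotProduct]
  rw [← (Equiv.funUnique Unit Lab).symm.sum_comp]
  refine Finset.sum_congr rfl fun y _ => ?_
  simp [siteKer_apply]
  left
  rfl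

/-- Cooling: if `α 0` can be prepared from the state `ω`, and the states `α` are related by gadgets,
then from qubits in the state `ω` in a box of level `j` one obtains a qubit in the state `α j` in
its corner. This is carried out for a family of disjoint boxes at the same time. -/
theorem exists_cooling (N : QubitMap) (hN : TP (qker N)) (hm : 2 ≤ m) (ω : Lab → ℂ)
    (α : ℕ → Lab → ℂ) (k : Matrix Lab Lab ℂ) (hk : MixU (oneKer k)) (hkω : k *ᵥ ω = α 0)
    (hα : ∑ b, trw b * α 0 b = 1) (J : ℕ)
    (hG : ∀ j < J, Gadget N (gap hd j) (lag hd j) (α j) (α (j + 1))) (j : ℕ) (hj : j ≤ J)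
    (I : Type) [Fintype I] [DecidableEq I] (f : W ↪ Λ) (p : I → Fin d → ℤ)
    (hΛ : ∀ i, box hd j (p i) ⊆ Λ)
    (hdisj : ∀ i i', i ≠ i' → Disjoint (box hd j (p i)) (box hd j (p i')))
    (hf : ∀ w i, (f w).1 ∉ box hd j (p i)) :
    ∃ F : W ⊕ I ↪ Λ, (∀ w, F (.inl w) = f w) ∧ (∀ i, (F (.inr i)).1 = p i) ∧
      ∃ Φ, Reach (latticeGraph Λ) m N (coolTime hd j) Φ ∧ ∀ ρ, red F (Φ *ᵥ place f ρ ω) =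
        tens (noiseKer W N ^ coolTime hd j *ᵥ ρ) (qker N ^ lag hd j *ᵥ α j) := by
  induction j generalizing I with
  | zero =>
    have hp : ∀ i, p i ∈ box hd 0 (p i) := fun i c => by simp [side]
    let F : W ⊕ I ↪ Λ := ⟨Sum.elim f fun i => ⟨p i, hΛ i (hp i)⟩, by
      rintro (v | i) (w | i') h
      · exact congrArg _ (f.injective h)
      · have h1 : (f v).1 = p i' := congrArg Subtype.val h
        exact absurd (hp i') (h1 ▸ hf v i')
      · have h1 : p i = (f w).1 := congrArg Subtype.val h
        exact absurd (hp i) (h1 ▸ hf w i)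
      · by_contra hne
        have h1 := congrArg Subtype.val h
        simp only [Sum.elim_inr] at h1
        exact Set.disjoint_left.1 (hdisj i i' fun h => hne (congrArg _ h)) (hp i) (by
          rw [h1]; exact hp i')⟩
    refine ⟨F, fun _ => rfl, fun _ => rfl, noiseKer Λ N *
      blockKer ((Equiv.sigmaPUnit W).toEmbedding.trans f) (fun _ => 1) k,
      reach_blockKer N (by omega) _ (fun w => ?_) (fun w => by simp; omega) _
        (fun w => MixU.one) _ hk, fun ρ => ?_⟩
    · refine induce_singleton_connected _ (f w) _ ?_
      ext v
      simp
    · have h1 : famKer (Equiv.sigmaPUnit W) (fun _ => 1) = 1 := by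
        ext x y
        simp [famKer, Matrix.one_apply, Finset.prod_ite_zero, funext_iff]
      rw [← Matrix.mulVec_mulVec, mulVec_place _ _ _ _ _ _ (blockKer_glue _ _ _ k), h1, hkω,
        Matrix.one_mulVec, noiseKer, siteKer_place]
      have : f = Function.Embedding.inl.trans F := rfl
      rw [this, red_place F _ _ (by rw [hN.trace, hα])]
      simp [coolTime, lag, noiseKer]
  | succ j ih =>
    -- The three boxes of level `j` in each of the boxes are cooled first.
    obtain ⟨F, hFf, hFp, Φ, hΦ, hred⟩ := ih (by omega) (Σ _ : I, Fin 3)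
      (fun i => subcorner hd j (p i.1) i.2)
      (fun i => (box_subcorner hd j _ _).trans (hΛ i.1)) (by
        rintro ⟨i, t⟩ ⟨i', t'⟩ h
        by_cases hi : i = i'
        · subst hi
          exact disjoint_subcorner hd j _ _ _ fun h' => h (Sigma.ext rfl (heq_of_eq h'))
        · exact (hdisj i i' hi).mono (box_subcorner hd j _ _) (box_subcorner hd j _ _))
      (fun w i h => hf w i.1 (box_subcorner hd j _ _ h))
    obtain ⟨K₁, K₂, K₃, K₄, hK₁, hK₂, hK₃, hK₄, hgad⟩ := hG j (by omega)
    have hs := side_pos hd j (axis hd j)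
    -- Gates between the corners of the three boxes, along straight paths.
    have hreach : ∀ (t : Fin 3) (ht : 0 ≠ t) (K : Ker (Fin 2)), MixU K →
        Reach (latticeGraph Λ) m N (2 * gap hd j + 1) (noiseKer Λ N ^ (gap hd j + 1) *
          blockKer ((famPair W I (zeroPair t ht)).trans F) (fun _ => K) 1 *
            noiseKer Λ N ^ gap hd j) := by
      intro t ht K hK
      refine reach_pairs N hm (fun i => {v | v.1 ∈ box hd (j + 1) (p i)}) (fun i i' h => ?_)
        (fun _ => K) (fun _ => hK) _ _ fun i => ?_
      · rw [Set.disjoint_left]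
        exact fun v hv hv' => Set.disjoint_left.1 (hdisj i i' h) hv hv'
      · have e0 : (((famPair W I (zeroPair t ht)).trans F) ⟨i, 0⟩).1 = p i := by
          refine (hFp ⟨i, 0⟩).trans ?_
          exact subcorner_zero hd j (p i)
        have e1 : (((famPair W I (zeroPair t ht)).trans F) ⟨i, 1⟩).1 = subcorner hd j (p i) t :=
          hFp ⟨i, t⟩
        have ht2 : (t.1 : ℤ) ≤ 2 := by have := t.2; omega
        have hbox : ∀ q : Fin d → ℤ, (∀ c, min (p i c) (subcorner hd j (p i) t c) ≤ q c ∧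
            q c ≤ max (p i c) (subcorner hd j (p i) t c)) → q ∈ box hd (j + 1) (p i) := by
          intro q hq c
          have h1 := hq c
          have h2 := side_pos hd j c
          simp only [side]
          by_cases hc : c = axis hd j
          · subst hc
            simp only [subcorner, Function.update_self] at h1 ⊢
            push_cast
            rw [min_le_iff, le_max_iff] at h1
            constructor
            · rcases h1.1 with h | h
              · exact h
              · nlinarith
            · rcases h1.2 with h | h <;> nlinarith
          · simp only [subcorner, Function.update_of_ne hc] at h1 ⊢
            omega
        obtain ⟨w, hl, hw⟩ := exists_walk (((famPair W I (zeroPair t ht)).trans F) ⟨i, 0⟩)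
          (((famPair W I (zeroPair t ht)).trans F) ⟨i, 1⟩) (by
            rw [e0, e1]
            exact fun q hq => hΛ i (hbox q hq))
        refine ⟨w, hl.trans ?_, fun v hv => ?_⟩
        · rw [e0, e1, Finset.sum_eq_single (axis hd j)]
          · simp only [subcorner, Function.update_self, gap]
            have : (p i (axis hd j) - (p i (axis hd j) + t.1 * side hd j (axis hd j))) =
              -((t.1 * side hd j (axis hd j) : ℕ) : ℤ) := by push_cast; ring
            rw [this, Int.natAbs_neg, Int.natAbs_natCast]
            have : t.1 * side hd j (axis hd j) ≤ 2 * side hd j (axis hd j) :=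
              Nat.mul_le_mul_right _ (by omega)
            omega
          · intro c _ hc
            simp [subcorner, Function.update_of_ne hc]
          · simp
        · refine hbox v.1 ?_
          rw [e0, e1] at hw
          exact hw v hv
    have htime : coolTime hd (j + 1) = coolTime hd j + (2 * gap hd j + 1) + (2 * gap hd j + 1) +
        (2 * gap hd j + 1) + (2 * gap hd j + 1) := by
      rw [coolTime]; ring
    rw [htime]
    refine ⟨(famOne W I 0).trans F, fun w => hFf w, fun i => ?_, _,
      (hreach 2 (by decide) K₄ hK₄).comp ((hreach 1 (by decide) K₃ hK₃).comp
        ((hreach 2 (by decide) K₂ hK₂).comp ((hreach 1 (by decide) K₁ hK₁).comp hΦ))), fun ρ => ?_⟩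
    · exact (hFp ⟨i, 0⟩).trans (subcorner_zero hd j (p i))
    · have h0 : red F (Φ *ᵥ place f ρ ω) = prodSt (noiseKer W N ^ coolTime hd j *ᵥ ρ)
          (noiseKer (Fin 3) N ^ lag hd j *ᵥ prodTen fun _ => α j) := by
        rw [hred, tens_eq_prodSt, noiseKer, noiseKer, siteKer_pow, siteKer_pow,
          siteKer_mulVec_prodTen]
      have h1 := red_gadgetStep N hN F (gap hd j) _ _ 1 (by decide) K₁ _ _ _ h0
      have h2 := red_gadgetStep N hN F (gap hd j) _ _ 2 (by decide) K₂ _ _ _ h1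
      have h3 := red_gadgetStep N hN F (gap hd j) _ _ 1 (by decide) K₃ _ _ _ h2
      have h4 := red_gadgetStep N hN F (gap hd j) _ _ 2 (by decide) K₄ _ _ _ h3
      rw [show gap hd j + (gap hd j + 1) = 2 * gap hd j + 1 by omega] at h4
      simp only [← Matrix.mulVec_mulVec] at hgad h4 ⊢
      rw [← red_red, h4, red_prodSt, red1_noise_pow N hN, hgad]
      rfl

end tree

/-! ### The arrangement of the qubits -/

section arrangement

variable {d : ℕ} {Λ' : Finset (Fin d → ℤ)} {m : ℕ}

lemma abs_sub_le_walk_length {P : Set Λ'} {x y : P}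
    (w : ((latticeGraph Λ').induce P).Walk x y) (i : Fin d) :
    |x.1.1 i - y.1.1 i| ≤ w.length := by
  induction w with
  | nil => simp
  | @cons u v z h w ih =>
    have h1 : ∑ i, |u.1.1 i - v.1.1 i| = 1 := h
    have h2 : |u.1.1 i - v.1.1 i| ≤ 1 := by
      rw [← h1]
      exact Finset.single_le_sum (f := fun i => |u.1.1 i - v.1.1 i|)
        (fun _ _ => abs_nonneg _) (Finset.mem_univ i)
    have h3 := abs_sub_le (u.1.1 i) (v.1.1 i) (z.1.1 i)
    rw [SimpleGraph.Walk.length_cons]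
    push_cast
    linarith

lemma abs_sub_lt_of_mem_part (L : Layer (latticeGraph Λ') m) {P : Finset Λ'}
    (hP : P ∈ L.parts.parts) {x y : Λ'} (hx : x ∈ P) (hy : y ∈ P) (i : Fin d) :
    |x.1 i - y.1 i| ≤ (m : ℤ) - 1 := by
  classical
  obtain ⟨w⟩ := (L.connected P hP).preconnected ⟨x, hx⟩ ⟨y, hy⟩
  have h1 := abs_sub_le_walk_length w.toPath.1 i
  have h2 := w.toPath.2.length_lt
  have h3 := L.card_le P hP
  have h4 : Fintype.card (P : Set Λ') = P.card := by simp
  have h5 : (w.toPath.1.length : ℤ) ≤ m - 1 := by omega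
  exact h1.trans h5

/-- A member of each group of a layer, one with the largest coordinate in the direction `i₀`. -/
lemma exists_root (L : Layer (latticeGraph Λ') m) (i₀ : Fin d) : ∃ r : Λ' → Λ',
    (∀ P ∈ L.parts.parts, ∀ x ∈ P, ∀ y ∈ P, r x = r y) ∧
    (∀ P ∈ L.parts.parts, ∀ x ∈ P, r x ∈ P) ∧ ∀ x, x.1 i₀ ≤ (r x).1 i₀ := by
  have h : ∀ x, ∃ y ∈ L.parts.part x, ∀ z ∈ L.parts.part x, z.1 i₀ ≤ y.1 i₀ := fun x =>
    Finset.exists_max_image _ (fun z : Λ' => z.1 i₀)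
      ⟨x, L.parts.mem_part (Finset.mem_univ x)⟩
  have h' : ∀ P : Finset Λ', ∃ y : Λ' → Λ', ∀ x, P = L.parts.part x → y x ∈ P ∧
      (∀ z ∈ P, z.1 i₀ ≤ (y x).1 i₀) ∧ ∀ x', P = L.parts.part x' → y x' = y x := by
    intro P
    by_cases hP : ∃ x, P = L.parts.part x
    · obtain ⟨x, rfl⟩ := hP
      obtain ⟨y, hy, hy'⟩ := h x
      exact ⟨fun _ => y, fun _ _ => ⟨hy, hy', fun _ _ => rfl⟩⟩
    · exact ⟨id, fun x hx => absurd ⟨x, hx⟩ hP⟩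
  choose y hy using h'
  have hpart : ∀ P ∈ L.parts.parts, ∀ x ∈ P, L.parts.part x = P := fun P hP x hx =>
    L.parts.part_eq_of_mem hP hx
  refine ⟨fun x => y (L.parts.part x) x, fun P hP x hx z hz => ?_, fun P hP x hx => ?_,
    fun x => (hy _ x rfl).2.1 x (L.parts.mem_part (Finset.mem_univ x))⟩
  · simp only [hpart P hP x hx, hpart P hP z hz]
    exact (hy P z (hpart P hP z hz).symm).2.2 x (hpart P hP x hx).symm
  · simp only [hpart P hP x hx]
    exact (hy P x (hpart P hP x hx).symm).1

/-- A translation of a group of sites preserves its connectedness. -/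
lemma connected_image {Λ : Finset (Fin d → ℤ)} {P : Set Λ'} (g : Λ' → Λ)
    (hP : ((latticeGraph Λ').induce P).Connected)
    (hg : ∀ x ∈ P, ∀ y ∈ P, ∀ i, (g x).1 i - (g y).1 i = x.1 i - y.1 i) :
    ((latticeGraph Λ).induce (g '' P)).Connected := by
  let φ : (latticeGraph Λ').induce P →g (latticeGraph Λ).induce (g '' P) :=
    ⟨fun x => ⟨g x.1, x.1, x.2, rfl⟩, fun {x y} h => by
      have h1 : ∑ i, |x.1.1 i - y.1.1 i| = 1 := h
      change ∑ i, |(g x.1).1 i - (g y.1).1 i| = 1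
      rw [← h1]
      exact Finset.sum_congr rfl fun i _ => by rw [hg _ x.2 _ y.2]⟩
  refine hP.map φ ?_
  rintro ⟨_, x, hx, rfl⟩
  exact ⟨⟨x, hx⟩, rfl⟩

lemma eq_of_mul_add {S a b e f : ℤ} (h : S * a + e = S * b + f) (he : |e - f| < S) : a = b := by
  rw [abs_lt] at he
  by_contra hab
  rcases lt_or_gt_of_ne hab with h1 | h1
  · nlinarith
  · nlinarith

/-- The time for a qubit to go home or back when the homes are `S` apart. -/
def routeTime (d m S : ℕ) : ℕ := (2 * m) ^ d * (2 * (d * ((S - 1) * (m - 1))) + 1)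

/-- The arrangement: homes of the qubits, disjoint boxes, and for every layer of a circuit positions
outside of the boxes where the groups are connected and from which the homes can be reached. The
positions of qubits that form a group of their own are next to the corners of their boxes. -/
theorem exists_arrangement (hd : 0 < d) (hm : 2 ≤ m) (s j : ℕ) (hs : ∀ c, side hd j c ≤ s)
    (Λ' : Finset (Fin d → ℤ)) : ∃ Λ : Finset (Fin d → ℤ),
    Λ.card ≤ (2 * (m * (s + 2 * m)) + 1) ^ d * Λ'.card ∧
    ∃ (home : Λ' ↪ Λ) (corner : Λ' → Fin d → ℤ),
      (∀ v, box hd j (corner v) ⊆ Λ) ∧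
      (∀ v w, v ≠ w → Disjoint (box hd j (corner v)) (box hd j (corner w))) ∧
      (∀ w v, (home w).1 ∉ box hd j (corner v)) ∧
      ∀ L : Layer (latticeGraph Λ') m, ∃ g : Λ' ↪ Λ,
        (∀ P ∈ L.parts.parts, ((latticeGraph Λ).induce (g '' P)).Connected) ∧
        (∀ w, {w} ∈ L.parts.parts → ∀ p : Λ, p.1 = corner w → (latticeGraph Λ).Adj (g w) p) ∧
        (∀ w v, (g w).1 ∉ box hd j (corner v)) ∧
        ∀ N, Route (latticeGraph Λ) m N (routeTime d m (s + 2 * m)) g home ∧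
          Route (latticeGraph Λ) m N (routeTime d m (s + 2 * m)) home g := by
  classical
  set S := s + 2 * m with hS
  have hSZ : (S : ℤ) = s + 2 * m := by rw [hS]; push_cast; ring
  have hmZ : (2 : ℤ) ≤ m := by exact_mod_cast hm
  have hs0 : (0 : ℤ) ≤ s := by positivity
  -- The coordinates are scaled by `S`. The box of `v` has its corner at `S * v`, and the home of `v`
  -- is next to this corner, outside of the box in the direction `i₀`.
  let i₀ : Fin d := ⟨0, hd⟩
  -- `site r w` is the site of `w` when its group is gathered around the home of `r`. If `r` has the
  -- largest coordinate in the direction `i₀` within the group, these sites avoid the boxes.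
  let site : Λ' → Λ' → Fin d → ℤ := fun r w i =>
    S * r.1 i + (w.1 i - r.1 i) - if i = i₀ then 1 else 0
  let Λ : Finset (Fin d → ℤ) := Finset.univ.biUnion fun v : Λ' =>
    Finset.Icc (fun i => S * v.1 i - (m * S : ℕ)) (fun i => S * v.1 i + (m * S : ℕ))
  have hmem : ∀ (v : Λ') (p : Fin d → ℤ), (∀ i, |p i - S * v.1 i| ≤ (m * S : ℕ)) → p ∈ Λ := by
    intro v p hp
    refine Finset.mem_biUnion.2 ⟨v, Finset.mem_univ v, Finset.mem_Icc.2 ⟨fun i => ?_, fun i => ?_⟩⟩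
    · have := abs_le.1 (hp i); linarith
    · have := abs_le.1 (hp i); linarith
  have hmS : ((m * S : ℕ) : ℤ) = m * S := by push_cast; ring
  have hbox : ∀ v : Λ', box hd j (fun i => S * v.1 i) ⊆ (Λ : Set (Fin d → ℤ)) := by
    intro v p hp
    refine hmem v p fun i => ?_
    have h1 := hp i
    have h2 : (side hd j i : ℤ) ≤ s := by exact_mod_cast hs i
    rw [hmS, abs_le]
    constructor <;> nlinarith
  -- Offsets within two groups are too small to bridge the distance of two homes.
  have hsite : ∀ r r' w w' : Λ', (∀ i, |w.1 i - r.1 i| ≤ (m : ℤ) - 1) →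
      (∀ i, |w'.1 i - r'.1 i| ≤ (m : ℤ) - 1) → site r w = site r' w' → r = r' ∧ w = w' := by
    intro r r' w w' h h' heq
    have hr : r = r' := by
      ext i
      have h1 := congrFun heq i
      simp only [site] at h1
      have h2 := abs_le.1 (h i)
      have h3 := abs_le.1 (h' i)
      refine eq_of_mul_add (S := S) (e := w.1 i - r.1 i) (f := w'.1 i - r'.1 i) (by linarith) ?_
      rw [abs_lt]
      constructor <;> linarith
    subst hr
    refine ⟨rfl, ?_⟩
    ext i
    have h1 := congrFun heq i
    simp only [site] at h1
    linarith
  have hsite_box : ∀ r w v : Λ', (∀ i, |w.1 i - r.1 i| ≤ (m : ℤ) - 1) → w.1 i₀ ≤ r.1 i₀ →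
      site r w ∉ box hd j (fun i => S * v.1 i) := by
    intro r w v h h0 hin
    have hv : ∀ i, v.1 i = r.1 i := by
      intro i
      have h1 := hin i
      have h2 : (side hd j i : ℤ) ≤ s := by exact_mod_cast hs i
      have h3 := abs_le.1 (h i)
      simp only [site] at h1
      by_contra hne
      rcases lt_or_gt_of_ne hne with hlt | hlt
      · split_ifs at h1 <;> nlinarith
      · split_ifs at h1 <;> nlinarith
    have h1 := hin i₀
    simp only [site, if_true] at h1
    rw [hv i₀] at h1
    linarith
  have hhome : ∀ v : Λ', ∀ i, |v.1 i - v.1 i| ≤ (m : ℤ) - 1 := fun v i => by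
    rw [sub_self, abs_zero]; linarith
  have hsite_mem : ∀ r w : Λ', (∀ i, |w.1 i - r.1 i| ≤ (m : ℤ) - 1) → ∀ p : Fin d → ℤ,
      (∀ i, min (site r w i) (site w w i) ≤ p i ∧ p i ≤ max (site r w i) (site w w i)) →
      ∀ i, |p i - site w w i| ≤ (S - 1) * (m - 1) := by
    intro r w h p hp i
    have h1 := hp i
    have h3 := abs_le.1 (h i)
    have h4 : site r w i - site w w i = (S - 1) * (r.1 i - w.1 i) := by simp only [site]; ring
    have h5 : (0 : ℤ) ≤ S - 1 := by linarith
    rw [min_le_iff, le_max_iff] at h1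
    have h6 : |site r w i - site w w i| ≤ (S - 1) * (m - 1) := by
      rw [h4, abs_mul, abs_of_nonneg h5, abs_sub_comm]
      exact mul_le_mul_of_nonneg_left (h i) h5
    have h8 : (0 : ℤ) ≤ (S - 1) * (m - 1) := mul_nonneg h5 (by linarith)
    rw [abs_le] at h6 ⊢
    constructor
    · rcases h1.1 with h7 | h7 <;> linarith [h6.1]
    · rcases h1.2 with h7 | h7 <;> linarith [h6.2]
  have hpath : ∀ r w : Λ', (∀ i, |w.1 i - r.1 i| ≤ (m : ℤ) - 1) → ∀ p : Fin d → ℤ,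
      (∀ i, min (site r w i) (site w w i) ≤ p i ∧ p i ≤ max (site r w i) (site w w i)) →
      p ∈ Λ := by
    intro r w h p hp
    refine hmem w p fun i => ?_
    have h1 := abs_le.1 (hsite_mem r w h p hp i)
    have h2 : site w w i = S * w.1 i - if i = i₀ then 1 else 0 := by simp [site]
    rw [hmS, abs_le]
    split_ifs at h2 <;> constructor <;> nlinarith
  have hgmem : ∀ r w : Λ', (∀ i, |w.1 i - r.1 i| ≤ (m : ℤ) - 1) → site r w ∈ Λ := fun r w h =>
    hpath r w h _ fun i => ⟨min_le_left _ _, le_max_left _ _⟩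
  let home : Λ' ↪ Λ := ⟨fun v => ⟨site v v, hgmem v v (hhome v)⟩, fun v w h =>
    (hsite v w v w (hhome v) (hhome w) (congrArg Subtype.val h)).1⟩
  refine ⟨Λ, ?_, home, fun v i => S * v.1 i, hbox, fun v w hvw => ?_,
    fun w v => hsite_box w w v (hhome w) le_rfl, fun L => ?_⟩
  · refine Finset.card_biUnion_le.trans ?_
    refine (Finset.sum_le_card_nsmul _ _ ((2 * (m * S) + 1) ^ d) fun v _ => ?_).trans
      (by simp [mul_comm])
    rw [Pi.card_Icc]
    simp only [Int.card_Icc]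
    refine (Finset.prod_le_pow_card _ _ (2 * (m * S) + 1) fun i _ => ?_).trans (by simp)
    generalize m * S = M
    omega
  · rw [Set.disjoint_left]
    intro p hp hp'
    refine hvw (Subtype.ext (funext fun i => ?_))
    have h1 := hp i
    have h2 := hp' i
    have h3 : (side hd j i : ℤ) ≤ s := by exact_mod_cast hs i
    by_contra hne
    rcases lt_or_gt_of_ne hne with hlt | hlt <;> nlinarith
  · obtain ⟨r, hr, hrP, hr0⟩ := exists_root L i₀
    have hrw : ∀ w i, |w.1 i - (r w).1 i| ≤ (m : ℤ) - 1 := fun w i =>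
      abs_sub_lt_of_mem_part L (L.parts.part_mem.2 (Finset.mem_univ w))
        (L.parts.mem_part (Finset.mem_univ w))
        (hrP _ (L.parts.part_mem.2 (Finset.mem_univ w)) _ (L.parts.mem_part (Finset.mem_univ w))) i
    let g : Λ' ↪ Λ := ⟨fun w => ⟨site (r w) w, hgmem _ _ (hrw w)⟩, fun v w h =>
      (hsite _ _ v w (hrw v) (hrw w) (congrArg Subtype.val h)).2⟩
    refine ⟨g, fun P hP => connected_image g (L.connected P hP) fun x hx y hy i => ?_,
      fun w hw p hp => ?_, fun w v => hsite_box _ w v (hrw w) (hr0 w), fun N => ?_⟩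
    · have : r x = r y := hr P hP x hx y hy
      change site (r x) x i - site (r y) y i = _
      rw [this]
      simp only [site]
      ring
    · have h1 : r w = w := Finset.mem_singleton.1 (hrP _ hw w (Finset.mem_singleton_self w))
      change ∑ i, |site (r w) w i - p.1 i| = 1
      rw [h1, hp, Finset.sum_eq_single i₀]
      · simp [site]
      · intro i _ hi
        simp [site, hi]
      · simp
    · -- Qubits of the same class have homes at a distance of at least `2 * m * S`, so that the
      -- regions `R` of their motions are disjoint.
      let cls : Λ' → Fin d → Fin (2 * m) := fun v i => ⟨(v.1 i % (2 * m)).toNat, by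
        have h1 := Int.emod_lt_of_pos (v.1 i) (show (0 : ℤ) < 2 * m by linarith)
        have h2 := Int.emod_nonneg (v.1 i) (show (2 * m : ℤ) ≠ 0 by linarith)
        omega⟩
      let R : Λ' → Set Λ := fun v => {u | ∀ i, |u.1 i - site v v i| ≤ (S - 1) * (m - 1)}
      have hcard : Fintype.card (Fin d → Fin (2 * m)) = (2 * m) ^ d := by simp
      have hR : ∀ v w, cls v = cls w → v ≠ w → Disjoint (R v) (R w) := by
        intro v w hc hvw
        rw [Set.disjoint_left]
        intro u hu hu'
        refine hvw (Subtype.ext (funext fun i => ?_))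
        have h1 : v.1 i % (2 * m) = w.1 i % (2 * m) := by
          have h1 := congrArg Fin.val (congrFun hc i)
          have h2 := Int.emod_nonneg (v.1 i) (show (2 * m : ℤ) ≠ 0 by linarith)
          have h3 := Int.emod_nonneg (w.1 i) (show (2 * m : ℤ) ≠ 0 by linarith)
          simp only [cls] at h1
          omega
        have h2 : (2 * m : ℤ) ∣ v.1 i - w.1 i :=
          Int.ModEq.dvd (show w.1 i ≡ v.1 i [ZMOD 2 * m] from h1.symm)
        obtain ⟨e, he⟩ := h2
        have h3 := abs_le.1 (hu i)
        have h4 := abs_le.1 (hu' i)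
        have h5 : site v v i - site w w i = S * (v.1 i - w.1 i) := by simp only [site]; ring
        rw [he] at h5
        have h6 : (0 : ℤ) < S := by linarith
        by_contra hne
        have he0 : e ≠ 0 := by
          rintro rfl
          exact hne (by linarith)
        rcases lt_or_gt_of_ne he0 with hlt | hlt
        · have : (S : ℤ) * (2 * m * e) ≤ - (2 * (S * m)) := by
            nlinarith [mul_pos h6 (by linarith : (0 : ℤ) < m)]
          nlinarith
        · have : 2 * ((S : ℤ) * m) ≤ S * (2 * m * e) := by
            nlinarith [mul_pos h6 (by linarith : (0 : ℤ) < m)]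
          nlinarith
      have hwalk : ∀ v, ∃ w : (latticeGraph Λ).Walk (g v) (home v),
          w.length ≤ d * ((S - 1) * (m - 1)) + 1 ∧ ∀ u ∈ w.support, u ∈ R v := by
        intro v
        obtain ⟨w, hl, hw⟩ := exists_walk (g v) (home v) (hpath _ v (hrw v))
        refine ⟨w, hl.trans ?_, fun u hu => hsite_mem _ v (hrw v) u.1 (hw u hu)⟩
        refine le_trans ?_ (Nat.le_succ _)
        refine (Finset.sum_le_card_nsmul _ _ ((S - 1) * (m - 1)) fun i _ => ?_).trans (by simp)
        have h1 := hsite_mem _ v (hrw v) (g v).1 (fun i => ⟨min_le_left _ _, le_max_left _ _⟩) i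
        have h2 : (((S - 1) * (m - 1) : ℕ) : ℤ) = (S - 1) * (m - 1) := by
          push_cast [Nat.cast_sub (show 1 ≤ S by omega), Nat.cast_sub (show 1 ≤ m by omega)]
          ring
        rw [← h2, Int.abs_eq_natAbs] at h1
        exact_mod_cast h1
      constructor
      · have := route_classes (m := m) N hm cls g home (fun v w h =>
          (hsite _ _ w v (hrw w) (hhome v) (congrArg Subtype.val h)).2) R hR _ hwalk
        rwa [hcard] at this
      · have := route_classes (m := m) N hm cls home g (fun v w h =>
          (hsite _ _ w v (hhome w) (hrw v) (congrArg Subtype.val h)).2) R hR _ (fun v => by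
            obtain ⟨w, hl, hw⟩ := hwalk v
            exact ⟨w.reverse, by rwa [SimpleGraph.Walk.length_reverse], fun u hu =>
              hw u (by rwa [SimpleGraph.Walk.support_reverse, List.mem_reverse] at hu)⟩)
        rwa [hcard] at this

lemma axis_mul_add (hd : 0 < d) (l k : ℕ) (hk : k < d) : axis hd (d * l + k) = ⟨k, hk⟩ := by
  ext
  simp [axis, Nat.mod_eq_of_lt hk]

lemma side_mul_add (hd : 0 < d) (l k : ℕ) (hk : k ≤ d) (c : Fin d) : side hd (d * l + k) c =
    if c.1 < k then 3 * side hd (d * l) c else side hd (d * l) c := by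
  induction k generalizing c with
  | zero => simp
  | succ k ih =>
    rw [← add_assoc, side, axis_mul_add hd l k (by omega), Function.update_apply, ih (by omega),
      ih (by omega)]
    by_cases h1 : c = ⟨k, by omega⟩
    · subst h1
      simp
    · have h2 : c.1 ≠ k := fun h => h1 (Fin.ext h)
      rw [if_neg h1]
      exact if_congr (by omega) rfl rfl

lemma side_mul (hd : 0 < d) (l : ℕ) (c : Fin d) : side hd (d * l) c = 3 ^ l := by
  induction l with
  | zero => simp [side]
  | succ l ih => rw [mul_add, mul_one, side_mul_add hd l d le_rfl, if_pos c.2, ih, pow_succ, mul_comm]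

lemma side_le (hd : 0 < d) {j l : ℕ} (hj : j ≤ d * l) (c : Fin d) : side hd j c ≤ 3 ^ l := by
  rw [← side_mul hd l c]
  refine monotone_nat_of_le_succ (f := fun j => side hd j c) (fun j => ?_) hj
  simp only [side, Function.update_apply]
  split_ifs with h
  · subst h; omega
  · exact le_rfl

/-- The cooling time is proportional to the side length of the boxes. -/
lemma coolTime_mul_le (hd : 0 < d) (l : ℕ) : coolTime hd (d * l) ≤ 8 * d * 3 ^ l := by
  have key : ∀ l k, k ≤ d → coolTime hd (d * l + k) ≤ coolTime hd (d * l) + 16 * k * 3 ^ l := by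
    intro l k hk
    induction k with
    | zero => simp
    | succ k ih =>
      rw [← add_assoc, coolTime, gap, side_mul_add hd l k (by omega),
        axis_mul_add hd l k (by omega), if_neg (lt_irrefl _), side_mul]
      have := ih (by omega)
      have : 16 * (k + 1) * 3 ^ l = 16 * k * 3 ^ l + 16 * 3 ^ l := by ring
      have : 0 < 3 ^ l := by positivity
      omega
  have key' : coolTime hd (d * l) + 8 * d ≤ 8 * d * 3 ^ l + 1 := by
    induction l with
    | zero => simp [coolTime]; omega
    | succ l ih =>
      have := key l d le_rfl
      rw [mul_add, mul_one]
      have : 8 * d * 3 ^ (l + 1) = 8 * d * 3 ^ l + 16 * d * 3 ^ l := by ring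
      omega
  omega

end arrangement

/-! ### The simulation -/

section simulation

lemma red_place_self {W V : Type} [Fintype W] [DecidableEq W] [Fintype V] [DecidableEq V]
    (f : W ↪ V) (ρ : Ten W) (ω : Lab → ℂ) (hω : ∑ b, trw b * ω b = 1) :
    red f (place f ρ ω) = ρ := by
  ext z
  have h := prod_sum_choice fun (_ : Off f) (b : Lab) => trw b * ω b
  simp only [hω, Finset.prod_const_one] at h
  rw [← mul_one (ρ z), h, Finset.mul_sum]
  refine Finset.sum_congr rfl fun o _ => ?_
  simp only [place, glue_apply, glue_off, Finset.prod_mul_distrib]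
  ring

/-- Circuits in the representation by kernels solve the simulation problem. -/
lemma Reach.simulates {V W : Type} [Fintype V] [DecidableEq V] [Fintype W] [DecidableEq W] {m : ℕ}
    {G : SimpleGraph V} {H : SimpleGraph W} {N N' : QubitMap} {D : ℕ} {target : List (Layer H m)}
    {Φ : Ker V} (hΦ : Reach G m N D Φ) (input output : W ↪ V)
    (h : ∀ ρ : Operator W, red output (Φ *ᵥ place input (vec ρ) zeroState) =
      vec (runNoisy N' target ρ)) : Simulates G N D N' target := by
  obtain ⟨ι, _, p, c, hp, hs, hc, rfl⟩ := hΦ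
  let e := (Fintype.equivFin ι).symm
  refine ⟨input, output, Fintype.card ι, p ∘ e, c ∘ e, fun k => hp _, ?_, fun k => hc _,
    fun ρ => vec_injective ?_⟩
  · rw [← hs]
    exact e.sum_comp p
  · rw [vec_reduceState, ← h, ← vec_embedState]
    congr 1
    rw [← e.sum_comp]
    ext x
    rw [Matrix.sum_mulVec, Finset.sum_apply]
    simp only [vec, Matrix.sum_apply, Matrix.smul_apply]
    refine Finset.sum_congr rfl fun k _ => ?_
    rw [Matrix.smul_mulVec, ← vec_runNoisy]
    rfl

lemma vec_noiseLayer_pow_mul_flipMap {W : Type} [Fintype W] [DecidableEq W] (N : QubitMap) (T : ℕ)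
    (r : ℝ) (ρ : Operator W) : vec (noiseLayer (N ^ T * flipMap r) ρ) =
      noiseKer W N ^ T *ᵥ (siteKer (fun _ => flipKer r) *ᵥ vec ρ) := by
  rw [vec_noiseLayer, qker_mul, qker_pow, qker_flipMap, noiseKer, siteKer_pow,
    Matrix.mulVec_mulVec, siteKer_mul]

variable {d m : ℕ}

/-- The duration of the simulation of one layer: gates and RESETs, moving the qubits home and to
their places for the next layer, waiting, and cooling. -/
def roundTime (hd : 0 < d) (m s j w : ℕ) : ℕ :=
  3 + (2 * routeTime d m (s + 2 * m) + w) + coolTime hd j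

/-- The state, when the cooling begins, of a qubit that was depolarized at the end of the gates and
RESETs of the round. -/
def idleState (d m : ℕ) (N : QubitMap) (s w : ℕ) : Lab → ℂ :=
  qker N ^ (2 * routeTime d m (s + 2 * m) + w + 1) *ᵥ diagState 0

/-- If gadgets turn idle qubits into qubits of polarization `1 - 2 * r`, then circuits of unitary
gates and RESETs subject to bit flips at rate `r` and to the noise of one round can be simulated. -/
theorem exists_simulation (hd : 0 < d) (hm : 2 ≤ m) (N : QubitMap) (hN : IsChannel N) (s j w : ℕ)
    (hs : ∀ c, side hd j c ≤ s) (α : ℕ → Lab → ℂ)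
    (hα : ∃ k, MixU (oneKer k) ∧ k *ᵥ idleState d m N s w = α 0)
    (hα1 : ∑ b, trw b * α 0 b = 1)
    (hG : ∀ i < j, Gadget N (gap hd i) (lag hd i) (α i) (α (i + 1)))
    {r : ℝ} (h0 : 0 ≤ r) (h1 : r ≤ 1)
    (hr : ∃ k, MixU (oneKer k) ∧ TP k ∧ k *ᵥ (qker N ^ lag hd j *ᵥ α j) = diagState (1 - 2 * r))
    (Λ' : Finset (Fin d → ℤ)) : ∃ Λ : Finset (Fin d → ℤ),
    Λ.card ≤ (2 * (m * (s + 2 * m)) + 1) ^ d * Λ'.card ∧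
    ∀ target : List (Layer (latticeGraph Λ') m),
      Simulates (latticeGraph Λ) N (roundTime hd m s j w * target.length)
        (N ^ roundTime hd m s j w * flipMap r) target := by
  classical
  have hT := hN.TP
  obtain ⟨Λ, hcard, home, corner, hbox, hdisj, hhome, hg⟩ := exists_arrangement hd hm s j hs Λ'
  refine ⟨Λ, hcard, ?_⟩
  choose g hgP hgadj hgbox hroute using hg
  obtain ⟨k, hk, hkω⟩ := hα
  -- The positions of the qubits before the execution of a list of layers.
  let pos : List (Layer (latticeGraph Λ') m) → (Λ' ↪ Λ)
    | [] => home
    | L :: _ => g L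
  have hpos : ∀ Ls w v, (pos Ls w).1 ∉ box hd j (corner v) := by
    intro Ls
    cases Ls with
    | nil => exact hhome
    | cons L Ls => exact hgbox L
  have hpos_route : ∀ Ls, Route (latticeGraph Λ) m N (routeTime d m (s + 2 * m)) home (pos Ls) := by
    intro Ls
    cases Ls with
    | nil =>
      exact Route.idle N (by omega) _ home
    | cons L Ls => exact (hroute L N).2
  set T := roundTime hd m s j w with hTdef
  set N' := N ^ T * flipMap r
  -- Before a round, the register is in its positions, each box has a fresh qubit in the state `γ` in
  -- its corner, and nothing else is used of the state.
  have key : ∀ (Ls : List (Layer (latticeGraph Λ') m)) (F : Λ' ⊕ Λ' ↪ Λ) (γ : Lab → ℂ),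
      (∀ w, F (.inl w) = pos Ls w) → (∀ w, (F (.inr w)).1 = corner w) →
      (∃ k, MixU (oneKer k) ∧ TP k ∧ k *ᵥ γ = diagState (1 - 2 * r)) →
      ∃ Φ, Reach (latticeGraph Λ) m N (T * Ls.length) Φ ∧
        ∀ (ψ : Ten Λ) (ρ : Operator Λ'), red F ψ = tens (vec ρ) γ →
          red home (Φ *ᵥ ψ) = vec (runNoisy N' Ls ρ) := by
    intro Ls
    induction Ls with
    | nil =>
      intro F γ hF _ ⟨k, _, hkT, hkγ⟩
      refine ⟨1, Reach.zero N, fun ψ ρ h => ?_⟩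
      have hF' : home = Function.Embedding.inl.trans F := by
        ext1 w; exact (hF w).symm
      rw [Matrix.one_mulVec, hF', ← red_red, h, tens_eq_place, red_place_self, runNoisy]
      rw [← hkT.trace, hkγ, trace_diagState]
    | cons L Ls ih =>
      intro F γ hF hF' hγ
      obtain ⟨Φ₁, hΦ₁, h₁⟩ := reach_layer N hT hm L F (g L) hF (hgP L)
        (fun w hw => hgadj L w hw _ (hF' w)) h0 h1 γ hγ
      obtain ⟨Φ₂, hΦ₂, h₂⟩ := ((hroute L N).1.trans (hpos_route Ls)).trans
        (Route.idle N (by omega) w (pos Ls))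
      obtain ⟨F', hF₁, hF₂, Φ₃, hΦ₃, h₃⟩ := exists_cooling (m := m) hd N hT hm _ α k hk hkω hα1 j hG
        j le_rfl Λ' (pos Ls) corner hbox hdisj (hpos Ls)
      obtain ⟨Φ₄, hΦ₄, h₄⟩ := ih F' _ hF₁ hF₂ hr
      refine ⟨Φ₄ * (Φ₃ * (Φ₂ * Φ₁)), ?_, fun ψ ρ h => ?_⟩
      · convert hΦ₄.comp (hΦ₃.comp (hΦ₂.comp hΦ₁)) using 1
        rw [hTdef, roundTime, List.length_cons]
        ring
      · simp only [← Matrix.mulVec_mulVec]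
        rw [runNoisy]
        refine h₄ _ _ ?_
        have hω : qker N ^ (routeTime d m (s + 2 * m) + routeTime d m (s + 2 * m) + w) *ᵥ
            (qker N *ᵥ diagState 0) = idleState d m N s w := by
          rw [idleState, Matrix.mulVec_mulVec, ← pow_succ, ← two_mul]
        rw [h₁ ψ ρ h, h₂, hω, h₃, vec_noiseLayer_pow_mul_flipMap]
        simp only [Matrix.mulVec_mulVec, ← mul_assoc, ← pow_add]
        rw [show T = coolTime hd j + (routeTime d m (s + 2 * m) + routeTime d m (s + 2 * m) + w) + 3
          by rw [hTdef, roundTime]; ring]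
        simp only [add_assoc]
  intro target
  have hc : ∀ v, corner v ∈ box hd j (corner v) := fun v c => by
    have := side_pos hd j c
    constructor <;> omega
  let F : Λ' ⊕ Λ' ↪ Λ := ⟨Sum.elim (pos target) fun v => ⟨corner v, hbox v (hc v)⟩, by
    rintro (v | v) (w | w) h
    · exact congrArg _ ((pos target).injective h)
    · have h1 : (pos target v).1 = corner w := congrArg Subtype.val h
      exact absurd (hc w) (h1 ▸ hpos target v w)
    · have h1 : corner v = (pos target w).1 := congrArg Subtype.val h
      exact absurd (hc v) (h1 ▸ hpos target w v)
    · have h1 : corner v = corner w := congrArg Subtype.val h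
      by_contra hne
      exact Set.disjoint_left.1 (hdisj v w fun h => hne (congrArg _ h)) (hc v) (h1 ▸ hc w)⟩
  obtain ⟨Φ, hΦ, h⟩ := key target F zeroState (fun _ => rfl) (fun _ => rfl)
    ⟨flipKer r, mixU_flipKer h0 h1, TP_flipKer r, flipKer_zeroState r⟩
  refine hΦ.simulates (pos target) home fun ρ => h _ _ ?_
  have : pos target = Function.Embedding.inl.trans F := rfl
  rw [this, red_place]
  simp [trw, zeroState]

end simulation

/-! ### The majority gadget -/

section lift

variable {T : Type} [Fintype T] [DecidableEq T]

/-- Change the labels of a pair of sites. -/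
def override (τ : Fin 2 ↪ T) (z : Fin 2 → Lab) (x : T → Lab) : T → Lab :=
  fun v => if v = τ 0 then z 0 else if v = τ 1 then z 1 else x v

lemma override_apply (τ : Fin 2 ↪ T) (z : Fin 2 → Lab) (x : T → Lab) (s : Fin 2) :
    override τ z x (τ s) = z s := by
  fin_cases s
  · simp [override]
  · simp [override]

lemma override_off (τ : Fin 2 ↪ T) (z : Fin 2 → Lab) (x : T → Lab) (o : Off τ) :
    override τ z x o.1 = x o.1 := by
  have h : ∀ s, o.1 ≠ τ s := fun s hs => o.2 ⟨s, hs.symm⟩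
  simp [override, h]

lemma override_override (τ : Fin 2 ↪ T) (z w : Fin 2 → Lab) (x : T → Lab) :
    override τ w (override τ z x) = override τ w x := by
  funext v
  simp only [override]
  split_ifs <;> rfl

lemma liftKer_mulVec (τ : Fin 2 ↪ T) (K : Ker (Fin 2)) (β : Ten T) (x : T → Lab) :
    (liftKer τ K *ᵥ β) x = ∑ z, K (fun s => x (τ s)) z * β (override τ z x) := by
  simp only [Matrix.mulVec, dotProduct]
  rw [sum_glue τ]
  refine Finset.sum_congr rfl fun z _ => ?_
  rw [Finset.sum_eq_single fun o : Off τ => x o.1]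
  · have h : glue τ z (fun o : Off τ => x o.1) = override τ z x :=
      (eq_glue τ z _ _ (override_apply τ z x) (override_off τ z x)).symm
    rw [h]
    simp only [liftKer, Matrix.of_apply, override_apply, override_off, if_true,
      Finset.prod_const_one, mul_one]
  · intro o _ ho
    obtain ⟨u, hu⟩ := Function.ne_iff.1 ho
    simp only [liftKer, Matrix.of_apply, glue_apply, glue_off]
    rw [Finset.prod_eq_zero (Finset.mem_univ u) (if_neg hu.symm)]
    simp
  · simp

lemma liftKer_mul (τ : Fin 2 ↪ T) (K K' : Ker (Fin 2)) :
    liftKer τ (K * K') = liftKer τ K * liftKer τ K' := by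
  refine Matrix.ext_of_mulVec_single fun i => ?_
  ext x
  rw [← Matrix.mulVec_mulVec]
  simp only [liftKer_mulVec, override_override, override_apply, Matrix.mul_apply, Finset.mul_sum,
    Finset.sum_mul]
  rw [Finset.sum_comm]
  simp only [mul_assoc]

end lift

/-- The gate that applies `A c` to the qubit `0` if the qubit `1` is in the state `c`. -/
def ctrlGate (A : Fin 2 → Matrix (Fin 2) (Fin 2) ℂ) : Operator (Fin 2) :=
  Matrix.of fun x y => if x 1 = y 1 then A (y 1) (x 0) (y 0) else 0

lemma ctrlGate_mem (A : Fin 2 → Matrix (Fin 2) (Fin 2) ℂ)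
    (hA : ∀ c, A c ∈ Matrix.unitaryGroup (Fin 2) ℂ) :
    ctrlGate A ∈ Matrix.unitaryGroup (Fin 2 → Fin 2) ℂ := by
  rw [Matrix.mem_unitaryGroup_iff]
  ext x y
  have h := congrFun (congrFun (Matrix.mem_unitaryGroup_iff.1 (hA (x 1))) (x 0)) (y 0)
  simp only [Matrix.mul_apply, Matrix.star_apply] at h ⊢
  have hxy : x = y ↔ x 0 = y 0 ∧ x 1 = y 1 := by
    rw [funext_iff, Fin.forall_fin_two]
  simp only [Matrix.one_apply, hxy] at h ⊢
  by_cases h1 : x 1 = y 1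
  · rw [← (finTwoArrowEquiv (Fin 2)).symm.sum_comp, Fintype.sum_prod_type]
    simp only [h1, and_true] at h ⊢
    rw [← h]
    refine Finset.sum_congr rfl fun a _ => ?_
    simp [ctrlGate, finTwoArrowEquiv, h1]
  · simp only [h1, and_false, if_false]
    refine Finset.sum_eq_zero fun z _ => ?_
    simp only [ctrlGate, Matrix.of_apply]
    by_cases h2 : x 1 = z 1
    · rw [if_neg fun h3 : y 1 = z 1 => h1 (h2.trans h3.symm), star_zero, mul_zero]
    · rw [if_neg h2, zero_mul]

lemma ctrlGate_mulVec (A : Fin 2 → Matrix (Fin 2) (Fin 2) ℂ) (j : Fin 3) (hj : 0 ≠ j)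
    (β : Ten (Fin 3)) (x : Fin 3 → Lab) :
    (liftKer (zeroPair j hj) (conjKer (ctrlGate A)) *ᵥ β) x =
      ∑ a : Lab, A (x j).1 (x 0).1 a.1 * star (A (x j).2 (x 0).2 a.2) *
        β (Function.update x 0 a) := by
  rw [liftKer_mulVec, ← (finTwoArrowEquiv Lab).symm.sum_comp, Fintype.sum_prod_type]
  refine Finset.sum_congr rfl fun a _ => ?_
  have h0 : zeroPair j hj 0 = 0 := rfl
  have h1 : zeroPair j hj 1 = j := rfl
  rw [Finset.sum_eq_single (x j)]
  · have : override (zeroPair j hj) ((finTwoArrowEquiv Lab).symm (a, x j)) x =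
        Function.update x 0 a := by
      funext v
      simp only [override, h0, h1, Function.update_apply, finTwoArrowEquiv_symm_apply,
        Matrix.cons_val_zero, Matrix.cons_val_one]
      split_ifs with h2 h3
      · rfl
      · rw [h3]
      · rfl
    rw [this]
    simp [conjKer, ctrlGate, h0, h1]
  · intro b _ hb
    have : ¬ ((x j).1 = b.1 ∧ (x j).2 = b.2) := fun h => hb (Prod.ext h.1.symm h.2.symm)
    simp only [conjKer, ctrlGate, Matrix.of_apply, h0, h1, finTwoArrowEquiv_symm_apply,
      Matrix.cons_val_zero, Matrix.cons_val_one]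
    split_ifs with h2 h3
    · exact absurd ⟨h2, h3⟩ this
    all_goals simp
  · simp

/-- The controlled NOT, controlled by the qubit `0`. -/
def cnot : Operator (Fin 2) := Matrix.of fun x y => if y = ![x 0, x 1 + x 0] then 1 else 0

lemma cnot_mem : cnot ∈ Matrix.unitaryGroup (Fin 2 → Fin 2) ℂ := by
  have hinj : ∀ x y : Fin 2 → Fin 2, ![x 0, x 1 + x 0] = ![y 0, y 1 + y 0] → x = y := by decide
  rw [Matrix.mem_unitaryGroup_iff]
  ext x y
  simp only [Matrix.mul_apply, Matrix.star_apply, cnot, Matrix.of_apply, ite_mul, one_mul,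
    zero_mul, Finset.sum_ite_eq', Finset.mem_univ, if_true, Matrix.one_apply]
  by_cases h : x = y
  · simp [h]
  · rw [if_neg h, if_neg fun h' => h (hinj x y h'), star_zero]

lemma cnot_mulVec (j : Fin 3) (hj : 0 ≠ j) (β : Ten (Fin 3)) (x : Fin 3 → Lab) :
    (liftKer (zeroPair j hj) (conjKer cnot) *ᵥ β) x = β (Function.update x j (x j + x 0)) := by
  rw [liftKer_mulVec, Finset.sum_eq_single ![x 0, x j + x 0]]
  · have h0 : zeroPair j hj 0 = 0 := rfl
    have h1 : zeroPair j hj 1 = j := rfl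
    have : override (zeroPair j hj) ![x 0, x j + x 0] x = Function.update x j (x j + x 0) := by
      funext v
      simp only [override, h0, h1, Function.update_apply, Matrix.cons_val_zero,
        Matrix.cons_val_one]
      split_ifs with h2 h3
      · exact absurd (h2.symm.trans h3) hj
      · rw [h2]
      · rfl
      · rfl
    rw [this]
    have e1 : (fun s => (![x 0, x j + x 0] s).1) = ![(x 0).1, (x j).1 + (x 0).1] := by
      funext s; fin_cases s <;> rfl
    have e2 : (fun s => (![x 0, x j + x 0] s).2) = ![(x 0).2, (x j).2 + (x 0).2] := by
      funext s; fin_cases s <;> rfl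
    simp [conjKer, cnot, e1, e2, h0, h1]
  · intro z _ hz
    simp only [conjKer, cnot, Matrix.of_apply]
    split_ifs with h2 h3
    · refine absurd ?_ hz
      funext s
      have e1 := congrFun h2 s
      have e2 := congrFun h3 s
      fin_cases s
      · exact Prod.ext e1 e2
      · exact Prod.ext e1 e2
    all_goals simp
  · simp

/-- The state in which the qubits `1` and `2` are classical and the qubit `0` depends on them. -/
def blockSt (M : Fin 2 → Fin 2 → Lab → ℂ) : Ten (Fin 3) := fun x =>
  if (x 1).1 = (x 1).2 ∧ (x 2).1 = (x 2).2 then M (x 1).1 (x 2).1 (x 0) else 0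

/-- A gate controlled by a classical qubit acts on the blocks separately. -/
lemma ctrlGate_one_blockSt (A : Fin 2 → Matrix (Fin 2) (Fin 2) ℂ) (M : Fin 2 → Fin 2 → Lab → ℂ) :
    liftKer (zeroPair 1 (by decide)) (conjKer (ctrlGate A)) *ᵥ blockSt M =
      blockSt fun c c' => conj1 (A c) *ᵥ M c c' := by
  ext x
  rw [ctrlGate_mulVec]
  simp only [blockSt]
  split_ifs with h
  · simp [Matrix.mulVec, dotProduct, conj1, h.1, h.2]
  · refine Finset.sum_eq_zero fun a _ => ?_
    rw [if_neg (by simpa using h), mul_zero]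

lemma ctrlGate_two_blockSt (A : Fin 2 → Matrix (Fin 2) (Fin 2) ℂ) (M : Fin 2 → Fin 2 → Lab → ℂ) :
    liftKer (zeroPair 2 (by decide)) (conjKer (ctrlGate A)) *ᵥ blockSt M =
      blockSt fun c c' => conj1 (A c') *ᵥ M c c' := by
  ext x
  rw [ctrlGate_mulVec]
  simp only [blockSt]
  split_ifs with h
  · simp [Matrix.mulVec, dotProduct, conj1, h.1, h.2]
  · refine Finset.sum_eq_zero fun a _ => ?_
    rw [if_neg (by simpa using h), mul_zero]

/-- The qubits other than the qubit `0`. -/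
def offZero : Fin 2 ≃ Off (oneEmb (0 : Fin 3)) :=
  Equiv.ofBijective (fun i => ⟨i.succ, by rintro ⟨_, h⟩; exact (Fin.succ_ne_zero i).symm h⟩) (by
    constructor
    · intro i j h
      exact Fin.succ_injective _ (congrArg Subtype.val h)
    · rintro ⟨v, hv⟩
      have hv0 : v ≠ 0 := fun h => hv ⟨(), h.symm⟩
      exact ⟨v.pred hv0, Subtype.ext (Fin.succ_pred v hv0)⟩)

lemma red1_zero (β : Ten (Fin 3)) (b : Lab) :
    red1 0 β b = ∑ p : Lab, ∑ q : Lab, trw p * trw q * β ![b, p, q] := by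
  rw [red1, red, ← ((offZero.arrowCongr (Equiv.refl Lab))).sum_comp,
    ← (finTwoArrowEquiv Lab).symm.sum_comp, Fintype.sum_prod_type]
  refine Finset.sum_congr rfl fun p _ => Finset.sum_congr rfl fun q _ => ?_
  rw [← offZero.prod_comp, Fin.prod_univ_two]
  have : ![b, p, q] = glue (oneEmb (0 : Fin 3)) (fun _ => b)
      ((offZero.arrowCongr (Equiv.refl Lab)) ((finTwoArrowEquiv Lab).symm (p, q))) := by
    refine eq_glue _ _ _ _ (fun _ => rfl) fun u => ?_
    obtain ⟨i, rfl⟩ := offZero.surjective u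
    fin_cases i <;> simp [Equiv.arrowCongr] <;> rfl
  rw [this]
  simp [Equiv.arrowCongr]

lemma red1_blockSt (M : Fin 2 → Fin 2 → Lab → ℂ) (b : Lab) :
    red1 0 (blockSt M) b = ∑ c, ∑ c', M c c' b := by
  simp [red1_zero, Fintype.sum_prod_type, trw, blockSt, Fin.sum_univ_two]

/-- The Hadamard matrix. -/
def hadamard : Matrix (Fin 2) (Fin 2) ℂ :=
  ((Real.sqrt 2 : ℝ) : ℂ)⁻¹ • !![1, 1; 1, -1]

lemma sqrt_two_inv_mul : ((Real.sqrt 2 : ℝ) : ℂ)⁻¹ * ((Real.sqrt 2 : ℝ) : ℂ)⁻¹ = 1 / 2 := by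
  rw [← mul_inv, ← Complex.ofReal_mul, Real.mul_self_sqrt (by norm_num)]
  norm_num

lemma hadamard_mul_self : hadamard * hadamard = 1 := by
  rw [hadamard, Matrix.smul_mul, Matrix.mul_smul, smul_smul, sqrt_two_inv_mul]
  ext i j
  fin_cases i <;> fin_cases j <;> norm_num [Matrix.mul_apply, Fin.sum_univ_two]

lemma hadamard_pauliZ_hadamard : hadamard * (pauliZ * hadamard) = pauliX := by
  rw [hadamard, Matrix.smul_mul, Matrix.mul_smul, Matrix.mul_smul, smul_smul, sqrt_two_inv_mul]
  ext i j
  fin_cases i <;> fin_cases j <;>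
    norm_num [Matrix.mul_apply, Fin.sum_univ_two, pauliZ, pauliX]

lemma hadamard_mem : hadamard ∈ Matrix.unitaryGroup (Fin 2) ℂ := by
  rw [Matrix.mem_unitaryGroup_iff]
  have : star hadamard = hadamard := by
    ext i j
    fin_cases i <;> fin_cases j <;> simp [hadamard, Matrix.star_apply]
  rw [this, hadamard_mul_self]

lemma conj1_mul (U U' : Matrix (Fin 2) (Fin 2) ℂ) : conj1 (U * U') = conj1 U * conj1 U' := by
  ext x y
  simp only [conj1, Matrix.of_apply, Matrix.mul_apply, Fintype.sum_prod_type, Fin.sum_univ_two,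
    star_add, star_mul']
  ring

lemma conj1_one : conj1 1 = 1 := by
  ext x y
  simp only [conj1, Matrix.of_apply, Matrix.one_apply, Prod.ext_iff]
  split_ifs <;> simp_all

/-- The controlled Hadamard gate. -/
def ctrlH : Operator (Fin 2) := ctrlGate fun c => if c = 0 then 1 else hadamard

/-- The controlled `Z` gate. -/
def ctrlZ : Operator (Fin 2) := ctrlGate fun c => if c = 0 then 1 else pauliZ

/-- The gates of the majority gadget put the majority of three classical bits into the
qubit `0`, because `H Z H = X`. -/
lemma red1_majority (b : ℝ) :
    red1 0 (liftKer (zeroPair 2 (by decide)) (conjKer ctrlH) *ᵥ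
      (liftKer (zeroPair 1 (by decide)) (conjKer ctrlZ) *ᵥ
        (liftKer (zeroPair 2 (by decide)) (conjKer ctrlH * conjKer cnot) *ᵥ
          (liftKer (zeroPair 1 (by decide)) (conjKer cnot) *ᵥ prodTen fun _ => diagState b)))) =
      diagState ((3 * b - b ^ 3) / 2) := by
  have h : liftKer (zeroPair 2 (by decide)) (conjKer cnot) *ᵥ
      (liftKer (zeroPair 1 (by decide)) (conjKer cnot) *ᵥ prodTen fun _ => diagState b) =
      blockSt fun c c' a => diagState b a * diagState b ((c, c) + a) *
        diagState b ((c', c') + a) := by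
    ext x
    rw [cnot_mulVec, cnot_mulVec]
    have hD : ∀ a : Lab, a.1 ≠ a.2 → diagState b a = 0 := by
      rintro ⟨i, j⟩ ha
      fin_cases i <;> fin_cases j <;> simp [diagState, Prod.ext_iff] at ha ⊢
    have hF : ∀ i j k l : Fin 2, i ≠ j → k = l → i + k ≠ j + l := by decide
    simp only [prodTen, Fin.prod_univ_three, blockSt]
    have e01 : (0 : Fin 3) ≠ 1 := by decide
    have e02 : (0 : Fin 3) ≠ 2 := by decide
    have e12 : (1 : Fin 3) ≠ 2 := by decide
    simp only [Function.update_self, Function.update_of_ne e01, Function.update_of_ne e02,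
      Function.update_of_ne e12, Function.update_of_ne e12.symm]
    by_cases h0 : (x 0).1 = (x 0).2
    · split_ifs with h
      · rw [show ((x 1).1, (x 1).1) = x 1 from Prod.ext rfl h.1,
          show ((x 2).1, (x 2).1) = x 2 from Prod.ext rfl h.2]
      · rw [not_and_or] at h
        rcases h with h | h
        · rw [hD (x 1 + x 0) (hF _ _ _ _ h h0)]; ring
        · rw [hD (x 2 + x 0) (hF _ _ _ _ h h0)]; ring
    · rw [hD (x 0) h0]
      simp
  rw [liftKer_mul, ← Matrix.mulVec_mulVec, h]
  simp only [ctrlH, ctrlZ]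
  rw [ctrlGate_two_blockSt, ctrlGate_one_blockSt, ctrlGate_two_blockSt]
  ext x
  rw [red1_blockSt]
  simp only [Matrix.mulVec_mulVec, ← conj1_mul, Fin.sum_univ_two, if_true, Fin.isValue,
    one_ne_zero, if_false, mul_one, one_mul, hadamard_mul_self, hadamard_pauliZ_hadamard,
    conj1_one, Matrix.one_mulVec, mul_assoc]
  obtain ⟨i, j⟩ := x
  fin_cases i <;> fin_cases j <;>
    simp [Matrix.mulVec, dotProduct, Fintype.sum_prod_type, conj1, pauliX, pauliZ, diagState,
      Prod.ext_iff] <;> ring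

/-! ### The effect of the noise on the gadget -/

section states

/-- Exchange rows and columns. -/
def flipLab {T : Type*} (x : T → Lab) : T → Lab := fun v => (x v).swap

lemma flipLab_flipLab {T : Type*} (x : T → Lab) : flipLab (flipLab x) = x := by
  funext v; simp [flipLab]

/-- The tensor of a Hermitian operator of trace one. -/
def IsState {T : Type*} [Fintype T] [DecidableEq T] (ψ : Ten T) : Prop :=
  (∀ x, ψ (flipLab x) = star (ψ x)) ∧ ∑ x, (∏ v, trw (x v)) * ψ x = 1

/-- A kernel that preserves Hermitian operators. -/
def HermPres (k : Matrix Lab Lab ℂ) : Prop := ∀ x y, k x.swap y.swap = star (k x y)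

lemma IsChannel.hermPres {Φ : QubitMap} (h : IsChannel Φ) : HermPres (qker Φ) := by
  obtain ⟨r, K, -, hΦ⟩ := h
  intro x y
  have : (Matrix.single y.swap.1 y.swap.2 (1 : ℂ)) =
      (Matrix.single y.1 y.2 (1 : ℂ)).conjTranspose := by
    rw [Matrix.conjTranspose_single]; simp
  simp only [qker, Matrix.of_apply, hΦ, this]
  have h2 : ∀ i, K i * (Matrix.single y.1 y.2 (1 : ℂ)).conjTranspose * (K i).conjTranspose =
      (K i * Matrix.single y.1 y.2 (1 : ℂ) * (K i).conjTranspose).conjTranspose := fun i => by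
    simp [Matrix.conjTranspose_mul, Matrix.mul_assoc]
  simp only [h2, Matrix.sum_apply, Matrix.conjTranspose_apply, star_sum]
  rfl

lemma HermPres.pow {k : Matrix Lab Lab ℂ} (h : HermPres k) (t : ℕ) : HermPres (k ^ t) := by
  induction t with
  | zero =>
    intro x y
    simp only [pow_zero, Matrix.one_apply, Prod.swap_inj]
    split_ifs <;> simp
  | succ t ih =>
    intro x y
    rw [pow_succ, Matrix.mul_apply, Matrix.mul_apply, star_sum,
      ← (Equiv.prodComm (Fin 2) (Fin 2)).sum_comp]
    refine Finset.sum_congr rfl fun z _ => ?_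
    rw [star_mul', ← ih, ← h]
    rfl

variable {T : Type} [Fintype T] [DecidableEq T]

/-- Reversal of all labels, as an equivalence. -/
def flipEquiv (T : Type) : (T → Lab) ≃ (T → Lab) :=
  ⟨flipLab, flipLab, flipLab_flipLab, flipLab_flipLab⟩

lemma IsState.siteKer {k : T → Matrix Lab Lab ℂ} (hT : ∀ v, TP (k v)) (hH : ∀ v, HermPres (k v))
    {ψ : Ten T} (hψ : IsState ψ) : IsState (NoisyCircuit.siteKer k *ᵥ ψ) := by
  constructor
  · intro x
    simp only [Matrix.mulVec, dotProduct, star_sum, star_mul']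
    rw [← (flipEquiv T).sum_comp]
    refine Finset.sum_congr rfl fun y _ => ?_
    rw [siteKer_apply, siteKer_apply, star_prod]
    change (∏ v, k v (x v).swap (y v).swap) * ψ (flipLab y) = _
    rw [hψ.1 y]
    congr 1
    exact Finset.prod_congr rfl fun v _ => hH v _ _
  · rw [← hψ.2]
    simp only [Matrix.mulVec, dotProduct, Finset.mul_sum]
    rw [Finset.sum_comm]
    refine Finset.sum_congr rfl fun y _ => ?_
    rw [← sum_prod_trw_mul k hT y, Finset.sum_mul]
    exact Finset.sum_congr rfl fun x _ => by ring

lemma sum_trw_conjKer (U : Matrix.unitaryGroup (T → Fin 2) ℂ) (w : T → Lab) :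
    ∑ z, (∏ s, trw (z s)) * conjKer (U : Operator T) z w = ∏ s, trw (w s) := by
  have h := congrFun (congrFun (Matrix.mem_unitaryGroup_iff'.1 U.2) fun s => (w s).2)
    fun s => (w s).1
  have htr : ∀ z : T → Lab, ∏ s, trw (z s) =
      if (fun s => (z s).1) = (fun s => (z s).2) then 1 else 0 := by
    intro z
    simp only [trw, Finset.prod_ite_zero, Finset.prod_const_one, funext_iff, Finset.mem_univ,
      true_implies]
  simp only [htr, conjKer, Matrix.of_apply]
  rw [← sum_pair fun y y' => (if y = y' then (1 : ℂ) else 0) *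
    ((U : Operator T) y (fun v => (w v).1) * star ((U : Operator T) y' fun v => (w v).2))]
  simp only [ite_mul, one_mul, zero_mul, Finset.sum_ite_eq, Finset.mem_univ, if_true]
  rw [Matrix.mul_apply, Matrix.one_apply] at h
  simp only [Matrix.star_apply] at h
  simp only [mul_comm ((U : Operator T) _ _), h]
  exact if_congr eq_comm rfl rfl

lemma IsState.liftKer_conjKer (τ : Fin 2 ↪ T) (U : Matrix.unitaryGroup (Fin 2 → Fin 2) ℂ)
    {ψ : Ten T} (hψ : IsState ψ) : IsState (liftKer τ (conjKer (U : Operator (Fin 2))) *ᵥ ψ) := by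
  constructor
  · intro x
    rw [liftKer_mulVec, liftKer_mulVec, star_sum, ← (flipEquiv (Fin 2)).sum_comp]
    refine Finset.sum_congr rfl fun z _ => ?_
    have h1 : override τ ((flipEquiv (Fin 2)) z) (flipLab x) = flipLab (override τ z x) := by
      funext v
      simp only [override, flipLab, flipEquiv, Equiv.coe_fn_mk]
      split_ifs <;> rfl
    rw [h1, hψ.1, star_mul']
    congr 1
    simp only [conjKer, Matrix.of_apply, star_mul', star_star]
    rw [mul_comm]
    rfl
  · rw [← hψ.2]
    simp only [Matrix.mulVec, dotProduct, Finset.mul_sum]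
    rw [Finset.sum_comm]
    refine Finset.sum_congr rfl fun y _ => ?_
    simp only [← mul_assoc, ← Finset.sum_mul]
    congr 1
    rw [sum_glue τ, prod_split τ, ← sum_trw_conjKer U, Finset.sum_mul]
    refine Finset.sum_congr rfl fun z _ => ?_
    rw [Finset.sum_eq_single fun o : Off τ => y o.1]
    · simp only [liftKer, Matrix.of_apply, prod_split τ (fun v => trw (glue τ z _ v)), glue_apply,
        glue_off, if_true, Finset.prod_const_one, mul_one]
      ring
    · intro o _ ho
      obtain ⟨u, hu⟩ := Function.ne_iff.1 ho
      simp only [liftKer, Matrix.of_apply, glue_apply, glue_off]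
      rw [Finset.prod_eq_zero (s := Finset.univ) (f := fun v : Off τ => if o v = y v.1 then (1 : ℂ) else 0)
        (Finset.mem_univ u) (if_neg hu)]
      simp
    · simp

lemma IsState.prodTen {α : Lab → ℂ} (h : ∀ x, α x.swap = star (α x)) (h' : ∑ x, trw x * α x = 1) :
    IsState (NoisyCircuit.prodTen fun _ : T => α) := by
  constructor
  · intro x
    simp only [NoisyCircuit.prodTen, star_prod]
    exact Finset.prod_congr rfl fun v _ => h _
  · simp only [NoisyCircuit.prodTen, ← Finset.prod_mul_distrib]
    rw [← prod_sum_choice (fun (_ : T) (b : Lab) => trw b * α b)]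
    simp [h']

lemma diagState_swap (b : ℝ) (x : Lab) : diagState b x.swap = star (diagState b x) := by
  obtain ⟨i, j⟩ := x
  fin_cases i <;> fin_cases j <;> simp [diagState, Prod.ext_iff]

lemma IsState.red1_zero {β : Ten (Fin 3)} (hβ : IsState β) :
    (∀ x : Lab, red1 0 β x.swap = star (red1 0 β x)) ∧ ∑ x, trw x * red1 0 β x = 1 := by
  constructor
  · intro x
    rw [NoisyCircuit.red1_zero, NoisyCircuit.red1_zero, star_sum,
      ← (Equiv.prodComm (Fin 2) (Fin 2)).sum_comp]
    refine Finset.sum_congr rfl fun p _ => ?_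
    rw [star_sum, ← (Equiv.prodComm (Fin 2) (Fin 2)).sum_comp]
    refine Finset.sum_congr rfl fun q _ => ?_
    have h := hβ.1 ![x, p, q]
    have h1 : flipLab ![x, p, q] = ![x.swap, p.swap, q.swap] := by
      funext v; fin_cases v <;> rfl
    have h2 : ∀ p : Lab, trw p.swap = star (trw p) := by
      intro p; simp only [trw, Prod.fst_swap, Prod.snd_swap, eq_comm]; split_ifs <;> simp
    rw [star_mul', star_mul', ← h, h1, ← h2, ← h2]
    rfl
  · rw [← hβ.2]
    let e : (Fin 3 → Lab) ≃ Lab × Lab × Lab :=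
      ⟨fun x => (x 0, x 1, x 2), fun p => ![p.1, p.2.1, p.2.2], fun x => by
        funext v; fin_cases v <;> rfl, fun p => rfl⟩
    have hsum : ∀ F : (Fin 3 → Lab) → ℂ, ∑ x, F x = ∑ x : Lab, ∑ p : Lab, ∑ q : Lab,
        F ![x, p, q] := by
      intro F
      rw [← e.symm.sum_comp]
      rw [Fintype.sum_prod_type]
      refine Finset.sum_congr rfl fun x _ => ?_
      rw [Fintype.sum_prod_type]
      rfl
    rw [hsum]
    refine Finset.sum_congr rfl fun x _ => ?_
    rw [NoisyCircuit.red1_zero, Finset.mul_sum]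
    refine Finset.sum_congr rfl fun p _ => ?_
    rw [Finset.mul_sum]
    refine Finset.sum_congr rfl fun q _ => ?_
    simp [Fin.prod_univ_three]
    ring

/-- The dephasing turns a state into a diagonal one. -/
lemma dephKer_eq_diagState {α : Lab → ℂ} (h : ∀ x, α x.swap = star (α x))
    (h' : ∑ x, trw x * α x = 1) (b : ℝ) :
    ∃ b' : ℝ, dephKer *ᵥ α = diagState b' ∧
      b - (‖α (0, 0) - diagState b (0, 0)‖ + ‖α (1, 1) - diagState b (1, 1)‖) ≤ b' := by
  have h0 : ((α (0, 0)).re : ℂ) = α (0, 0) := Complex.conj_eq_iff_re.1 (h (0, 0)).symm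
  have h1 : ((α (1, 1)).re : ℂ) = α (1, 1) := Complex.conj_eq_iff_re.1 (h (1, 1)).symm
  have htr : α (0, 0) + α (1, 1) = 1 := by
    rw [← h']; simp [Fintype.sum_prod_type, trw]
  refine ⟨(α (0, 0)).re - (α (1, 1)).re, ?_, ?_⟩
  · ext x
    rw [dephKer_mulVec]
    obtain ⟨i, j⟩ := x
    fin_cases i <;> fin_cases j <;> simp [diagState, Prod.ext_iff, h0, h1]
    · linear_combination (1 / 2 : ℂ) * htr
    · linear_combination (1 / 2 : ℂ) * htr
  · have e0 : diagState b (0, 0) = (((1 + b) / 2 : ℝ) : ℂ) := by simp [diagState, Prod.ext_iff]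
    have e1 : diagState b (1, 1) = (((1 - b) / 2 : ℝ) : ℂ) := by simp [diagState, Prod.ext_iff]
    rw [e0, e1, ← h0, ← h1, ← Complex.ofReal_sub, ← Complex.ofReal_sub, Complex.norm_real,
      Complex.norm_real, Real.norm_eq_abs, Real.norm_eq_abs]
    simp only [Complex.ofReal_re]
    have h2 := neg_abs_le ((α (0, 0)).re - (1 + b) / 2)
    have h3 := le_abs_self ((α (1, 1)).re - (1 - b) / 2)
    linarith

/-- Random bit flips decrease the polarization to any smaller value. -/
lemma exists_flipKer (b b' : ℝ) (h0 : 0 ≤ b') (h : b' ≤ b) :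
    ∃ r : ℝ, 0 ≤ r ∧ r ≤ 1 ∧ flipKer r *ᵥ diagState b = diagState b' := by
  rcases eq_or_lt_of_le (h0.trans h) with hb | hb
  · refine ⟨0, le_rfl, zero_le_one, ?_⟩
    rw [flipKer_diagState]
    congr 1
    linarith
  · have h1 : b' / b ≤ 1 := by rwa [div_le_one hb]
    have h2 : 0 ≤ b' / b := div_nonneg h0 hb.le
    refine ⟨(1 - b' / b) / 2, by linarith, by linarith, ?_⟩
    rw [flipKer_diagState]
    congr 1
    field_simp
    ring

end states

/-! ### Error bounds -/

open scoped Matrix.Norms.Operator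

section norms

variable {n : Type*} [Fintype n] [DecidableEq n]

lemma norm_entry_le (A : Matrix n n ℂ) (i j : n) : ‖A i j‖ ≤ ‖A‖ := by
  have h := Matrix.linfty_opNorm_mulVec A (Pi.single j 1)
  rw [Pi.norm_single, norm_one, mul_one, Matrix.mulVec_single_one] at h
  exact (norm_le_pi_norm (A.col j) i).trans h

lemma norm_le_of_entry_le (A : Matrix n n ℂ) {c : ℝ} (hc : 0 ≤ c) (h : ∀ i j, ‖A i j‖ ≤ c) :
    ‖A‖ ≤ Fintype.card n * c := by
  rw [Matrix.linfty_opNorm_def]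
  have : (Finset.univ.sup fun i => ∑ j, ‖A i j‖₊) ≤ (⟨Fintype.card n * c, by positivity⟩ : NNReal) := by
    refine Finset.sup_le fun i _ => NNReal.coe_le_coe.1 ?_
    have h1 : ∑ j, ‖A i j‖ ≤ Fintype.card n * c :=
      (Finset.sum_le_card_nsmul _ _ c fun j _ => h i j).trans (by simp)
    rw [NNReal.coe_sum]
    exact h1
  exact this

lemma norm_pow_sub_one_le {R : Type*} [NormedRing R] [NormOneClass R] (a : R) (t : ℕ) :
    ‖a ^ t - 1‖ ≤ (1 + ‖a - 1‖) ^ t - 1 := by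
  induction t with
  | zero => simp
  | succ t ih =>
    have h1 : a ^ (t + 1) - 1 = a ^ t - 1 + (a - 1) + (a ^ t - 1) * (a - 1) := by
      rw [pow_succ]; noncomm_ring
    rw [h1]
    refine (norm_add₃_le).trans ?_
    have h2 := norm_mul_le (a ^ t - 1) (a - 1)
    have h3 := mul_le_mul_of_nonneg_right ih (norm_nonneg (a - 1))
    rw [pow_succ]
    nlinarith

lemma norm_pow_sub_one_le_two_mul {R : Type*} [NormedRing R] [NormOneClass R] (a : R) (t : ℕ) {ε : ℝ}
    (ha : ‖a - 1‖ ≤ ε) (ht : ε * t ≤ 1) : ‖a ^ t - 1‖ ≤ 2 * (ε * t) := by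
  have hε : 0 ≤ ε := (norm_nonneg _).trans ha
  have h0 : 0 ≤ ε * t := by positivity
  have h1 : (1 + ‖a - 1‖) ^ t ≤ Real.exp (ε * t) := by
    rw [mul_comm, Real.exp_nat_mul]
    refine pow_le_pow_left₀ (by positivity) ?_ t
    have := Real.add_one_le_exp ε
    linarith
  have h2 := Real.abs_exp_sub_one_sub_id_le (x := ε * t) (by rwa [abs_of_nonneg h0])
  have h3 := le_abs_self (Real.exp (ε * t) - 1 - ε * t)
  have h4 := norm_pow_sub_one_le a t
  nlinarith

lemma norm_prod_three_sub_le (a b : Fin 3 → ℂ) {δ : ℝ} (ha : ∀ i, ‖a i‖ ≤ 3) (hb : ∀ i, ‖b i‖ ≤ 1)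
    (h : ∀ i, ‖a i - b i‖ ≤ δ) : ‖∏ i, a i - ∏ i, b i‖ ≤ 13 * δ := by
  rw [Fin.prod_univ_three, Fin.prod_univ_three]
  have e : a 0 * a 1 * a 2 - b 0 * b 1 * b 2 = (a 0 - b 0) * a 1 * a 2 +
      b 0 * (a 1 - b 1) * a 2 + b 0 * b 1 * (a 2 - b 2) := by ring
  rw [e]
  refine (norm_add₃_le).trans ?_
  simp only [norm_mul]
  have hδ : 0 ≤ δ := (norm_nonneg _).trans (h 0)
  have h1 : ‖a 0 - b 0‖ * ‖a 1‖ * ‖a 2‖ ≤ δ * 3 * 3 := by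
    gcongr
    exacts [h 0, ha 1, ha 2]
  have h2 : ‖b 0‖ * ‖a 1 - b 1‖ * ‖a 2‖ ≤ 1 * δ * 3 := by
    gcongr
    exacts [hb 0, h 1, ha 2]
  have h3 : ‖b 0‖ * ‖b 1‖ * ‖a 2 - b 2‖ ≤ 1 * 1 * δ := by
    gcongr
    exacts [hb 0, hb 1, h 2]
  linarith

lemma norm_prodTen_sub_le (α β : Lab → ℂ) {δ : ℝ} (hα : ‖α‖ ≤ 3) (hβ : ‖β‖ ≤ 1)
    (h : ‖α - β‖ ≤ δ) :
    ‖prodTen (fun _ : Fin 3 => α) - prodTen fun _ : Fin 3 => β‖ ≤ 13 * δ := by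
  have hδ : 0 ≤ δ := (norm_nonneg _).trans h
  refine (pi_norm_le_iff_of_nonneg (by positivity)).2 fun x => ?_
  exact norm_prod_three_sub_le _ _ (fun i => (norm_le_pi_norm α _).trans hα)
    (fun i => (norm_le_pi_norm β _).trans hβ) fun i => (norm_le_pi_norm (α - β) _).trans h

lemma norm_siteKer_sub_one_le (k : Matrix Lab Lab ℂ) {δ : ℝ} (h : ‖k - 1‖ ≤ δ) (hδ : δ ≤ 2) :
    ‖siteKer (fun _ : Fin 3 => k) - 1‖ ≤ 832 * δ := by
  have hδ0 : 0 ≤ δ := (norm_nonneg _).trans h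
  have hk : ‖k‖ ≤ 3 := by
    have h1 := norm_add_le (k - 1) 1
    rw [sub_add_cancel, norm_one] at h1
    linarith
  have hc : Fintype.card (Fin 3 → Lab) = 64 := by simp
  refine (norm_le_of_entry_le _ (c := 13 * δ) (by positivity) fun x y => ?_).trans ?_
  · rw [← siteKer_one, Matrix.sub_apply, siteKer_apply, siteKer_apply]
    refine norm_prod_three_sub_le _ _ (fun i => (norm_entry_le k _ _).trans hk)
      (fun i => (norm_entry_le 1 _ _).trans norm_one.le) fun i => ?_
    rw [← Matrix.sub_apply]
    exact (norm_entry_le _ _ _).trans h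
  · rw [hc]; push_cast; linarith

end norms

lemma norm_trw_le (b : Lab) : ‖trw b‖ ≤ 1 := by
  rw [trw]; split_ifs <;> simp

lemma norm_red1_sub_le (ψ β : Ten (Fin 3)) (b : Lab) :
    ‖red1 0 ψ b - red1 0 β b‖ ≤ 16 * ‖ψ - β‖ := by
  rw [red1_zero, red1_zero, ← Finset.sum_sub_distrib]
  simp only [← Finset.sum_sub_distrib]
  have h : ∀ p q : Lab, ‖trw p * trw q * ψ ![b, p, q] - trw p * trw q * β ![b, p, q]‖ ≤
      ‖ψ - β‖ := by
    intro p q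
    rw [← mul_sub, norm_mul, norm_mul]
    have h1 := norm_le_pi_norm (ψ - β) ![b, p, q]
    have h2 : ‖trw p‖ * ‖trw q‖ ≤ 1 := mul_le_one₀ (norm_trw_le p) (norm_nonneg _) (norm_trw_le q)
    calc _ ≤ 1 * ‖(ψ - β) ![b, p, q]‖ := mul_le_mul_of_nonneg_right h2 (norm_nonneg _)
      _ ≤ _ := by rw [one_mul]; exact h1
  calc _ ≤ ∑ p : Lab, ∑ q : Lab, ‖ψ - β‖ :=
        norm_sum_le_of_le _ fun p _ => norm_sum_le_of_le _ fun q _ => h p q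
    _ = _ := by simp; ring

lemma diagState_zero_apply (b : Lab) : diagState 0 b = trw b / 2 := by
  obtain ⟨i, j⟩ := b
  fin_cases i <;> fin_cases j <;> simp [diagState, trw, Prod.ext_iff]

lemma sum_conjKer_trw {S : Type} [Fintype S] [DecidableEq S]
    (U : Matrix.unitaryGroup (S → Fin 2) ℂ) (w : S → Lab) :
    ∑ z, conjKer (U : Operator S) w z * (∏ s, trw (z s)) = ∏ s, trw (w s) := by
  have h := congrFun (congrFun (Matrix.mem_unitaryGroup_iff.1 U.2) fun s => (w s).1)
    fun s => (w s).2
  have htr : ∀ z : S → Lab, ∏ s, trw (z s) =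
      if (fun s => (z s).1) = (fun s => (z s).2) then 1 else 0 := by
    intro z
    simp only [trw, Finset.prod_ite_zero, Finset.prod_const_one, funext_iff, Finset.mem_univ,
      true_implies]
  simp only [htr, conjKer, Matrix.of_apply]
  rw [← sum_pair fun y y' => ((U : Operator S) (fun v => (w v).1) y *
    star ((U : Operator S) (fun v => (w v).2) y')) * (if y = y' then (1 : ℂ) else 0)]
  simp only [mul_ite, mul_one, mul_zero, Finset.sum_ite_eq, Finset.mem_univ, if_true]
  rw [Matrix.mul_apply, Matrix.one_apply] at h
  simpa only [Matrix.star_apply] using h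

/-- Gates leave the completely mixed state invariant. -/
lemma liftKer_conjKer_mixed {T : Type} [Fintype T] [DecidableEq T]
    (U : Matrix.unitaryGroup (Fin 2 → Fin 2) ℂ) (τ : Fin 2 ↪ T) :
    liftKer τ (conjKer (U : Operator (Fin 2))) *ᵥ (prodTen fun _ => diagState 0) =
      prodTen fun _ => diagState 0 := by
  ext x
  rw [liftKer_mulVec]
  simp only [prodTen, prod_split τ, override_apply, override_off]
  simp only [← mul_assoc, ← Finset.sum_mul]
  congr 1
  simp only [diagState_zero_apply, Finset.prod_div_distrib, ← mul_div_assoc, ← Finset.sum_div]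
  rw [sum_conjKer_trw]

/-- The channel, its fixed point, and bounds on its deviation from the identity and on the
polarization of the fixed point. Tensors carry the supremum norm, and kernels the corresponding
operator norm. -/
structure NoiseBound (N : QubitMap) (σ : Lab → ℂ) (ε η : ℝ) : Prop where
  tp : TP (qker N)
  hermPres : HermPres (qker N)
  fixed : qker N *ᵥ σ = σ
  norm_sub_one_le : ‖qker N - 1‖ ≤ ε
  norm_fixed_le : ‖σ - diagState 0‖ ≤ η
  le_one : η ≤ 1

lemma diagState_eq_ofReal (b : ℝ) (x : Lab) : diagState b x =
    ((if x = 0 then (1 + b) / 2 else if x = 1 then (1 - b) / 2 else 0 : ℝ) : ℂ) := by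
  rw [diagState]
  split_ifs <;> push_cast <;> rfl

lemma norm_diagState_sub (b : ℝ) (h0 : 0 ≤ b) : ‖diagState b - diagState 0‖ ≤ b := by
  refine (pi_norm_le_iff_of_nonneg h0).2 fun x => ?_
  rw [Pi.sub_apply, diagState_eq_ofReal, diagState_eq_ofReal, ← Complex.ofReal_sub,
    Complex.norm_real, Real.norm_eq_abs, abs_le]
  split_ifs <;> constructor <;> linarith

lemma norm_diagState_le (b : ℝ) (h0 : 0 ≤ b) (h1 : b ≤ 1) : ‖diagState b‖ ≤ 1 := by
  refine (pi_norm_le_iff_of_nonneg zero_le_one).2 fun x => ?_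
  rw [diagState_eq_ofReal, Complex.norm_real, Real.norm_eq_abs, abs_le]
  split_ifs <;> constructor <;> linarith

namespace NoiseBound

variable {N : QubitMap} {σ : Lab → ℂ} {ε η : ℝ}

lemma norm_noise_sub_one_le (h : NoiseBound N σ ε η) (t : ℕ) (ht : ε * t ≤ 1) :
    ‖noiseKer (Fin 3) N ^ t - 1‖ ≤ 1664 * (ε * t) := by
  have h1 := norm_pow_sub_one_le_two_mul (qker N) t h.norm_sub_one_le ht
  have h2 := norm_siteKer_sub_one_le _ h1 (by linarith)
  rw [noiseKer, siteKer_pow]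
  linarith

/-- The noise changes a state by an amount proportional to its distance from the fixed point. -/
lemma norm_noise_mulVec_sub_le (h : NoiseBound N σ ε η) (t : ℕ) (ht : ε * t ≤ 1)
    (β : Ten (Fin 3)) : ‖noiseKer (Fin 3) N ^ t *ᵥ β - β‖ ≤
      1664 * (ε * t) * (‖β - prodTen fun _ => diagState 0‖ + 13 * η) := by
  have hσ : noiseKer (Fin 3) N ^ t *ᵥ prodTen (fun _ => σ) = prodTen fun _ => σ := by
    have : ∀ t : ℕ, qker N ^ t *ᵥ σ = σ := by
      intro t
      induction t with
      | zero => simp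
      | succ t ih => rw [pow_succ, ← Matrix.mulVec_mulVec, h.fixed, ih]
    rw [noiseKer, siteKer_pow, siteKer_mulVec_prodTen, this]
  have e : noiseKer (Fin 3) N ^ t *ᵥ β - β =
      (noiseKer (Fin 3) N ^ t - 1) *ᵥ (β - prodTen fun _ => σ) := by
    rw [Matrix.sub_mulVec, Matrix.mulVec_sub, Matrix.mulVec_sub, hσ, Matrix.one_mulVec,
      Matrix.one_mulVec]
    abel
  rw [e]
  refine (Matrix.linfty_opNorm_mulVec _ _).trans ?_
  have hd := norm_diagState_le 0 le_rfl zero_le_one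
  have h0 : ‖σ‖ ≤ 3 := by
    have h1 := norm_add_le (σ - diagState 0) (diagState 0)
    rw [sub_add_cancel] at h1
    have := h.norm_fixed_le
    have := h.le_one
    linarith
  have h1 := norm_prodTen_sub_le σ (diagState 0) h0 hd h.norm_fixed_le
  have h2 : ‖β - prodTen fun _ => σ‖ ≤ ‖β - prodTen fun _ => diagState 0‖ + 13 * η := by
    rw [norm_sub_rev] at h1
    exact (norm_sub_le_norm_sub_add_norm_sub _ _ _).trans (add_le_add le_rfl h1)
  exact mul_le_mul (h.norm_noise_sub_one_le t ht) h2 (norm_nonneg _)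
    ((norm_nonneg _).trans (h.norm_noise_sub_one_le t ht))

end NoiseBound

namespace NoiseBound

variable {N : QubitMap} {σ : Lab → ℂ} {ε η : ℝ}

/-- The propagation of errors through one noisy gate: bounds on the distance of the actual state `ψ`
from the ideal one `β`, and of `β` from the completely mixed state. -/
lemma step (h : NoiseBound N σ ε η) {G : Ker (Fin 3)} {M : ℝ} (hG : ‖G‖ ≤ M)
    (hG1 : G *ᵥ (prodTen fun _ => diagState 0) = prodTen fun _ => diagState 0)
    {t t₀ : ℕ} (htt : t ≤ t₀) (ht : ε * t₀ ≤ 1) {ψ β : Ten (Fin 3)} {b c : ℝ} (hc : 1 ≤ c)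
    (hb : 0 ≤ b) (hη : 0 ≤ η)
    (hψ : ‖ψ - β‖ ≤ c * (21632 * (ε * t₀) * (b + η)))
    (hβ : ‖β - prodTen fun _ => diagState 0‖ ≤ c * (13 * b)) :
    ‖(G * noiseKer (Fin 3) N ^ t) *ᵥ ψ - G *ᵥ β‖ ≤
        1666 * M * c * (21632 * (ε * t₀) * (b + η)) ∧
      ‖G *ᵥ β - prodTen fun _ => diagState 0‖ ≤ 1666 * M * c * (13 * b) := by
  have hε : 0 ≤ ε := (norm_nonneg _).trans h.norm_sub_one_le
  have hM : 0 ≤ M := (norm_nonneg _).trans hG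
  have ht0 : ε * t ≤ ε * t₀ := mul_le_mul_of_nonneg_left (by exact_mod_cast htt) hε
  have ht1 : ε * t ≤ 1 := ht0.trans ht
  have htn : 0 ≤ ε * t := by positivity
  set E := noiseKer (Fin 3) N ^ t
  have hE : ‖E‖ ≤ 1665 := by
    have h1 := norm_add_le (E - 1) 1
    rw [sub_add_cancel, norm_one] at h1
    have := h.norm_noise_sub_one_le t ht1
    linarith
  constructor
  · have e : (G * E) *ᵥ ψ - G *ᵥ β = G *ᵥ (E *ᵥ (ψ - β) + (E *ᵥ β - β)) := by
      rw [← Matrix.mulVec_mulVec, Matrix.mulVec_sub, sub_add_sub_cancel, Matrix.mulVec_sub]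
    rw [e]
    refine (Matrix.linfty_opNorm_mulVec _ _).trans ?_
    have h1 := norm_add_le (E *ᵥ (ψ - β)) (E *ᵥ β - β)
    have h2 := (Matrix.linfty_opNorm_mulVec E (ψ - β)).trans
      (mul_le_mul hE hψ (norm_nonneg _) (by norm_num))
    have h3 := h.norm_noise_mulVec_sub_le t ht1 β
    have h4 : 1664 * (ε * t) * (‖β - prodTen fun _ => diagState 0‖ + 13 * η) ≤
        1664 * (ε * t₀) * (c * (13 * (b + η))) := by
      refine mul_le_mul (by linarith) ?_ (by positivity) (by linarith)
      nlinarith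
    have h5 : ‖E *ᵥ (ψ - β) + (E *ᵥ β - β)‖ ≤ 1666 * c * (21632 * (ε * t₀) * (b + η)) := by
      linarith
    calc ‖G‖ * ‖E *ᵥ (ψ - β) + (E *ᵥ β - β)‖ ≤ M * (1666 * c * (21632 * (ε * t₀) * (b + η))) :=
          mul_le_mul hG h5 (norm_nonneg _) hM
      _ = _ := by ring
  · have e : G *ᵥ β - prodTen (fun _ => diagState 0) =
        G *ᵥ (β - prodTen fun _ => diagState 0) := by
      rw [Matrix.mulVec_sub, hG1]
    rw [e]
    refine (Matrix.linfty_opNorm_mulVec _ _).trans ?_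
    calc ‖G‖ * ‖β - prodTen fun _ => diagState 0‖ ≤ M * (c * (13 * b)) :=
          mul_le_mul hG hβ (norm_nonneg _) hM
      _ ≤ _ := by
        have : 0 ≤ M * (c * (13 * b)) := by positivity
        linarith

/-- The propagation of errors through four noisy gates. -/
lemma four_steps (h : NoiseBound N σ ε η) {G₁ G₂ G₃ G₄ : Ker (Fin 3)} {M : ℝ} (hM : 1 ≤ M)
    (h₁ : ‖G₁‖ ≤ M) (h₂ : ‖G₂‖ ≤ M) (h₃ : ‖G₃‖ ≤ M) (h₄ : ‖G₄‖ ≤ M)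
    (h₁' : G₁ *ᵥ (prodTen fun _ => diagState 0) = prodTen fun _ => diagState 0)
    (h₂' : G₂ *ᵥ (prodTen fun _ => diagState 0) = prodTen fun _ => diagState 0)
    (h₃' : G₃ *ᵥ (prodTen fun _ => diagState 0) = prodTen fun _ => diagState 0)
    (h₄' : G₄ *ᵥ (prodTen fun _ => diagState 0) = prodTen fun _ => diagState 0)
    {s t t₀ : ℕ} (hs : s ≤ t₀) (ht : t ≤ t₀) (ht₀ : ε * t₀ ≤ 1) {b : ℝ} (hb0 : 0 ≤ b)
    (hb1 : b ≤ 1) :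
    ‖(G₄ * noiseKer (Fin 3) N ^ t) *ᵥ ((G₃ * noiseKer (Fin 3) N ^ t) *ᵥ
      ((G₂ * noiseKer (Fin 3) N ^ t) *ᵥ ((G₁ * noiseKer (Fin 3) N ^ s) *ᵥ
        prodTen fun _ => diagState b))) -
          G₄ *ᵥ (G₃ *ᵥ (G₂ *ᵥ (G₁ *ᵥ prodTen fun _ => diagState b)))‖ ≤
      (1666 * M) ^ 4 * (21632 * (ε * t₀) * (b + η)) := by
  have hη : 0 ≤ η := (norm_nonneg _).trans h.norm_fixed_le
  have hε : 0 ≤ ε := (norm_nonneg _).trans h.norm_sub_one_le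
  generalize hD : (prodTen fun _ : Fin 3 => diagState b) = D
  have s0 : ‖D - D‖ ≤ 1 * (21632 * (ε * t₀) * (b + η)) := by
    rw [sub_self, norm_zero]; positivity
  have s0' : ‖D - prodTen fun _ => diagState 0‖ ≤ 1 * (13 * b) := by
    rw [one_mul, ← hD]
    exact norm_prodTen_sub_le _ _ ((norm_diagState_le b hb0 hb1).trans (by norm_num))
      (norm_diagState_le 0 le_rfl zero_le_one) (norm_diagState_sub b hb0)
  have hL : ∀ c : ℝ, 1 ≤ c → 1 ≤ 1666 * M * c := fun c hc => by nlinarith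
  obtain ⟨s1, s1'⟩ := h.step h₁ h₁' hs ht₀ le_rfl hb0 hη s0 s0'
  obtain ⟨s2, s2'⟩ := h.step h₂ h₂' ht ht₀ (hL _ le_rfl) hb0 hη s1 s1'
  obtain ⟨s3, s3'⟩ := h.step h₃ h₃' ht ht₀ (hL _ (hL _ le_rfl)) hb0 hη s2 s2'
  obtain ⟨s4, -⟩ := h.step h₄ h₄' ht ht₀ (hL _ (hL _ (hL _ le_rfl))) hb0 hη s3 s3'
  refine s4.trans (le_of_eq ?_)
  ring

end NoiseBound

lemma ctrlH_mem : ctrlH ∈ Matrix.unitaryGroup (Fin 2 → Fin 2) ℂ :=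
  ctrlGate_mem _ fun c => by
    split_ifs
    exacts [one_mem _, hadamard_mem]

lemma ctrlZ_mem : ctrlZ ∈ Matrix.unitaryGroup (Fin 2 → Fin 2) ℂ :=
  ctrlGate_mem _ fun c => by
    split_ifs
    exacts [one_mem _, pauliZ_mem]

lemma liftKer_siteKer_zero (j : Fin 3) (hj : 0 ≠ j) (k : Matrix Lab Lab ℂ) :
    liftKer (zeroPair j hj) (siteKer fun s => if s = 0 then k else 1) =
      siteKer fun v => if v = 0 then k else 1 := by
  ext x y
  simp only [liftKer, Matrix.of_apply, siteKer_apply]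
  rw [prod_split (zeroPair j hj)]
  congr 1
  · refine Finset.prod_congr rfl fun s _ => ?_
    have : zeroPair j hj s = 0 ↔ s = 0 := by
      constructor
      · intro h
        exact (zeroPair j hj).injective h
      · rintro rfl; rfl
    simp only [this]
  · refine Finset.prod_congr rfl fun o _ => ?_
    have : o.1 ≠ 0 := fun h => o.2 ⟨0, h.symm⟩
    simp [this, Matrix.one_apply]

lemma red1_siteKer_zero (k : Matrix Lab Lab ℂ) (hk : TP k) (β : Ten (Fin 3)) :
    red1 0 ((siteKer fun v => if v = 0 then k else 1) *ᵥ β) = k *ᵥ red1 0 β := by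
  ext b
  simp only [red1]
  rw [red_siteKer _ _ fun v => by split_ifs; exacts [hk, TP_one]]
  simp only [Matrix.mulVec, dotProduct]
  rw [← (Equiv.funUnique Unit Lab).symm.sum_comp]
  refine Finset.sum_congr rfl fun y _ => ?_
  simp only [siteKer_apply, Finset.univ_unique, Finset.prod_singleton]
  rfl

lemma mixU_siteKer_zero (k : Matrix Lab Lab ℂ) (hk : MixU (oneKer k)) :
    MixU (siteKer fun s : Fin 2 => if s = 0 then k else 1) :=
  MixU.site fun s => by
    split_ifs
    · exact hk
    · rw [oneKer_one]; exact MixU.one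

/-- Three qubits of polarization `b` yield one of polarization `(3 * b - b ^ 3) / 2`, up to the effect
of the noise. This is proportional to `b + η`, since the states of the qubits are at the distance
`O(b)` from the completely mixed state and this one is at the distance `η` from the fixed point. -/
theorem exists_gadget : ∃ C : ℝ, 0 < C ∧ ∀ (N : QubitMap) (σ : Lab → ℂ) (ε η : ℝ),
    NoiseBound N σ ε η → ∀ t n l : ℕ, n + l ≤ t → 2 * n + 1 ≤ t → ε * t ≤ 1 →
    ∀ b b' : ℝ, 0 ≤ b → b ≤ 1 → 0 ≤ b' →
      b' ≤ (3 * b - b ^ 3) / 2 - C * (ε * t) * (b + η) →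
      Gadget N n l (diagState b) (diagState b') := by
  let z1 := zeroPair 1 (by decide)
  let z2 := zeroPair 2 (by decide)
  let uC : Matrix.unitaryGroup (Fin 2 → Fin 2) ℂ := ⟨cnot, cnot_mem⟩
  let uH : Matrix.unitaryGroup (Fin 2 → Fin 2) ℂ := ⟨ctrlH, ctrlH_mem⟩
  let uZ : Matrix.unitaryGroup (Fin 2 → Fin 2) ℂ := ⟨ctrlZ, ctrlZ_mem⟩
  obtain ⟨G₁, hG₁⟩ : ∃ G, G = liftKer z1 (conjKer (uC : Operator (Fin 2))) := ⟨_, rfl⟩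
  obtain ⟨G₂, hG₂⟩ : ∃ G, G = liftKer z2 (conjKer ((uH * uC :
    Matrix.unitaryGroup (Fin 2 → Fin 2) ℂ) : Operator (Fin 2))) := ⟨_, rfl⟩
  obtain ⟨G₃, hG₃⟩ : ∃ G, G = liftKer z1 (conjKer (uZ : Operator (Fin 2))) := ⟨_, rfl⟩
  obtain ⟨G₄, hG₄⟩ : ∃ G, G = liftKer z2 (conjKer (uH : Operator (Fin 2))) := ⟨_, rfl⟩
  have n1 := norm_nonneg G₁
  have n2 := norm_nonneg G₂
  have n3 := norm_nonneg G₃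
  have n4 := norm_nonneg G₄
  obtain ⟨M, hM⟩ : ∃ M, M = 1 + ‖G₁‖ + ‖G₂‖ + ‖G₃‖ + ‖G₄‖ := ⟨_, rfl⟩
  have hM1 : 1 ≤ M := by linarith
  refine ⟨32 * (1666 * M) ^ 4 * 21632, by positivity, ?_⟩
  intro N σ ε η h t n l hnl hn ht b b' hb0 hb1 hb' hbb
  have s4 := h.four_steps hM1 (by linarith) (by linarith) (by linarith) (by linarith)
    (hG₁ ▸ liftKer_conjKer_mixed uC z1) (hG₂ ▸ liftKer_conjKer_mixed (uH * uC) z2)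
    (hG₃ ▸ liftKer_conjKer_mixed uZ z1) (hG₄ ▸ liftKer_conjKer_mixed uH z2) hnl hn ht hb0 hb1
  have hideal : red1 0 (G₄ *ᵥ (G₃ *ᵥ (G₂ *ᵥ (G₁ *ᵥ prodTen fun _ => diagState b)))) =
      diagState ((3 * b - b ^ 3) / 2) := by
    rw [← red1_majority b, hG₁, hG₂, hG₃, hG₄, ← conjKer_mul]
    rfl
  obtain ⟨ψ, hψ⟩ : ∃ ψ : Ten (Fin 3), ψ = (G₄ * noiseKer (Fin 3) N ^ (2 * n + 1)) *ᵥ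
    ((G₃ * noiseKer (Fin 3) N ^ (2 * n + 1)) *ᵥ ((G₂ * noiseKer (Fin 3) N ^ (2 * n + 1)) *ᵥ
      ((G₁ * noiseKer (Fin 3) N ^ (n + l)) *ᵥ prodTen fun _ => diagState b))) := ⟨_, rfl⟩
  rw [← hψ] at s4
  have hnoise : ∀ (t : ℕ) (ψ : Ten (Fin 3)), IsState ψ → IsState (noiseKer (Fin 3) N ^ t *ᵥ ψ) := by
    intro t ψ hψ
    rw [noiseKer, siteKer_pow]
    exact hψ.siteKer (fun _ => h.tp.pow t) fun _ => h.hermPres.pow t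
  have hst : IsState ψ := by
    simp only [hψ, hG₁, hG₂, hG₃, hG₄, ← Matrix.mulVec_mulVec]
    exact (hnoise _ _ ((hnoise _ _ ((hnoise _ _ ((hnoise _ _ (IsState.prodTen (diagState_swap b)
      (trace_diagState b))).liftKer_conjKer z1 uC)).liftKer_conjKer z2 (uH * uC))).liftKer_conjKer
        z1 uZ)).liftKer_conjKer z2 uH
  obtain ⟨b'', hb'', hle⟩ := dephKer_eq_diagState hst.red1_zero.1 hst.red1_zero.2
    ((3 * b - b ^ 3) / 2)
  have hbb' : b' ≤ b'' := by
    refine le_trans ?_ hle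
    rw [← hideal]
    have e0 := norm_red1_sub_le ψ (G₄ *ᵥ (G₃ *ᵥ (G₂ *ᵥ (G₁ *ᵥ prodTen fun _ => diagState b)))) (0, 0)
    have e1 := norm_red1_sub_le ψ (G₄ *ᵥ (G₃ *ᵥ (G₂ *ᵥ (G₁ *ᵥ prodTen fun _ => diagState b)))) (1, 1)
    linarith
  obtain ⟨r, hr0, hr1, hr⟩ := exists_flipKer b'' b' hb' hbb'
  refine ⟨conjKer cnot, conjKer ((uH * uC : Matrix.unitaryGroup (Fin 2 → Fin 2) ℂ) :
    Operator (Fin 2)), conjKer ctrlZ,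
    (siteKer fun s => if s = 0 then flipKer r * dephKer else 1) * conjKer ctrlH,
    MixU.conj uC, MixU.conj _, MixU.conj uZ,
    (mixU_siteKer_zero _ ((mixU_flipKer hr0 hr1).oneKer_mul mixU_dephKer)).mul (MixU.conj uH), ?_⟩
  rw [← hr, ← hb'', Matrix.mulVec_mulVec, ← red1_siteKer_zero _ ((TP_flipKer r).mul TP_dephKer), hψ,
    hG₁, hG₂, hG₃, hG₄]
  simp only [gadgetStep, liftKer_mul, liftKer_siteKer_zero, ← Matrix.mulVec_mulVec]
  rfl

/-! ### Trace norm and diamond norm -/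

section fro

variable {n : Type*} [Fintype n] [DecidableEq n]

/-- The Frobenius norm. -/
def fro (M : Matrix n n ℂ) : ℝ := Real.sqrt (∑ p : n × n, ‖M p.1 p.2‖ ^ 2)

lemma fro_nonneg (M : Matrix n n ℂ) : 0 ≤ fro M := Real.sqrt_nonneg _

lemma fro_sq (M : Matrix n n ℂ) : fro M ^ 2 = ∑ p : n × n, ‖M p.1 p.2‖ ^ 2 :=
  Real.sq_sqrt (Finset.sum_nonneg fun _ _ => by positivity)

lemma fro_add_le (M M' : Matrix n n ℂ) : fro (M + M') ≤ fro M + fro M' := by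
  have h : ∀ M : Matrix n n ℂ, fro M =
      ‖(WithLp.toLp 2 fun p : n × n => M p.1 p.2 : EuclideanSpace ℂ (n × n))‖ := fun M => by
    rw [EuclideanSpace.norm_eq]; rfl
  rw [h, h, h]
  exact norm_add_le (WithLp.toLp 2 fun p : n × n => M p.1 p.2 : EuclideanSpace ℂ (n × n))
    (WithLp.toLp 2 fun p : n × n => M' p.1 p.2)

lemma norm_entry_le_fro (M : Matrix n n ℂ) (i j : n) : ‖M i j‖ ≤ fro M := by
  refine Real.le_sqrt_of_sq_le ?_
  exact Finset.single_le_sum (f := fun p : n × n => ‖M p.1 p.2‖ ^ 2) (fun _ _ => by positivity)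
    (Finset.mem_univ (i, j))

lemma fro_le_of_entry_le (M : Matrix n n ℂ) {e : ℝ} (he : 0 ≤ e) (h : ∀ i j, ‖M i j‖ ≤ e) :
    fro M ≤ Fintype.card n * e := by
  refine Real.sqrt_le_iff.2 ⟨by positivity, ?_⟩
  refine (Finset.sum_le_card_nsmul _ _ (e ^ 2) fun p _ => ?_).trans ?_
  · exact pow_le_pow_left₀ (norm_nonneg _) (h _ _) 2
  · rw [Finset.card_univ, Fintype.card_prod, nsmul_eq_mul]
    push_cast
    exact le_of_eq (by ring)

lemma fro_sq_eq_trace (M : Matrix n n ℂ) : ((fro M ^ 2 : ℝ) : ℂ) = (M.conjTranspose * M).trace := by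
  rw [fro_sq]
  simp only [Matrix.trace, Matrix.diag_apply, Matrix.mul_apply, Matrix.conjTranspose_apply]
  rw [Finset.sum_comm, Fintype.sum_prod_type]
  push_cast
  refine Finset.sum_congr rfl fun i _ => Finset.sum_congr rfl fun j _ => ?_
  rw [mul_comm]
  exact (Complex.mul_conj' _).symm

lemma fro_sq_eq_sum (M : Matrix n n ℂ) : fro M ^ 2 =
    ∑ i, (Matrix.isHermitian_conjTranspose_mul_self M).eigenvalues i := by
  have h := fro_sq_eq_trace M
  rw [(Matrix.isHermitian_conjTranspose_mul_self M).trace_eq_sum_eigenvalues] at h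
  apply Complex.ofReal_injective
  rw [h]
  push_cast
  rfl

lemma traceNorm_nonneg (M : Matrix n n ℂ) : 0 ≤ traceNorm M :=
  Finset.sum_nonneg fun _ _ => Real.sqrt_nonneg _

lemma fro_le_traceNorm (M : Matrix n n ℂ) : fro M ≤ traceNorm M := by
  have h0 : ∀ i, 0 ≤ (Matrix.isHermitian_conjTranspose_mul_self M).eigenvalues i :=
    (Matrix.posSemidef_conjTranspose_mul_self M).eigenvalues_nonneg
  have h1 : 0 ≤ traceNorm M := Finset.sum_nonneg fun i _ => Real.sqrt_nonneg _
  refine (pow_le_pow_iff_left₀ (fro_nonneg M) h1 two_ne_zero).1 ?_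
  rw [fro_sq_eq_sum, traceNorm]
  refine le_trans (le_of_eq ?_) (Finset.sum_sq_le_sq_sum_of_nonneg fun i _ => Real.sqrt_nonneg _)
  exact Finset.sum_congr rfl fun i _ => (Real.sq_sqrt (h0 i)).symm

lemma traceNorm_sq_le (M : Matrix n n ℂ) : traceNorm M ^ 2 ≤ Fintype.card n * fro M ^ 2 := by
  have h0 : ∀ i, 0 ≤ (Matrix.isHermitian_conjTranspose_mul_self M).eigenvalues i :=
    (Matrix.posSemidef_conjTranspose_mul_self M).eigenvalues_nonneg
  rw [fro_sq_eq_sum, traceNorm]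
  refine sq_sum_le_card_mul_sum_sq.trans (le_of_eq ?_)
  rw [Finset.card_univ]
  congr 1
  exact Finset.sum_congr rfl fun i _ => Real.sq_sqrt (h0 i)

end fro

lemma traceNorm_le_of_card_four (M : Matrix (Fin 2 × Fin 2) (Fin 2 × Fin 2) ℂ) :
    traceNorm M ≤ 2 * fro M := by
  have h0 := fro_nonneg M
  refine (pow_le_pow_iff_left₀ (traceNorm_nonneg M) (by positivity) two_ne_zero).1 ?_
  refine (traceNorm_sq_le M).trans (le_of_eq ?_)
  simp
  ring

lemma withReference_apply (Φ : QubitMap) (X : Matrix (Fin 2 × Fin 2) (Fin 2 × Fin 2) ℂ)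
    (a b : Fin 2 × Fin 2) : withReference Φ X a b =
      ∑ y : Lab, qker Φ (a.1, b.1) y * X (y.1, a.2) (y.2, b.2) :=
  (qker_mulVec Φ (Matrix.of fun i j => X (i, a.2) (j, b.2)) (a.1, b.1)).symm

lemma traceNorm_withReference_le (Φ : QubitMap) {e : ℝ} (h : ∀ x y, ‖qker Φ x y‖ ≤ e)
    (X : Matrix (Fin 2 × Fin 2) (Fin 2 × Fin 2) ℂ) (hX : traceNorm X ≤ 1) :
    traceNorm (withReference Φ X) ≤ 32 * e := by
  have he : 0 ≤ e := (norm_nonneg _).trans (h 0 0)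
  have h1 : ∀ a b, ‖withReference Φ X a b‖ ≤ 4 * e := by
    intro a b
    rw [withReference_apply]
    refine (norm_sum_le_of_le (n := fun _ => e) _ fun y _ => ?_).trans (by simp)
    rw [norm_mul]
    have h2 := (norm_entry_le_fro X (y.1, a.2) (y.2, b.2)).trans ((fro_le_traceNorm X).trans hX)
    have := mul_le_mul (h (a.1, b.1) y) h2 (norm_nonneg _) he
    linarith
  have h2 := fro_le_of_entry_le _ (by positivity) h1
  have h3 := traceNorm_le_of_card_four (withReference Φ X)
  simp only [Fintype.card_prod, Fintype.card_fin] at h2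
  push_cast at h2
  linarith

lemma diamondNorm_le (Φ : QubitMap) {e : ℝ} (h : ∀ x y, ‖qker Φ x y‖ ≤ e) :
    diamondNorm Φ ≤ 32 * e := by
  have he : 0 ≤ e := (norm_nonneg _).trans (h 0 0)
  refine Real.sSup_le ?_ (by positivity)
  rintro r ⟨X, hX, rfl⟩
  exact traceNorm_withReference_le Φ h X hX

/-- The diamond norm bounds the matrix elements, as the norms of the images of matrix units. -/
lemma norm_qker_le (Φ : QubitMap) (x y : Lab) : ‖qker Φ x y‖ ≤ 2 * diamondNorm Φ := by
  have hbdd : BddAbove {r : ℝ | ∃ X : Matrix (Fin 2 × Fin 2) (Fin 2 × Fin 2) ℂ,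
      traceNorm X ≤ 1 ∧ r = traceNorm (withReference Φ X)} := by
    refine ⟨32 * ‖qker Φ‖, ?_⟩
    rintro r ⟨X, hX, rfl⟩
    exact traceNorm_withReference_le Φ (norm_entry_le _) X hX
  let X : Matrix (Fin 2 × Fin 2) (Fin 2 × Fin 2) ℂ := Matrix.single (y.1, 0) (y.2, 0) (1 / 2)
  have hX : fro X = 1 / 2 := by
    rw [fro, Finset.sum_eq_single ((y.1, 0), (y.2, 0))]
    · simp only [X, Matrix.single_apply_same]
      norm_num
    · rintro ⟨a, b⟩ _ hab
      have : ¬ ((y.1, (0 : Fin 2)) = a ∧ (y.2, (0 : Fin 2)) = b) := fun h => hab (by rw [h.1, h.2])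
      simp [X, this]
    · simp
  have hX1 : traceNorm X ≤ 1 := by
    have := traceNorm_le_of_card_four X
    rw [hX] at this
    linarith
  have h1 : traceNorm (withReference Φ X) ≤ diamondNorm Φ := le_csSup hbdd ⟨X, hX1, rfl⟩
  have h2 := (norm_entry_le_fro (withReference Φ X) (x.1, 0) (x.2, 0)).trans (fro_le_traceNorm _)
  have h3 : withReference Φ X (x.1, 0) (x.2, 0) = qker Φ x y * (1 / 2) := by
    rw [withReference_apply, Finset.sum_eq_single y]
    · simp [X]
    · intro z _ hz
      have : ¬ (y.1 = z.1 ∧ y.2 = z.2) := fun h => hz (Prod.ext h.1.symm h.2.symm)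
      simp [X, this]
    · simp
  rw [h3, norm_mul] at h2
  norm_num at h2
  linarith

lemma qker_sub_id (Φ : QubitMap) : qker (Φ - LinearMap.id) = qker Φ - 1 := by
  rw [← qker_one]
  rfl

lemma strength_nonneg (N : QubitMap) : 0 ≤ strength N := by
  have := (norm_nonneg _).trans (norm_qker_le (N - LinearMap.id) 0 0)
  rw [strength]
  linarith

lemma norm_qker_sub_one_le (N : QubitMap) : ‖qker N - 1‖ ≤ 8 * strength N := by
  have h := norm_le_of_entry_le (qker N - 1) (c := 2 * strength N)
    (by have := strength_nonneg N; positivity) (by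
      rw [← qker_sub_id]; exact norm_qker_le _)
  simp only [Fintype.card_prod, Fintype.card_fin] at h
  push_cast at h
  linarith

lemma strength_le (N : QubitMap) : strength N ≤ 32 * ‖qker N - 1‖ := by
  refine diamondNorm_le _ fun x y => ?_
  rw [qker_sub_id]
  exact norm_entry_le _ _ _

lemma norm_flipKer_sub_one_le {r : ℝ} (h0 : 0 ≤ r) : ‖flipKer r - 1‖ ≤ 4 * r := by
  have h := norm_le_of_entry_le (flipKer r - 1) h0 (by
    rintro ⟨i, j⟩ ⟨k, l⟩
    have hr : ‖(r : ℂ)‖ = r := by rw [Complex.norm_real, Real.norm_of_nonneg h0]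
    have hr' : ‖(1 - r - 1 : ℂ)‖ = r := by rw [show (1 - r - 1 : ℂ) = -r by ring, norm_neg, hr]
    fin_cases i <;> fin_cases j <;> fin_cases k <;> fin_cases l <;>
      simp [flipKer, conj1, pauliX, Prod.ext_iff, h0, abs_of_nonneg h0])
  simp only [Fintype.card_prod, Fintype.card_fin] at h
  push_cast at h
  linarith

/-- The strength of the noise of the simulated circuit. -/
lemma strength_pow_mul_flipMap_le (N : QubitMap) (T : ℕ) {r : ℝ} (h0 : 0 ≤ r) (h1 : r ≤ 1) :
    strength (N ^ T * flipMap r) ≤ 160 * ‖qker N ^ T - 1‖ + 128 * r := by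
  refine (strength_le _).trans ?_
  rw [qker_mul, qker_pow, qker_flipMap]
  have e : qker N ^ T * flipKer r - 1 = (qker N ^ T - 1) * flipKer r + (flipKer r - 1) := by
    noncomm_ring
  rw [e]
  have h2 := norm_flipKer_sub_one_le h0
  have h3 : ‖flipKer r‖ ≤ 5 := by
    have := norm_add_le (flipKer r - 1) 1
    rw [sub_add_cancel, norm_one] at this
    linarith
  have h4 := norm_add_le ((qker N ^ T - 1) * flipKer r) (flipKer r - 1)
  have h5 := norm_mul_le (qker N ^ T - 1) (flipKer r)
  have h6 := mul_le_mul_of_nonneg_left h3 (norm_nonneg (qker N ^ T - 1))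
  linarith

/-! ### The polarization of idle qubits -/

/-- The completely mixed state of a qubit. -/
def mixed : Matrix (Fin 2) (Fin 2) ℂ := (1 / 2 : ℂ) • 1

lemma isDensity_mixed : IsDensity mixed := by
  constructor
  · refine Matrix.PosSemidef.one.smul ?_
    rw [show (1 / 2 : ℂ) = ((1 / 2 : ℝ) : ℂ) by norm_num]
    exact Complex.zero_le_real.2 (by norm_num)
  · simp [mixed, Matrix.trace_smul]

lemma IsChannel.isDensity {N : QubitMap} (hN : IsChannel N) {ρ : Matrix (Fin 2) (Fin 2) ℂ}
    (hρ : IsDensity ρ) : IsDensity (N ρ) := by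
  obtain ⟨r, K, hK, hΦ⟩ := hN
  constructor
  · rw [hΦ]
    exact Matrix.posSemidef_sum _ fun i _ => hρ.1.mul_mul_conjTranspose_same (K i)
  · rw [hΦ, Matrix.trace_sum, ← hρ.2]
    calc _ = ∑ i, ((K i).conjTranspose * K i * ρ).trace :=
          Finset.sum_congr rfl fun i _ => by rw [Matrix.trace_mul_comm, ← mul_assoc]
      _ = _ := by rw [← Matrix.trace_sum, ← Finset.sum_mul, hK, one_mul]

lemma IsChannel.isDensity_pow {N : QubitMap} (hN : IsChannel N) {ρ : Matrix (Fin 2) (Fin 2) ℂ}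
    (hρ : IsDensity ρ) (t : ℕ) : IsDensity ((N ^ t) ρ) := by
  induction t with
  | zero => exact hρ
  | succ t ih => rw [pow_succ']; exact hN.isDensity ih

/-- The trace distance to the fixed point decreases exponentially. -/
lemma IsContracting.traceNorm_pow_le {N : QubitMap} {Δ : ℝ} (hN : IsChannel N)
    (hc : IsContracting Δ N) (h1 : 0 ≤ 1 - Δ * strength N) {ρ σ : Matrix (Fin 2) (Fin 2) ℂ}
    (hρ : IsDensity ρ) (hσ : IsDensity σ) (t : ℕ) :
    traceNorm ((N ^ t) (ρ - σ)) ≤ (1 - Δ * strength N) ^ t * traceNorm (ρ - σ) := by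
  induction t with
  | zero => simp
  | succ t ih =>
    have e : (N ^ (t + 1)) (ρ - σ) = N ((N ^ t) ρ - (N ^ t) σ) := by
      rw [pow_succ', ← map_sub]; rfl
    rw [e]
    refine (hc _ _ (hN.isDensity_pow hρ t) (hN.isDensity_pow hσ t)).trans ?_
    rw [← map_sub, pow_succ', mul_assoc]
    exact mul_le_mul_of_nonneg_left ih h1

lemma eigenvalues_of_eq_smul_one {n : Type*} [Fintype n] [DecidableEq n] [Nonempty n]
    {A : Matrix n n ℂ} (hA : A.IsHermitian) {c : ℝ} (h : A = (c : ℂ) • 1) (i : n) :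
    hA.eigenvalues i = c := by
  have h1 := hA.eigenvalues_mem_spectrum_real i
  have h2 : A = algebraMap ℝ (Matrix n n ℂ) c := by
    rw [h, Algebra.algebraMap_eq_smul_one]
    ext i j
    simp [Matrix.one_apply]
  have h3 : spectrum ℝ A = {c} := by rw [h2, spectrum.scalar_eq]
  rw [h3] at h1
  exact h1

/-- The trace norm of a traceless Hermitian `2 × 2` matrix. -/
lemma traceNorm_of_traceless {M : Matrix (Fin 2) (Fin 2) ℂ} (hM : M.IsHermitian)
    (htr : M.trace = 0) : traceNorm M = Real.sqrt 2 * fro M := by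
  have h1 : M 1 1 = - M 0 0 := by
    rw [Matrix.trace_fin_two] at htr
    linear_combination htr
  have h2 : M 1 0 = star (M 0 1) := (hM.apply 1 0).symm
  have h3 : star (M 0 0) = M 0 0 := hM.apply 0 0
  have hn : ∀ z : ℂ, star z * z = ((‖z‖ ^ 2 : ℝ) : ℂ) := fun z => by
    push_cast; exact Complex.conj_mul' z
  have hn' : ∀ z : ℂ, z * star z = ((‖z‖ ^ 2 : ℝ) : ℂ) := fun z => by
    push_cast; exact Complex.mul_conj' z
  have h4 : M.conjTranspose * M = ((‖M 0 0‖ ^ 2 + ‖M 0 1‖ ^ 2 : ℝ) : ℂ) • 1 := by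
    rw [Complex.ofReal_add, ← hn, ← hn]
    ext i j
    fin_cases i <;> fin_cases j <;>
      simp only [Matrix.mul_apply, Fin.sum_univ_two, Matrix.conjTranspose_apply, h1, h2, Fin.isValue,
        Fin.zero_eta, Fin.mk_one, Matrix.smul_apply, Matrix.one_apply, star_star, star_neg, h3,
        smul_eq_mul] <;> simp <;> ring
  have h5 : traceNorm M = 2 * Real.sqrt (‖M 0 0‖ ^ 2 + ‖M 0 1‖ ^ 2) := by
    rw [traceNorm]
    simp only [eigenvalues_of_eq_smul_one (Matrix.isHermitian_conjTranspose_mul_self M) h4]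
    simp
  have h6 : fro M ^ 2 = 2 * (‖M 0 0‖ ^ 2 + ‖M 0 1‖ ^ 2) := by
    rw [fro_sq, Fintype.sum_prod_type]
    simp only [Fin.sum_univ_two, h1, h2, norm_neg, norm_star]
    ring
  refine (pow_left_inj₀ (traceNorm_nonneg M) (by have := fro_nonneg M; positivity) two_ne_zero).1 ?_
  rw [h5, mul_pow, mul_pow, h6, Real.sq_sqrt (by positivity), Real.sq_sqrt (by norm_num)]
  ring

lemma isHermitian_mixed : mixed.IsHermitian := isDensity_mixed.1.1

/-- The purity parameter is the distance to the completely mixed state. -/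
lemma purity_eq {ρ : Matrix (Fin 2) (Fin 2) ℂ} (hρ : ρ.IsHermitian) (htr : ρ.trace = 1) :
    purity ρ = Real.sqrt 2 * fro (ρ - mixed) := by
  have h : 2 * ((ρ * ρ).trace).re - 1 = 2 * fro (ρ - mixed) ^ 2 := by
    have h1 := fro_sq_eq_trace (ρ - mixed)
    rw [Matrix.IsHermitian.eq (hρ.sub isHermitian_mixed), mixed, sub_mul, mul_sub, mul_sub,
      Matrix.trace_sub, Matrix.trace_sub, Matrix.trace_sub] at h1
    simp only [Matrix.smul_mul, Matrix.mul_smul, one_mul, mul_one, Matrix.trace_smul, htr,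
      Matrix.trace_one, smul_smul] at h1
    have h2 := congrArg Complex.re h1
    rw [Complex.ofReal_re] at h2
    norm_num at h2
    rw [mixed, h2]
    ring
  rw [purity, h, Real.sqrt_mul (by norm_num), Real.sqrt_sq (fro_nonneg _)]

/-- A completely mixed qubit that idles for `t` steps acquires a polarization: its distance to the
fixed point decreases by the factor `(1 - u) ^ t ≤ 1 / (1 + u * t)`, where `u = Δ * κ`. -/
theorem le_purity_pow {N : QubitMap} {Δ : ℝ} (hN : IsChannel N) (hc : IsContracting Δ N)
    (h0 : 0 ≤ Δ * strength N) (h1 : Δ * strength N ≤ 1) {σ : Matrix (Fin 2) (Fin 2) ℂ}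
    (hσ : IsDensity σ) (hfix : N σ = σ) (t : ℕ) :
    purity σ * (Δ * strength N * t / (1 + Δ * strength N * t)) ≤ purity ((N ^ t) mixed) := by
  have hpow : ∀ t : ℕ, (N ^ t) σ = σ := by
    intro t
    induction t with
    | zero => rfl
    | succ t ih => rw [pow_succ]; change (N ^ t) (N σ) = σ; rw [hfix, ih]
  have hd := hN.isDensity_pow isDensity_mixed t
  set u := Δ * strength N with hu
  have e1 := hc.traceNorm_pow_le hN (by linarith) isDensity_mixed hσ t
  rw [map_sub, hpow, ← hu] at e1
  rw [traceNorm_of_traceless (hd.1.1.sub hσ.1.1) (by rw [Matrix.trace_sub, hd.2, hσ.2, sub_self]),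
    traceNorm_of_traceless (isHermitian_mixed.sub hσ.1.1)
      (by rw [Matrix.trace_sub, isDensity_mixed.2, hσ.2, sub_self])] at e1
  have hneg : ∀ A B : Matrix (Fin 2) (Fin 2) ℂ, fro (A - B) = fro (B - A) := fun A B => by
    simp only [fro, Matrix.sub_apply, norm_sub_rev]
  have e2 := fro_add_le ((N ^ t) mixed - mixed) (σ - (N ^ t) mixed)
  rw [sub_add_sub_cancel', hneg σ ((N ^ t) mixed)] at e2
  rw [hneg mixed σ] at e1
  rw [purity_eq hσ.1.1 hσ.2, purity_eq hd.1.1 hd.2]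
  have e3 : (1 - u) ^ t ≤ 1 / (1 + u * t) := by
    have h2 : (1 + u * t) ≤ (1 + u) ^ t := by
      have := one_add_mul_le_pow (show (-2 : ℝ) ≤ u by linarith) t
      linarith
    have h3 : (1 - u) ^ t * (1 + u) ^ t ≤ 1 := by
      rw [← mul_pow]
      exact pow_le_one₀ (by nlinarith) (by nlinarith)
    rw [le_div_iff₀ (by positivity)]
    exact (mul_le_mul_of_nonneg_left h2 (pow_nonneg (by linarith) t)).trans h3
  have e4 : u * t / (1 + u * t) = 1 - 1 / (1 + u * t) := by
    have : 1 + u * t ≠ 0 := by positivity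
    field_simp
    ring
  rw [e4]
  have hs := Real.sqrt_nonneg 2
  have hf := fro_nonneg (σ - mixed)
  have e5 := mul_le_mul_of_nonneg_left e2 hs
  have e6 := mul_le_mul_of_nonneg_right e3 (mul_nonneg hs hf)
  nlinarith

lemma conj1_mulVec (U ρ : Matrix (Fin 2) (Fin 2) ℂ) (x : Lab) :
    (conj1 U *ᵥ fun b => ρ b.1 b.2) x = (U * ρ * U.conjTranspose) x.1 x.2 := by
  simp only [Matrix.mulVec, dotProduct, conj1, Matrix.of_apply, Matrix.mul_apply,
    Fintype.sum_prod_type, Fin.sum_univ_two, Matrix.conjTranspose_apply]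
  ring

/-- A unitary turns a qubit into a diagonal state. -/
lemma exists_diagonalize {ρ : Matrix (Fin 2) (Fin 2) ℂ} (hρ : IsDensity ρ) :
    ∃ (U : Matrix (Fin 2) (Fin 2) ℂ) (b : ℝ), U ∈ Matrix.unitaryGroup (Fin 2) ℂ ∧
      (conj1 U *ᵥ fun x => ρ x.1 x.2) = diagState b ∧ |b| = purity ρ ∧ |b| ≤ 1 := by
  have hH := hρ.1.1
  set U := hH.eigenvectorUnitary with hU
  set D : Matrix (Fin 2) (Fin 2) ℂ := Matrix.diagonal fun i => (hH.eigenvalues i : ℂ) with hD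
  have h1 : star (U : Matrix (Fin 2) (Fin 2) ℂ) * ρ * U = D := by
    have := hH.conjStarAlgAut_star_eigenvectorUnitary
    simp only [Unitary.conjStarAlgAut_apply, Unitary.coe_star, star_star] at this
    exact this
  have hUU : (U : Matrix (Fin 2) (Fin 2) ℂ) * star (U : Matrix (Fin 2) (Fin 2) ℂ) = 1 :=
    Matrix.mem_unitaryGroup_iff.1 U.2
  have h2 : (hH.eigenvalues 0 : ℂ) + hH.eigenvalues 1 = 1 := by
    rw [← hρ.2, hH.trace_eq_sum_eigenvalues, Fin.sum_univ_two]
    rfl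
  have h2' : hH.eigenvalues 0 + hH.eigenvalues 1 = 1 := by exact_mod_cast h2
  have h3 : (ρ * ρ).trace = ((hH.eigenvalues 0 ^ 2 + hH.eigenvalues 1 ^ 2 : ℝ) : ℂ) := by
    have e : (ρ * ρ).trace = (D * D).trace := by
      rw [← h1]
      have : star (U : Matrix (Fin 2) (Fin 2) ℂ) * ρ * U *
            (star (U : Matrix (Fin 2) (Fin 2) ℂ) * ρ * U) =
          star (U : Matrix (Fin 2) (Fin 2) ℂ) * (ρ * ρ * U) := by
        calc _ = star (U : Matrix (Fin 2) (Fin 2) ℂ) * (ρ * ((U : Matrix (Fin 2) (Fin 2) ℂ) *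
              star (U : Matrix (Fin 2) (Fin 2) ℂ)) * ρ * U) := by simp only [mul_assoc]
          _ = _ := by rw [hUU, mul_one]
      rw [this, Matrix.trace_mul_comm (star (U : Matrix (Fin 2) (Fin 2) ℂ)), mul_assoc, hUU, mul_one]
    rw [e, hD, Matrix.diagonal_mul_diagonal, Matrix.trace_fin_two]
    simp
    ring
  refine ⟨star (U : Matrix (Fin 2) (Fin 2) ℂ), hH.eigenvalues 0 - hH.eigenvalues 1,
    (star U).2, ?_, ?_, ?_⟩
  · ext x
    rw [conj1_mulVec, ← Matrix.star_eq_conjTranspose, star_star, h1]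
    obtain ⟨i, j⟩ := x
    fin_cases i <;> fin_cases j <;> simp [hD, diagState, Prod.ext_iff]
    · linear_combination (1 / 2 : ℂ) * h2
    · linear_combination (1 / 2 : ℂ) * h2
  · rw [purity, h3, Complex.ofReal_re, ← Real.sqrt_sq_eq_abs]
    congr 1
    nlinarith
  · have p0 := hρ.1.eigenvalues_nonneg 0
    have p1 := hρ.1.eigenvalues_nonneg 1
    rw [abs_le]
    constructor <;> linarith

lemma purity_le_one {ρ : Matrix (Fin 2) (Fin 2) ℂ} (hρ : IsDensity ρ) : purity ρ ≤ 1 := by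
  obtain ⟨U, b, -, -, h, h'⟩ := exists_diagonalize hρ
  rwa [← h]

/-- States can be rotated to a prescribed, not larger polarization. -/
lemma exists_prepare {ρ : Matrix (Fin 2) (Fin 2) ℂ} (hρ : IsDensity ρ) {b : ℝ} (h0 : 0 ≤ b)
    (hb : b ≤ purity ρ) : ∃ k, MixU (oneKer k) ∧ (k *ᵥ fun x => ρ x.1 x.2) = diagState b := by
  obtain ⟨U, b', hU, h, h', -⟩ := exists_diagonalize hρ
  rw [← h'] at hb
  rcases le_total 0 b' with hb' | hb'
  · rw [abs_of_nonneg hb'] at hb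
    obtain ⟨r, hr0, hr1, hr⟩ := exists_flipKer b' b h0 hb
    exact ⟨flipKer r * conj1 U, (mixU_flipKer hr0 hr1).oneKer_mul (mixU_conj1 U hU), by
      rw [← Matrix.mulVec_mulVec, h, hr]⟩
  · rw [abs_of_nonpos hb'] at hb
    obtain ⟨r, hr0, hr1, hr⟩ := exists_flipKer (-b') b h0 hb
    refine ⟨flipKer r * (flipKer 1 * conj1 U), (mixU_flipKer hr0 hr1).oneKer_mul
      ((mixU_flipKer zero_le_one le_rfl).oneKer_mul (mixU_conj1 U hU)), ?_⟩
    rw [← Matrix.mulVec_mulVec, ← Matrix.mulVec_mulVec, h, flipKer_diagState,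
      show (1 - 2 * 1) * b' = -b' by ring, hr]

lemma vec_mixed : (fun x : Lab => mixed x.1 x.2) = diagState 0 := by
  ext ⟨i, j⟩
  fin_cases i <;> fin_cases j <;> simp [mixed, diagState, Prod.ext_iff]

/-- The polarization acquired by idling can be turned into the direction of `|0⟩`. -/
theorem exists_prepare_idle {N : QubitMap} {Δ : ℝ} (hN : IsChannel N) (hc : IsContracting Δ N)
    (h0 : 0 ≤ Δ * strength N) (h1 : Δ * strength N ≤ 1) {σ : Matrix (Fin 2) (Fin 2) ℂ}
    (hσ : IsDensity σ) (hfix : N σ = σ) (t : ℕ) {b : ℝ} (hb0 : 0 ≤ b)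
    (hb : b ≤ purity σ * (Δ * strength N * t / (1 + Δ * strength N * t))) :
    ∃ k, MixU (oneKer k) ∧ k *ᵥ (qker N ^ t *ᵥ diagState 0) = diagState b := by
  have h : (qker N ^ t *ᵥ diagState 0) = fun x : Lab => (N ^ t) mixed x.1 x.2 := by
    ext x
    rw [← qker_pow, ← vec_mixed, qker_mulVec]
  rw [h]
  exact exists_prepare (hN.isDensity_pow isDensity_mixed t) hb0
    (hb.trans (le_purity_pow hN hc h0 h1 hσ hfix t))

/-- The bounds on the noise that enter the analysis of the gadgets. -/
lemma noiseBound {N : QubitMap} (hN : IsChannel N) {σ : Matrix (Fin 2) (Fin 2) ℂ}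
    (hσ : IsDensity σ) (hfix : N σ = σ) :
    NoiseBound N (fun x => σ x.1 x.2) (8 * strength N) (purity σ) where
  tp := hN.TP
  hermPres := hN.hermPres
  fixed := by
    ext x
    rw [qker_mulVec, hfix]
  norm_sub_one_le := norm_qker_sub_one_le N
  norm_fixed_le := by
    rw [← vec_mixed]
    refine (pi_norm_le_iff_of_nonneg (show 0 ≤ purity σ from Real.sqrt_nonneg _)).2 fun x => ?_
    change ‖(σ - mixed) x.1 x.2‖ ≤ _
    rw [purity_eq hσ.1.1 hσ.2]
    have h1 := norm_entry_le_fro (σ - mixed) x.1 x.2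
    have h2 : 1 ≤ Real.sqrt 2 := Real.one_le_sqrt.2 (by norm_num)
    have h3 := fro_nonneg (σ - mixed)
    refine h1.trans ?_
    nlinarith
  le_one := purity_le_one hσ

/-- Contracting noise of a given constant is not arbitrarily strong. -/
lemma IsContracting.mul_strength_le_one {N : QubitMap} {Δ : ℝ} (hc : IsContracting Δ N) :
    Δ * strength N ≤ 1 := by
  have hd : ∀ i : Fin 2, IsDensity (Matrix.single i i (1 : ℂ)) := fun i => by
    constructor
    · have h : Matrix.single i i (1 : ℂ) = Matrix.diagonal (Pi.single i 1) := by
        rw [Matrix.diagonal_single]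
      rw [h]
      refine Matrix.PosSemidef.diagonal fun j => ?_
      by_cases hj : j = i
      · subst hj; simp
      · simp [hj]
    · simp
  have h := hc _ _ (hd 0) (hd 1)
  have h1 : 0 < traceNorm (Matrix.single 0 0 1 - Matrix.single 1 1 1 : Matrix (Fin 2) (Fin 2) ℂ) := by
    rw [traceNorm_of_traceless ((hd 0).1.1.sub (hd 1).1.1)
      (by rw [Matrix.trace_sub, (hd 0).2, (hd 1).2, sub_self])]
    have h2 := norm_entry_le_fro
      (Matrix.single 0 0 1 - Matrix.single 1 1 1 : Matrix (Fin 2) (Fin 2) ℂ) 0 0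
    simp only [Matrix.sub_apply, Matrix.single_apply] at h2
    norm_num at h2
    have := Real.sqrt_pos.2 (show (0 : ℝ) < 2 by norm_num)
    positivity
  have h2 := (traceNorm_nonneg _).trans h
  have h3 := (mul_nonneg_iff_of_pos_right h1).1 h2
  linarith

/-! ### The progress of the polarization -/

/-- The polarization after a gadget, with the parameter `a` for the effect of the noise. -/
def polStep (a η b : ℝ) : ℝ := (3 * b - b ^ 3) / 2 - a * (b + η)

section iterate

variable {a η θ e : ℝ}

lemma polStep_le_one (ha : 0 ≤ a) (hη : 0 ≤ η) {b : ℝ} (h0 : 0 ≤ b) :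
    polStep a η b ≤ 1 := by
  have : 0 ≤ a * (b + η) := by positivity
  rw [polStep]
  nlinarith [mul_nonneg (sq_nonneg (1 - b)) (show 0 ≤ 2 + b by linarith)]

/-- As long as it is small, the polarization is multiplied by almost `3 / 2`. -/
lemma mul_le_polStep (ha : a ≤ θ / 3) (hθ : 0 < θ) (hθ' : θ ≤ 1 / 2)
    {b : ℝ} (h0 : 3 / θ * a * η ≤ b) (hb0 : 0 ≤ b) (hb : b ≤ θ) :
    (3 / 2 - θ) * b ≤ polStep a η b := by
  have h1 : a * η ≤ θ / 3 * b := by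
    have : θ / 3 * (3 / θ * a * η) = a * η := by field_simp
    rw [← this]
    exact mul_le_mul_of_nonneg_left h0 (by positivity)
  have h2 : a * b ≤ θ / 3 * b := mul_le_mul_of_nonneg_right ha hb0
  have h3 : b ^ 2 ≤ θ * (1 / 2) := by nlinarith
  have h4 : b ^ 2 * b ≤ θ * (1 / 2) * b := mul_le_mul_of_nonneg_right h3 hb0
  have h5 : 0 ≤ θ * b := by positivity
  rw [polStep]
  nlinarith

/-- Intermediate polarizations increase at least linearly. -/
lemma add_le_polStep (ha0 : 0 ≤ a) (ha : a ≤ θ * e / 8) (hη : η ≤ 1) (hθ : 0 < θ) (he : 0 ≤ e)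
    {lo b : ℝ} (h0 : θ ≤ lo) (h1 : lo ≤ 1 - e) (hb : lo ≤ b) (hb1 : b ≤ 1) :
    lo + θ * e / 4 ≤ polStep a η b := by
  have h2 : a * (b + η) ≤ a * 2 := mul_le_mul_of_nonneg_left (by linarith) ha0
  have h3 : (3 * lo - lo ^ 3) / 2 ≤ (3 * b - b ^ 3) / 2 := by
    have : 0 ≤ (b - lo) * (3 - (b ^ 2 + b * lo + lo ^ 2)) :=
      mul_nonneg (by linarith) (by nlinarith)
    nlinarith
  have h4 : θ * e ≤ lo * (1 - lo ^ 2) := mul_le_mul h0 (by nlinarith) he (by linarith)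
  rw [polStep]
  nlinarith

/-- Near the maximum the defect contracts. -/
lemma one_sub_polStep_le (ha0 : 0 ≤ a) (hη : η ≤ 1) {b : ℝ} (hb : 1 - e ≤ b) (hb1 : b ≤ 1) :
    1 - polStep a η b ≤ 3 / 2 * e * (1 - b) + 2 * a := by
  have h2 : a * (b + η) ≤ a * 2 := mul_le_mul_of_nonneg_left (by linarith) ha0
  have h3 : (1 - b) * (1 - b) ≤ e * (1 - b) := mul_le_mul_of_nonneg_right (by linarith) (by linarith)
  have h4 : 0 ≤ (1 - b) ^ 3 := pow_nonneg (by linarith) 3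
  rw [polStep]
  nlinarith

variable {b : ℕ → ℝ} (hb : ∀ j, b (j + 1) = polStep a η (b j)) (ha0 : 0 ≤ a) (hη0 : 0 ≤ η)
  (hη : η ≤ 1) (hθ : 0 < θ) (hθ' : θ ≤ 1 / 2) (he : 0 < e) (he' : e ≤ 1 / 3)
  (ha : a ≤ θ * e / 8)
include hb ha0 hη0 hη hθ hθ' he he' ha

/-- The polarization grows exponentially up to `θ`, and does not fall below `θ` afterwards. -/
lemma polarization_growth (h0 : b 0 = 3 / θ * a * η) (h1 : b 0 ≤ θ) (j : ℕ) :
    b 0 ≤ b j ∧ b j ≤ 1 ∧ min ((3 / 2 - θ) ^ j * b 0) θ ≤ b j := by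
  have hb0 : 0 ≤ b 0 := by rw [h0]; positivity
  have key : ∀ j, min ((3 / 2 - θ) ^ j * b 0) θ ≤ b j → b 0 ≤ b j := fun j h => by
    refine le_trans (le_min ?_ h1) h
    exact le_mul_of_one_le_left hb0 (one_le_pow₀ (by linarith))
  suffices h : b j ≤ 1 ∧ min ((3 / 2 - θ) ^ j * b 0) θ ≤ b j from ⟨key j h.2, h⟩
  induction j with
  | zero => exact ⟨by linarith, by simp⟩
  | succ j ih =>
    have hj := key j ih.2
    rw [hb]
    refine ⟨polStep_le_one ha0 hη0 (by linarith), ?_⟩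
    rcases le_total (b j) θ with h | h
    · refine le_trans ?_ (mul_le_polStep (by nlinarith) hθ hθ' (h0 ▸ hj) (by linarith) h)
      rcases min_le_iff.1 ih.2 with h' | h'
      · refine (min_le_left _ _).trans ?_
        rw [pow_succ', mul_assoc]
        exact mul_le_mul_of_nonneg_left h' (by linarith)
      · refine (min_le_right _ _).trans ?_
        nlinarith
    · refine (min_le_right _ _).trans ?_
      have := add_le_polStep ha0 ha hη hθ he.le le_rfl (by linarith) h ih.1
      have h3 : 0 ≤ θ * e := by positivity
      linarith

/-- It takes at most about `1 / (θ * e)` levels from the polarization `θ` to `1 - e`. -/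
lemma polarization_linear (h1 : ∀ j, b j ≤ 1) {i : ℕ} (hi : θ ≤ b i) (j : ℕ) :
    min (θ + j * (θ * e / 4)) (1 - e) ≤ b (i + j) := by
  induction j with
  | zero => exact (min_le_left _ _).trans (by simpa using hi)
  | succ j ih =>
    have h3 : 0 ≤ θ * e := by positivity
    rw [← add_assoc, hb]
    refine le_trans ?_ (add_le_polStep ha0 ha hη hθ he.le (le_min ?_ ?_) (min_le_right _ _) ih (h1 _))
    · rw [← min_add_add_right]
      refine min_le_min ?_ (by linarith)
      push_cast
      linarith
    · have : 0 ≤ (j : ℝ) * (θ * e / 4) := by positivity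
      linarith
    · linarith

/-- From the polarization `1 - e` on, the defect decreases exponentially, up to the effect of the
noise. -/
lemma polarization_final (h1 : ∀ j, b j ≤ 1) {i : ℕ} (hi : 1 - e ≤ b i) (j : ℕ) :
    1 - b (i + j) ≤ (3 / 2 * e) ^ j + 4 * a := by
  suffices h : 1 - e ≤ b (i + j) ∧ 1 - b (i + j) ≤ (3 / 2 * e) ^ j + 4 * a from h.2
  have hee : 3 / 2 * e * e ≤ 1 / 2 * e := mul_le_mul_of_nonneg_right (by linarith) he.le
  induction j with
  | zero => exact ⟨hi, by simp only [add_zero, pow_zero]; linarith⟩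
  | succ j ih =>
    have h := one_sub_polStep_le ha0 hη ih.1 (h1 _)
    rw [← hb, add_assoc] at h
    have h5 := mul_le_mul_of_nonneg_left ih.2 (show 0 ≤ 3 / 2 * e by linarith)
    have h6 : 3 / 2 * e * (1 - b (i + j)) ≤ 3 / 2 * e * e :=
      mul_le_mul_of_nonneg_left (by linarith [ih.1]) (by linarith)
    have h7 : 8 * a ≤ e := by nlinarith
    have h8 : 3 / 2 * e * (4 * a) ≤ 1 / 2 * (4 * a) :=
      mul_le_mul_of_nonneg_right (by linarith) (by linarith)
    refine ⟨by linarith, h.trans ?_⟩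
    rw [pow_succ']
    linarith

end iterate

/-- A number of levels that exceeds `log (1 / β) / log (3 / 2)` by a constant factor suffices to cool
from polarization `β` to almost a pure state. -/
theorem exists_polarizations {δ μ : ℝ} (hδ : 0 < δ)
    (hμ : μ = Real.log 3 / Real.log (3 / 2) + δ) : ∃ L a₀ : ℝ, 0 < L ∧ 0 < a₀ ∧
    ∀ (a β η : ℝ) (k : ℕ), 0 < β → β ≤ a * η → 0 < η → η ≤ 1 → 0 < a → a ≤ a₀ →
      β ^ (-μ) ≤ (3 : ℝ) ^ k →
      ∃ b : ℕ → ℝ, b 0 = L * a * η ∧ (∀ j, 0 ≤ b j ∧ b j ≤ 1) ∧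
        (∀ j, b (j + 1) = (3 * b j - b j ^ 3) / 2 - a * (b j + η)) ∧ 1 - 5 * a ≤ b k := by
  have hl3 : 0 < Real.log 3 := Real.log_pos (by norm_num)
  have hl : 0 < Real.log (3 / 2) := Real.log_pos (by norm_num)
  -- The exponent `μ` leaves room for a growth factor `g < 3 / 2` and a final phase.
  obtain ⟨ζ, hζ⟩ : ∃ ζ, ζ = δ / (3 * Real.log 3) := ⟨_, rfl⟩
  have hζ0 : 0 < ζ := by rw [hζ]; positivity
  obtain ⟨G, hG⟩ : ∃ G, G = 1 / (1 / Real.log (3 / 2) + ζ) := ⟨_, rfl⟩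
  have hG0 : 0 < G := by rw [hG]; positivity
  have hGl : G < Real.log (3 / 2) := by
    rw [hG, one_div_lt (by positivity) hl]
    linarith
  obtain ⟨θ, hθ⟩ : ∃ θ, θ = 3 / 2 - Real.exp G := ⟨_, rfl⟩
  have hθ0 : 0 < θ := by
    have := (Real.lt_log_iff_exp_lt (by norm_num)).1 hGl
    linarith
  have hθ1 : θ ≤ 1 / 2 := by
    have := Real.one_le_exp hG0.le
    linarith
  obtain ⟨R, hR⟩ : ∃ R, R = max (1 / ζ) (Real.log 2) := ⟨_, rfl⟩
  have hR0 : 0 < R := by rw [hR]; exact lt_max_of_lt_left (by positivity)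
  obtain ⟨e, he⟩ : ∃ e, e = 2 / 3 * Real.exp (-R) := ⟨_, rfl⟩
  have he0 : 0 < e := by rw [he]; positivity
  have he1 : e ≤ 1 / 3 := by
    have h1 : Real.exp (-R) ≤ Real.exp (-Real.log 2) :=
      Real.exp_le_exp.2 (neg_le_neg (hR ▸ le_max_right _ _))
    rw [Real.exp_neg (Real.log 2), Real.exp_log (by norm_num)] at h1
    linarith
  -- The numbers of levels of the three phases are `n₁`, `n₂` and at least `n₃`.
  obtain ⟨n₂, hn₂⟩ := exists_nat_gt (1 / (θ * e / 4))
  have hθe : 0 < θ * e := mul_pos hθ0 he0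
  refine ⟨3 / θ, min (min (θ * e / 8) (θ ^ 2 / 3)) (Real.exp (-((n₂ + 2) / ζ))), by positivity,
    lt_min (lt_min (by positivity) (by positivity)) (Real.exp_pos _), ?_⟩
  intro a β η k hβ hβa hη0 hη1 ha0 ha hk
  rw [le_min_iff, le_min_iff] at ha
  obtain ⟨⟨ha1, ha2⟩, ha3⟩ := ha
  have hβa' : β ≤ a := hβa.trans (mul_le_of_le_one_right ha0.le hη1)
  obtain ⟨X, hX⟩ : ∃ X, X = -Real.log β := ⟨_, rfl⟩
  have hβX : β = Real.exp (-X) := by rw [hX, neg_neg, Real.exp_log hβ]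
  have hX0 : (n₂ + 2) / ζ ≤ X := by
    have := hβa'.trans ha3
    rw [hβX, Real.exp_le_exp] at this
    linarith
  have hXpos : 0 ≤ X := le_trans (by positivity) hX0
  have hk' : X / G + X * ζ + n₂ + 2 ≤ k := by
    have h1 := Real.log_le_log (Real.rpow_pos_of_pos hβ _) hk
    rw [Real.log_rpow hβ, Real.log_pow] at h1
    have h2 : μ = Real.log 3 * (1 / Real.log (3 / 2) + 3 * ζ) := by
      rw [hμ, hζ]; field_simp
    have h3 : (1 / Real.log (3 / 2) + 3 * ζ) * X ≤ k := by
      refine le_of_mul_le_mul_left ?_ hl3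
      rw [hX]
      calc _ = -μ * Real.log β := by rw [h2]; ring
        _ ≤ _ := by linarith
    have h4 : X / G = X * (1 / Real.log (3 / 2) + ζ) := by rw [hG]; field_simp
    have h5 := (div_le_iff₀ hζ0).1 hX0
    rw [h4]
    linarith
  have hXR : X / R ≤ X * ζ := by
    rw [div_le_iff₀ hR0, mul_assoc]
    refine le_mul_of_one_le_right hXpos ?_
    have : 1 / ζ ≤ R := hR ▸ le_max_left _ _
    rwa [div_le_iff₀ hζ0, mul_comm] at this
  obtain ⟨n₁, hn₁⟩ : ∃ n, n = ⌈X / G⌉₊ := ⟨_, rfl⟩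
  obtain ⟨n₃, hn₃⟩ : ∃ n, n = ⌈X / R⌉₊ := ⟨_, rfl⟩
  have h1 := Nat.ceil_lt_add_one (show 0 ≤ X / G by positivity)
  have h3 := Nat.ceil_lt_add_one (show 0 ≤ X / R by positivity)
  have h1' := Nat.le_ceil (X / G)
  have h3' := Nat.le_ceil (X / R)
  rw [← hn₁] at h1 h1'
  rw [← hn₃] at h3 h3'
  have hsum : n₁ + n₂ + n₃ ≤ k := by
    have : ((n₁ + n₂ + n₃ : ℕ) : ℝ) ≤ k := by push_cast; linarith
    exact_mod_cast this
  obtain ⟨i, rfl⟩ := Nat.exists_eq_add_of_le hsum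
  obtain ⟨b, hb⟩ : ∃ b : ℕ → ℝ, b = fun j => (polStep a η)^[j] (3 / θ * a * η) := ⟨_, rfl⟩
  have hb0 : b 0 = 3 / θ * a * η := by rw [hb]; rfl
  have hbs : ∀ j, b (j + 1) = polStep a η (b j) := fun j => by
    rw [hb]; exact Function.iterate_succ_apply' _ _ _
  have hbθ : b 0 ≤ θ := by
    rw [hb0]
    calc 3 / θ * a * η ≤ 3 / θ * a * 1 := by gcongr
      _ ≤ 3 / θ * (θ ^ 2 / 3) * 1 := by gcongr
      _ = θ := by field_simp
  have hgrow := polarization_growth hbs ha0.le hη0.le hη1 hθ0 hθ1 he0 he1 ha1 hb0 hbθ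
  have hb0' : 0 ≤ b 0 := by rw [hb0]; positivity
  refine ⟨b, hb0, fun j => ⟨hb0'.trans (hgrow j).1, (hgrow j).2.1⟩, hbs, ?_⟩
  have p1 : θ ≤ b n₁ := by
    refine le_trans (le_min ?_ le_rfl) (hgrow n₁).2.2
    rw [show 3 / 2 - θ = Real.exp G by rw [hθ]; ring, ← Real.exp_nat_mul]
    have e1 : Real.exp X ≤ Real.exp (n₁ * G) :=
      Real.exp_le_exp.2 ((div_le_iff₀ hG0).1 h1')
    have e2 : θ * β ≤ b 0 := by
      rw [hb0]
      calc θ * β ≤ 3 / θ * (a * η) := by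
            refine mul_le_mul ?_ hβa hβ.le (by positivity)
            rw [le_div_iff₀ hθ0]
            nlinarith
        _ = _ := by ring
    calc θ = Real.exp X * (θ * β) := by
          rw [hβX, mul_left_comm, ← Real.exp_add, add_neg_cancel, Real.exp_zero, mul_one]
      _ ≤ _ := mul_le_mul e1 e2 (by positivity) (by positivity)
  have p2 : 1 - e ≤ b (n₁ + n₂) := by
    refine le_trans (le_min ?_ le_rfl) (polarization_linear hbs ha0.le hη0.le hη1 hθ0 hθ1 he0 he1 ha1
      (fun j => (hgrow j).2.1) p1 n₂)
    rw [div_lt_iff₀ (by positivity)] at hn₂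
    linarith
  have p3 := polarization_final hbs ha0.le hη0.le hη1 hθ0 hθ1 he0 he1 ha1
    (fun j => (hgrow j).2.1) p2 (n₃ + i)
  have p4 : (3 / 2 * e) ^ (n₃ + i) ≤ β := by
    calc _ ≤ (3 / 2 * e) ^ n₃ := pow_le_pow_of_le_one (by positivity) (by linarith) (by omega)
      _ = Real.exp (-(n₃ * R)) := by
        rw [he, show 3 / 2 * (2 / 3 * Real.exp (-R)) = Real.exp (-R) by ring, ← Real.exp_nat_mul]
        congr 1; ring
      _ ≤ β := by
        rw [hβX, Real.exp_le_exp]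
        have := (div_le_iff₀ hR0).1 h3'
        linarith
  rw [← add_assoc] at p3
  linarith

/-! ### The choice of the parameters -/

/-- For some noise `N'` of strength at most `C * (κ * τ)`, where `κ` is the strength of `N`, circuits
with RESETs and noise `N'` on arbitrary registers are simulated by unitary circuits with noise `N`.
The time overhead is at most `C * τ` and the space overhead at most `C * τ ^ d`. -/
def HasSimulation (d m : ℕ) (N : QubitMap) (τ C : ℝ) : Prop :=
  ∃ (N' : QubitMap) (T A : ℕ), IsChannel N' ∧ strength N' ≤ C * (strength N * τ) ∧
    (T : ℝ) ≤ C * τ ∧ (A : ℝ) ≤ C * τ ^ d ∧ ∀ Λ' : Finset (Fin d → ℤ), ∃ Λ : Finset (Fin d → ℤ),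
      Λ.card ≤ A * Λ'.card ∧ ∀ target : List (Layer (latticeGraph Λ') m),
        Simulates (latticeGraph Λ) N (T * target.length) N' target

lemma HasSimulation.mono {d m : ℕ} {N : QubitMap} {τ C C' : ℝ} (h : HasSimulation d m N τ C)
    (hτ : 0 ≤ τ) (hC : C ≤ C') : HasSimulation d m N τ C' := by
  obtain ⟨N', T, A, h1, h2, h3, h4, h5⟩ := h
  have := strength_nonneg N
  exact ⟨N', T, A, h1, h2.trans (by gcongr), h3.trans (by gcongr), h4.trans (by gcongr), h5⟩

lemma depKer_mulVec {α : Lab → ℂ} (h : ∑ x, trw x * α x = 1) : depKer *ᵥ α = diagState 0 := by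
  ext x
  simp only [Matrix.mulVec, dotProduct, depKer_apply, mul_assoc, ← Finset.mul_sum, h, mul_one]

lemma TP_depKer : TP depKer := TP_dephKer.mul (TP_flipKer _)

/-- If `κ τ` is bounded below, then the noise of the simulated circuit may contain bit flips of rate
`1 / 2`. These turn a reset qubit into a completely mixed one, so that RESETs can be replaced by
depolarizations. -/
theorem exists_hasSimulation_of_le {d m : ℕ} (hd : 0 < d) (hm : 2 ≤ m) {Δ τ₀ y₀ : ℝ} (hΔ : 0 < Δ)
    (hτ₀ : 0 < τ₀) (hy₀ : 0 < y₀) : ∃ C : ℝ, 0 < C ∧ ∀ N : QubitMap, IsChannel N →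
      Δ * strength N ≤ 1 → ∀ τ, τ₀ ≤ τ → y₀ ≤ strength N * τ → HasSimulation d m N τ C := by
  obtain ⟨T, hT⟩ : ∃ T, T = roundTime hd m 1 0 0 := ⟨_, rfl⟩
  obtain ⟨A, hA⟩ : ∃ A, A = (2 * (m * (1 + 2 * m)) + 1) ^ d := ⟨_, rfl⟩
  obtain ⟨B, hB⟩ : ∃ B : ℝ, B = 160 * (1 + 8 / Δ) ^ T + 64 := ⟨_, rfl⟩
  have hB0 : 0 < B := by rw [hB]; positivity
  refine ⟨B / y₀ + T / τ₀ + A / τ₀ ^ d, by positivity, fun N hN hκ τ hτ hy => ?_⟩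
  have hκ0 := strength_nonneg N
  have hτ0 : 0 < τ := hτ₀.trans_le hτ
  refine ⟨N ^ T * flipMap (1 / 2), T, A,
    (hN.pow T).mul (isChannel_flipMap (by norm_num) (by norm_num)), ?_, ?_, ?_, fun Λ' => ?_⟩
  · have h1 := strength_pow_mul_flipMap_le N T (r := 1 / 2) (by norm_num) (by norm_num)
    have h2 := norm_pow_sub_one_le (qker N) T
    have h3 : (1 + ‖qker N - 1‖) ^ T ≤ (1 + 8 / Δ) ^ T := by
      gcongr
      rw [le_div_iff₀ hΔ]
      have := norm_qker_sub_one_le N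
      nlinarith
    have h4 : 0 ≤ (T / τ₀ + A / τ₀ ^ d) * (strength N * τ) := by positivity
    calc _ ≤ B := by rw [hB]; linarith
      _ = B / y₀ * y₀ := by field_simp
      _ ≤ B / y₀ * (strength N * τ) := by gcongr
      _ ≤ _ := by linarith
  · have h4 : 0 ≤ (B / y₀ + A / τ₀ ^ d) * τ := by positivity
    calc (T : ℝ) = T / τ₀ * τ₀ := by field_simp
      _ ≤ T / τ₀ * τ := by gcongr
      _ ≤ _ := by linarith
  · have h4 : 0 ≤ (B / y₀ + T / τ₀) * τ ^ d := by positivity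
    calc (A : ℝ) = A / τ₀ ^ d * τ₀ ^ d := by field_simp
      _ ≤ A / τ₀ ^ d * τ ^ d := by gcongr
      _ ≤ _ := by linarith
  · rw [hA, hT]
    refine exists_simulation hd hm N hN 1 0 0 (fun c => le_rfl) (fun _ => diagState 0)
      ⟨depKer, mixU_depKer, depKer_mulVec ?_⟩ (trace_diagState 0) (fun i hi => absurd hi (by omega))
      (by norm_num) (by norm_num) ⟨depKer, mixU_depKer, TP_depKer, ?_⟩ Λ'
    · rw [idleState, (hN.TP.pow _).trace, trace_diagState]
    · rw [depKer_mulVec (by rw [(hN.TP.pow _).trace, trace_diagState])]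
      norm_num

/-- A cold qubit remains cold while it is moved to its destination. -/
lemma NoiseBound.exists_final {N : QubitMap} {σ : Lab → ℂ} {ε η : ℝ} (h : NoiseBound N σ ε η) {t : ℕ}
    (ht : ε * t ≤ 1) {b b' : ℝ} (h0 : 0 ≤ b) (h1 : b ≤ 1) (hb' : 0 ≤ b') (hbb' : b' ≤ b - 4 * (ε * t)) :
    ∃ k, MixU (oneKer k) ∧ TP k ∧ k *ᵥ (qker N ^ t *ᵥ diagState b) = diagState b' := by
  have hdist : ‖qker N ^ t *ᵥ diagState b - diagState b‖ ≤ 2 * (ε * t) := by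
    have e : qker N ^ t *ᵥ diagState b - diagState b = (qker N ^ t - 1) *ᵥ diagState b := by
      rw [Matrix.sub_mulVec, Matrix.one_mulVec]
    rw [e]
    refine (Matrix.linfty_opNorm_mulVec _ _).trans ?_
    refine (mul_le_of_le_one_right (norm_nonneg _) (norm_diagState_le b h0 h1)).trans ?_
    exact norm_pow_sub_one_le_two_mul _ t h.norm_sub_one_le ht
  have hherm : ∀ x, (qker N ^ t *ᵥ diagState b) x.swap = star ((qker N ^ t *ᵥ diagState b) x) := by
    intro x
    simp only [Matrix.mulVec, dotProduct, star_sum, star_mul']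
    rw [← (Equiv.prodComm (Fin 2) (Fin 2)).sum_comp]
    refine Finset.sum_congr rfl fun y _ => ?_
    rw [← diagState_swap, ← h.hermPres.pow t]
    rfl
  obtain ⟨b'', hb'', hle⟩ := dephKer_eq_diagState hherm
    (by rw [(h.tp.pow t).trace, trace_diagState]) b
  have e0 := (norm_le_pi_norm (qker N ^ t *ᵥ diagState b - diagState b) (0, 0)).trans hdist
  have e1 := (norm_le_pi_norm (qker N ^ t *ᵥ diagState b - diagState b) (1, 1)).trans hdist
  rw [Pi.sub_apply] at e0 e1
  obtain ⟨r, hr0, hr1, hr⟩ := exists_flipKer b'' b' hb' (by linarith)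
  exact ⟨flipKer r * dephKer, (mixU_flipKer hr0 hr1).oneKer_mul mixU_dephKer,
    (TP_flipKer r).mul TP_dephKer, by rw [← Matrix.mulVec_mulVec, hb'', hr]⟩

lemma gap_le {d : ℕ} (hd : 0 < d) {i l : ℕ} (hi : i ≤ d * l) : gap hd i + 1 ≤ 2 * 3 ^ l := by
  have h := side_le hd hi (axis hd i)
  have : 0 < 3 ^ l := by positivity
  rw [gap]
  omega

lemma lag_le {d : ℕ} (hd : 0 < d) {i l : ℕ} (hi : i ≤ d * l) : lag hd i ≤ 2 * 3 ^ l := by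
  cases i with
  | zero =>
    have : 0 < 3 ^ l := by positivity
    rw [lag]
    omega
  | succ i => exact gap_le hd (by omega)

lemma routeTime_le (d m s : ℕ) (hs : 1 ≤ s) :
    routeTime d m (s + 2 * m) ≤ (2 * m) ^ d * (2 * (d * ((1 + 2 * m) * m)) + 1) * s := by
  have h1 : s + 2 * m - 1 ≤ (1 + 2 * m) * s := by
    have : 2 * m ≤ 2 * m * s := Nat.le_mul_of_pos_right _ hs
    rw [add_mul]
    omega
  rw [routeTime, mul_assoc]
  refine Nat.mul_le_mul_left _ ?_
  calc _ ≤ 2 * (d * ((1 + 2 * m) * s * m)) + 1 * s := by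
        gcongr <;> omega
    _ = _ := by ring

set_option maxHeartbeats 1000000 in
/-- If the strength `κ τ` is small, then boxes of side length about `τ` cool qubits to a defect
`O(κ τ)`. -/
theorem exists_hasSimulation_of_ge {d m : ℕ} (hd : 0 < d) (hm : 2 ≤ m) {Δ δ μ : ℝ} (hΔ : 0 < Δ)
    (hδ : 0 < δ) (hμ : μ = Real.log 3 / Real.log (3 / 2) + δ) : ∃ y₀ C : ℝ, 0 < y₀ ∧ 0 < C ∧
    ∀ (N : QubitMap) (σ : Matrix (Fin 2) (Fin 2) ℂ), IsChannel N → IsContracting Δ N →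
      IsDensity σ → N σ = σ → 0 < strength N → 0 < purity σ → ∀ τ : ℝ, 1 ≤ τ →
      strength N * τ ≤ y₀ → (strength N * τ * purity σ) ^ (-μ) ≤ τ ^ d →
      HasSimulation d m N τ C := by
  obtain ⟨C₁, hC₁, hgadget⟩ := exists_gadget
  obtain ⟨L, a₀, hL, ha₀, hpol⟩ := exists_polarizations hδ hμ
  -- The noise acts in a gadget with the parameter `C₂ * (κ * s)`, where `s` is the side length.
  obtain ⟨C₂, hC₂⟩ : ∃ C₂, C₂ = 32 * (C₁ + 1) := ⟨_, rfl⟩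
  have hC₂1 : 1 ≤ C₂ := by linarith
  -- Waiting for the time `W * s` polarizes qubits to `L * C₂ * (κ * s) * η`.
  obtain ⟨W, hW⟩ := exists_nat_ge (2 * L * C₂ / Δ)
  obtain ⟨R₀, hR₀⟩ : ∃ R, R = (2 * m) ^ d * (2 * (d * ((1 + 2 * m) * m)) + 1) := ⟨_, rfl⟩
  obtain ⟨R, hR⟩ : ∃ R, R = 3 + 2 * R₀ + W + 8 * d := ⟨_, rfl⟩
  have hR3 : (3 : ℝ) ≤ R := by
    have : 3 ≤ R := by omega
    exact_mod_cast this
  obtain ⟨M, hM⟩ : ∃ M, M = 2 * (m * (1 + 2 * m)) + 1 := ⟨_, rfl⟩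
  obtain ⟨C₃, hC₃⟩ : ∃ C₃ : ℝ, C₃ = 2560 * R + 64 * (5 * C₂ + 64) := ⟨_, rfl⟩
  have hC₃0 : 0 < C₃ := by rw [hC₃]; positivity
  obtain ⟨K, hK⟩ : ∃ K : ℝ, K = C₂ / a₀ + 2 * L * C₂ + 5 * C₂ + 64 + 8 * R + 1 / a₀ := ⟨_, rfl⟩
  have hK0 : 0 < K := by rw [hK]; positivity
  refine ⟨1 / (3 * K), 3 * C₃ + 3 * R + (3 * M) ^ d, by positivity, by positivity, ?_⟩
  intro N σ hN hcon hσ hfix hκ hη τ hτ hy hβ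
  have hκΔ := hcon.mul_strength_le_one
  have hb := noiseBound hN hσ hfix
  have hη1 := hb.le_one
  obtain ⟨κ, hκ'⟩ : ∃ κ, κ = strength N := ⟨_, rfl⟩
  obtain ⟨η, hη'⟩ : ∃ η, η = purity σ := ⟨_, rfl⟩
  -- The side length `s` is the power of `3` with `τ < s ≤ 3 * τ`.
  obtain ⟨n, hn, hn'⟩ := exists_nat_pow_near hτ (show (1 : ℝ) < 3 by norm_num)
  obtain ⟨l, hl⟩ : ∃ l, l = n + 1 := ⟨_, rfl⟩
  rw [← hl] at hn'
  obtain ⟨s, hs⟩ : ∃ s : ℕ, s = 3 ^ l := ⟨_, rfl⟩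
  have hsτ : τ ≤ s := by rw [hs]; push_cast; exact hn'.le
  have hsτ' : (s : ℝ) ≤ 3 * τ := by rw [hs, hl]; push_cast; rw [pow_succ]; linarith
  have hs1 : 1 ≤ s := by exact_mod_cast hτ.trans hsτ
  rw [← hκ'] at hκΔ hκ hy hβ hb
  rw [← hη'] at hη hη1 hβ hb
  obtain ⟨z, hz⟩ : ∃ z, z = κ * s := ⟨_, rfl⟩
  have hz0 : 0 < z := by rw [hz]; positivity
  have hzτ : κ * τ ≤ z := by rw [hz]; gcongr
  have hzτ' : z ≤ 3 * (κ * τ) := by rw [hz]; nlinarith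
  have hzK : K * z ≤ 1 := by
    rw [le_div_iff₀ (by positivity)] at hy
    nlinarith
  have hzK' : C₂ / a₀ * z + 2 * L * C₂ * z + 5 * C₂ * z + 64 * z + 8 * R * z + 1 / a₀ * z ≤ 1 := by
    rw [hK] at hzK; linarith
  have q1 : 0 ≤ C₂ / a₀ * z := by positivity
  have q2 : 0 ≤ 2 * L * C₂ * z := by positivity
  have q3 : 0 ≤ 5 * C₂ * z := by positivity
  have q4 : 0 ≤ 8 * R * z := by positivity
  have q5 : 0 ≤ 1 / a₀ * z := by positivity
  have ha : C₂ * z ≤ a₀ := by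
    have : C₂ / a₀ * z ≤ 1 := by linarith
    rwa [div_mul_eq_mul_div, div_le_one ha₀] at this
  obtain ⟨b, hb0, hb01, hbs, hbl⟩ := hpol (C₂ * z) (κ * τ * η) η (d * l) (by positivity)
    (mul_le_mul_of_nonneg_right (hzτ.trans (le_mul_of_one_le_left hz0.le hC₂1)) hη.le) hη hη1 (by positivity) ha (hβ.trans (by
      rw [mul_comm d l, pow_mul]
      gcongr))
  -- The polarization of the qubits that enter the cooling.
  obtain ⟨t, ht⟩ : ∃ t, t = 2 * routeTime d m (s + 2 * m) + W * s + 1 := ⟨_, rfl⟩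
  have hprep : ∃ k, MixU (oneKer k) ∧ k *ᵥ idleState d m N s (W * s) = diagState (b 0) := by
    rw [idleState, ← ht]
    refine exists_prepare_idle hN hcon (by rw [← hκ']; positivity) (by rwa [← hκ']) hσ hfix t
      (hb01 0).1 ?_
    rw [← hκ', ← hη', hb0]
    have hu : 2 * (L * (C₂ * z)) ≤ Δ * κ * t := by
      rw [div_le_iff₀ hΔ] at hW
      have h1 : (W * s : ℝ) ≤ t := by
        rw [ht]; push_cast
        have := (routeTime d m (s + 2 * m)).cast_nonneg (α := ℝ)
        linarith
      calc 2 * (L * (C₂ * z)) = 2 * L * C₂ * (κ * s) := by rw [hz]; ring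
        _ ≤ W * Δ * (κ * s) := by gcongr
        _ = Δ * κ * (W * s) := by ring
        _ ≤ _ := by gcongr
    have hu0 : 0 < 1 + Δ * κ * t := by positivity
    have h2 : L * (C₂ * z) ≤ Δ * κ * t / (1 + Δ * κ * t) := by
      rw [le_div_iff₀ hu0]
      have h3 : L * (C₂ * z) * (Δ * κ * t) ≤ 1 / 2 * (Δ * κ * t) := by
        gcongr
        linarith
      linarith
    calc L * (C₂ * z) * η = η * (L * (C₂ * z)) := by ring
      _ ≤ _ := by gcongr
  have hG : ∀ i < d * l, Gadget N (gap hd i) (lag hd i) (diagState (b i)) (diagState (b (i + 1))) := by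
    intro i hi
    have h1 := gap_le hd hi.le
    have h2 := lag_le hd hi.le
    rw [← hs] at h1 h2
    have e1 : 8 * κ * ((4 * s : ℕ) : ℝ) = 32 * z := by rw [hz]; push_cast; ring
    refine hgadget N _ _ _ hb (4 * s) _ _ (by omega) (by omega) (by rw [e1]; linarith) _ _
      (hb01 i).1 (hb01 i).2 (hb01 (i + 1)).1 ?_
    rw [hbs, e1, hC₂]
    have h3 : 0 ≤ 32 * z * (b i + η) := by
      have := (hb01 i).1
      positivity
    linarith
  -- The flip rate accounts for the defect after the cooling and for the final motion.
  obtain ⟨r, hr⟩ : ∃ r, r = (5 * C₂ + 64) * z / 2 := ⟨_, rfl⟩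
  have hr0 : 0 ≤ r := by rw [hr]; positivity
  have hr1 : r ≤ 1 / 2 := by rw [hr]; linarith
  have hlag : 8 * κ * (lag hd (d * l) : ℝ) ≤ 16 * z := by
    have h2 : (lag hd (d * l) : ℝ) ≤ 2 * s := by
      rw [hs]; exact_mod_cast lag_le hd le_rfl
    calc 8 * κ * (lag hd (d * l) : ℝ) ≤ 8 * κ * (2 * s) := by gcongr
      _ = 16 * z := by rw [hz]; ring
  have hfinal := hb.exists_final (t := lag hd (d * l)) (by linarith) (hb01 (d * l)).1 (hb01 (d * l)).2
    (show 0 ≤ 1 - 2 * r by linarith) (by rw [hr]; linarith)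
  obtain ⟨T, hT⟩ : ∃ T, T = roundTime hd m s (d * l) (W * s) := ⟨_, rfl⟩
  have hTs : (T : ℝ) ≤ R * s := by
    have h1 := routeTime_le d m s hs1
    have h2 := coolTime_mul_le hd l
    rw [← hR₀] at h1
    rw [← hs] at h2
    have h3 : T ≤ R * s := by
      rw [hT, hR, roundTime]
      calc _ ≤ 3 * s + (2 * (R₀ * s) + W * s) + 8 * d * s := by gcongr; omega
        _ = _ := by ring
    exact_mod_cast h3
  have hMd : 0 ≤ (3 * (M : ℝ)) ^ d := by positivity
  refine ⟨N ^ T * flipMap r, T, (2 * (m * (s + 2 * m)) + 1) ^ d,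
    (hN.pow T).mul (isChannel_flipMap hr0 (by linarith)), ?_, ?_, ?_, fun Λ' => ?_⟩
  · have h1 := strength_pow_mul_flipMap_le N T hr0 (by linarith)
    have h2 : 8 * κ * (T : ℝ) ≤ 8 * R * z := by
      calc 8 * κ * (T : ℝ) ≤ 8 * κ * (R * s) := by gcongr
        _ = _ := by rw [hz]; ring
    have h3 := norm_pow_sub_one_le_two_mul (qker N) T hb.norm_sub_one_le (by linarith)
    have h4 : C₃ * z ≤ C₃ * (3 * (κ * τ)) := by gcongr
    have h5 : 0 ≤ (3 * R + (3 * M) ^ d) * (κ * τ) := by positivity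
    rw [← hκ']
    calc _ ≤ C₃ * z := by rw [hC₃]; rw [hr] at h1 ⊢; linarith
      _ ≤ _ := by linarith
  · have h4 : R * (s : ℝ) ≤ R * (3 * τ) := by gcongr
    have h5 : 0 ≤ (3 * C₃ + (3 * M) ^ d) * τ := by positivity
    linarith
  · have h1 : 2 * (m * (s + 2 * m)) + 1 ≤ M * s := by
      rw [hM]
      nlinarith [Nat.mul_le_mul_left (m * m) hs1]
    have h2 : ((2 * (m * (s + 2 * m)) + 1 : ℕ) : ℝ) ≤ M * (3 * τ) := by
      calc _ ≤ ((M * s : ℕ) : ℝ) := by exact_mod_cast h1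
        _ = M * (s : ℝ) := by push_cast; ring
        _ ≤ _ := by gcongr
    have h5 : 0 ≤ (3 * C₃ + 3 * R) * τ ^ d := by positivity
    rw [Nat.cast_pow]
    calc _ ≤ (M * (3 * τ)) ^ d := by gcongr
      _ = (3 * M) ^ d * τ ^ d := by rw [← mul_pow]; ring
      _ ≤ _ := by linarith
  · rw [hT]
    exact exists_simulation hd hm N hN s (d * l) (W * s) (fun c => hs ▸ side_le hd le_rfl c)
      (fun i => diagState (b i)) hprep (trace_diagState _) hG hr0 (by linarith) hfinal Λ'

end NoisyCircuit

end

theorem mainTheorem3 (d m : ℕ) (hd : 1 ≤ d) (hm : 2 ≤ m)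
    (δ Δ c : ℝ) (hδ : 0 < δ) (hΔ : 0 < Δ) (hc : 0 < c)
    (μ : ℝ) (hμ : μ = Real.log 3 / Real.log (3 / 2) + δ) :
    ∃ (C : ℝ) (q : ℕ), 0 < C ∧
      ∀ (N : NoisyCircuit.QubitMap) (σ : Matrix (Fin 2) (Fin 2) ℂ) (κ η : ℝ),
        NoisyCircuit.IsChannel N → NoisyCircuit.IsContracting Δ N →
        NoisyCircuit.IsDensity σ → N σ = σ →
        κ = NoisyCircuit.strength N → η = NoisyCircuit.purity σ →
        0 < κ → 0 < η → κ ≤ c * η ^ (μ / d) →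
        ∃ N' : NoisyCircuit.QubitMap, NoisyCircuit.IsChannel N' ∧
          NoisyCircuit.strength N' ≤
            C * (κ * η ^ (-μ / d)) ^ (d / (μ + d)) * (1 + |Real.log (κ * η ^ (-μ / d))|) ^ q ∧
          ∀ Λ' : Finset (Fin d → ℤ), ∃ Λ : Finset (Fin d → ℤ),
            (Λ.card : ℝ) ≤
              C * (κ * η) ^ (-(μ * d) / (μ + d)) * (1 + |Real.log (κ * η ^ (-μ / d))|) ^ q *
                Λ'.card ∧
            ∀ D' : ℕ, ∃ D : ℕ,
              (D : ℝ) ≤ C * (κ * η) ^ (-μ / (μ + d)) * D' ∧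
              ∀ target : List (NoisyCircuit.Layer (NoisyCircuit.latticeGraph Λ') m),
                target.length = D' →
                NoisyCircuit.Simulates (NoisyCircuit.latticeGraph Λ) N D N' target := by
  have hd0 : (0 : ℝ) < d := by exact_mod_cast hd
  have hμ0 : 0 < μ := by
    have h1 : 0 < Real.log 3 := Real.log_pos (by norm_num)
    have h2 : 0 < Real.log (3 / 2) := Real.log_pos (by norm_num)
    rw [hμ]
    positivity
  have hs : 0 < μ + d := by positivity
  obtain ⟨y₀, C₁, hy₀, hC₁, small⟩ := NoisyCircuit.exists_hasSimulation_of_ge hd hm hΔ hδ hμ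
  obtain ⟨C₂, hC₂, large⟩ := NoisyCircuit.exists_hasSimulation_of_le hd hm hΔ
    (show 0 < Δ⁻¹ ^ (-μ / (μ + d)) by positivity) (lt_min hy₀ one_pos)
  refine ⟨max C₁ C₂, 0, lt_max_of_lt_left hC₁, ?_⟩
  intro N σ κ η hN hcon hσ hfix hκ hη hκ0 hη0 _
  have hκΔ := hcon.mul_strength_le_one
  have hη1 : η ≤ 1 := hη ▸ NoisyCircuit.purity_le_one hσ
  rw [← hκ] at hκΔ
  -- The side length of the boxes balances the defect `κ * τ` and the number `τ ^ d` of qubits.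
  obtain ⟨τ, hτ⟩ : ∃ τ, τ = (κ * η) ^ (-μ / (μ + d)) := ⟨_, rfl⟩
  have hκη : 0 < κ * η := mul_pos hκ0 hη0
  have hτ0 : 0 < τ := hτ ▸ Real.rpow_pos_of_pos hκη _
  have hexp : -μ / (μ + d) ≤ 0 := div_nonpos_of_nonpos_of_nonneg (by linarith) hs.le
  have hy : (κ * η ^ (-μ / d)) ^ (d / (μ + d)) = κ * τ := by
    rw [hτ, Real.mul_rpow hκ0.le (by positivity), ← Real.rpow_mul hη0.le,
      Real.mul_rpow hκ0.le hη0.le, ← mul_assoc]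
    nth_rewrite 2 [← Real.rpow_one κ]
    rw [← Real.rpow_add hκ0]
    congr 2
    · field_simp
      ring
    · field_simp
  have hβ : κ * τ * η = (κ * η) ^ (d / (μ + d)) := by
    rw [mul_right_comm, hτ]
    nth_rewrite 1 [← Real.rpow_one (κ * η)]
    rw [← Real.rpow_add hκη]
    congr 1
    field_simp
    ring
  have hτd : τ ^ d = (κ * η) ^ (-(μ * d) / (μ + d)) := by
    rw [hτ, ← Real.rpow_natCast, ← Real.rpow_mul hκη.le]
    congr 1
    ring
  have hβμ : (κ * τ * η) ^ (-μ) = τ ^ d := by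
    rw [hβ, hτd, ← Real.rpow_mul hκη.le]
    congr 1
    ring
  have main : NoisyCircuit.HasSimulation d m N τ (max C₁ C₂) := by
    rcases le_total (κ * τ) (min y₀ 1) with h | h
    · refine (small N σ hN hcon hσ hfix (hκ ▸ hκ0) (hη ▸ hη0) τ ?_ ?_ ?_).mono hτ0.le (le_max_left _ _)
      · rw [hτ]
        refine Real.one_le_rpow_of_pos_of_le_one_of_nonpos hκη ?_ hexp
        by_contra! h1
        have h2 := Real.one_lt_rpow h1 (show 0 < d / (μ + d) by positivity)
        rw [← hβ] at h2
        have h3 := h.trans (min_le_right _ _)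
        nlinarith [mul_pos hκ0 hτ0]
      · rw [← hκ]
        exact h.trans (min_le_left _ _)
      · rw [← hκ, ← hη, hβμ]
    · refine (large N hN (hκ ▸ hκΔ) τ ?_ (hκ ▸ h)).mono hτ0.le (le_max_right _ _)
      rw [hτ]
      refine Real.rpow_le_rpow_of_nonpos hκη ?_ hexp
      rw [← one_div, le_div_iff₀ hΔ]
      nlinarith
  obtain ⟨N', T, A, h1, h2, h3, h4, h5⟩ := main
  refine ⟨N', h1, ?_, fun Λ' => ?_⟩
  · rw [hy, pow_zero, mul_one, hκ]
    exact h2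
  · obtain ⟨Λ, h6, h7⟩ := h5 Λ'
    refine ⟨Λ, ?_, fun D' => ⟨T * D', ?_, ?_⟩⟩
    · rw [← hτd, pow_zero, mul_one]
      calc (Λ.card : ℝ) ≤ A * Λ'.card := by exact_mod_cast h6
        _ ≤ _ := by gcongr
    · rw [← hτ]
      push_cast
      gcongr
    · rintro target rfl
      exact h7 target
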